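/- **Conventions.** An algorithm is a probabilistic Turing machine, modelled by a finite control working on finitely many stacks over a finite alphabet, each step being a push, a pop or a fair coin flip. For a set $X$ of inputs, $T_{\mathcal A}(X)$ is the supremum, over inputs in $X$ and over all outcomes of the coins, of the number of steps until $\mathcal A$ halts. Formulas and networks are given to the algorithms as words (variable indices in unary; networks layer by layer as the list of their weights and biases). Real outputs are finite binary expansions. Let $k,C\ge 1$ be integers. Let $\mathcal S_k(n)$ be the set of CNF formulas in the variables $x_1,\dots,x_n$ with at most $k$ literals per clause, and $\widetilde{\mathcal S}_k(n)$ the set of those with at most $Cn$ clauses. A decision algorithm for $k$SAT halts on every $\alpha\in\bigcup_n\mathcal S_k(n)$, decides with probability at least $2/3$ correctly whether $\alpha$ is satisfiable, and accepts an input that is not such a formula with probability at most $1/3$. Put $$\widetilde s_k:=\inf\{s>0 : \text{there is a decision algorithm } \mathcal B \text{ for } k\text{SAT with } T_{\mathcal B}(\widetilde{\mathcal S}_k(n))=\mathcal O(2^{sn}) \text{ as } n\to\infty\}.$$ For a set $\theta\subset\mathbb R$, let $\mathcal N(m,w,L,\theta)$ be the set of feed-forward networks with $m$ inputs, one output, at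 most $L$ layers, all layers (input and output included) having between $1$ and $w$ neurons, and all weights and biases in $\theta$. Write $\mathcal R_\Phi$ for the realization of $\Phi$ with a fixed activation function $\sigma:\mathbb R\to\mathbb R$, applied after every layer but the last. **Theorem.** Let $0<\eta<1/2$ and let $\theta_r\subset\mathbb R$ be finite. Suppose that $\Psi\in\mathcal N(1,w_r,L_r,\theta_r)$ realizes a continuous function $r=\mathcal R_\Psi:\mathbb R\to[0,1]$ with $r(x)=0$ for $x\le 1/2$ and $r(x)=1$ for $x\ge 1-\eta$. Let $\theta_{\rm CNF}\subset\mathbb R$ be any finite set that contains all numbers $jab+c$ with $j\in\mathbb Z$, $|j|\le k$, and $a,b,c\in\theta_r\cup\{-1,0,1\}$. Let $\delta>0$ and let $d:\mathbb N\to\mathbb N$ satisfy $d(n)\ge n$ for all $n$. For $n\ge 0$ put $$\mathcal K(n):=\Big\{\Phi\in\bigcup_{\ell=1}^{n}\mathcal N\big(2\ell,\;C\cdot 2n\cdot w_r k,\;3L_r-2,\;\theta_{\rm CNF}\big) : \mathcal R_\Phi \text{ maps } [0,1]^{2\ell} \text{ to } [0,1]\Big\}.$$ For $\Phi\in\mathcal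 K(n)\setminus\mathcal K(n-1)$ with $2\ell$ inputs let $M_\Phi\in\mathbb R^{2^{d(n)}\times 2^{d(n)}}$ be the matrix with entries $$(M_\Phi)_{ij}=\mathcal R_\Phi\big(b(i)_1,\dots,b(i)_\ell,b(j)_1,\dots,b(j)_\ell\big),\qquad 0\le i,j<2^{d(n)},$$ where $b(i)\in\{0,1\}^{d(n)}$ is the binary representation of $i$. Let $\mathcal A$ be a probabilistic algorithm such that, for all $n\ge1$ and all $\Phi\in\mathcal K(n)\setminus\mathcal K(n-1)$, with probability at least $2/3$, $$\Big|\mathcal A(\Phi)-\frac{|M_\Phi\mathbf 1|}{\|M_\Phi\|_2\,|\mathbf 1|}\Big|<\tfrac12\,2^{-(1/2+1-\widetilde s_k+\delta)n},$$ where $|\cdot|$ is the Euclidean norm, $\|\cdot\|_2$ the spectral norm, $\mathbf 1$ the all-ones vector, and the quotient is $0$ if $M_\Phi=0$. If $T_{\mathcal A}(\mathcal K(n))=\mathcal O(2^{tn})$ as $n\to\infty$ for some $t>0$, then $t\ge 2\widetilde s_k$. -/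

import Mathlib

open MeasureTheory Filter
open scoped ENNReal

noncomputable section

/-! ### Probabilistic machines

A probabilistic machine has a finite control and finitely many stacks over a finite alphabet (a tape
of a Turing machine is a pair of stacks, so this is the multitape probabilistic Turing machine, up
to a constant factor in the running time). In one step it pushes one symbol, pops one symbol and
branches on it, or flips a fair coin and branches on the outcome. -/

/-- Instructions of a machine with stacks `K`, stack alphabet `Γ` and control states `Λ`. -/
inductive Instr (K Γ Λ : Type) : Type
  /-- Push `a` on stack `k`, then go to `next`. -/
  | push (k : K) (a : Γ) (next : Λ) : Instr K Γ Λ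
  /-- Pop stack `k` and branch on the removed symbol (`none` if the stack was empty). -/
  | pop (k : K) (next : Option Γ → Λ) : Instr K Γ Λ
  /-- Flip a fair coin and branch on the outcome. -/
  | flip (next : Bool → Λ) : Instr K Γ Λ
  /-- Stop. -/
  | halt : Instr K Γ Λ

/-- Probabilistic machines that read words over `ι` and write words over `ο`. -/
structure ProbMachine (ι ο : Type) where
  /-- the stacks -/
  K : Type
  /-- the stack alphabet -/
  Γ : Type
  /-- the control states -/
  Λ : Type
  [decK : DecidableEq K]
  [finK : Fintype K]
  [finΓ : Fintype Γ]
  [finΛ : Fintype Λ]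
  /-- the stack that holds the input at the start -/
  inStack : K
  /-- the stack that holds the output at the end -/
  outStack : K
  /-- how input symbols are written on the input stack -/
  inSym : ι → Γ
  /-- how symbols on the output stack are read -/
  outSym : Γ → ο
  /-- the initial state -/
  start : Λ
  /-- the program -/
  prog : Λ → Instr K Γ Λ

namespace ProbMachine

variable {ι ο : Type}

attribute [instance] ProbMachine.decK ProbMachine.finK ProbMachine.finΓ ProbMachine.finΛ

/-- A configuration: control state, contents of the stacks (top first), number of coins used. -/
structure Cfg (M : ProbMachine ι ο) where
  /-- current control state -/
  state : M.Λ
  /-- contents of the stacks -/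
  stk : M.K → List M.Γ
  /-- number of coin flips made so far -/
  coins : ℕ

/-- One step; `ω i` is the outcome of the `i`-th coin flip. A halted configuration stays put. -/
def step (M : ProbMachine ι ο) (ω : ℕ → Bool) (c : M.Cfg) : M.Cfg :=
  match M.prog c.state with
  | .push k a next => ⟨next, Function.update c.stk k (a :: c.stk k), c.coins⟩
  | .pop k next => ⟨next (c.stk k).head?, Function.update c.stk k (c.stk k).tail, c.coins⟩
  | .flip next => ⟨next (ω c.coins), c.stk, c.coins + 1⟩
  | .halt => c

/-- The initial configuration: the input on the input stack, all other stacks empty. -/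
def init (M : ProbMachine ι ο) (x : List ι) : M.Cfg :=
  ⟨M.start, Function.update (fun _ => []) M.inStack (x.map M.inSym), 0⟩

/-- The configuration after `t` steps on input `x` with coin flips `ω`. -/
def run (M : ProbMachine ι ο) (x : List ι) (ω : ℕ → Bool) (t : ℕ) : M.Cfg :=
  (M.step ω)^[t] (M.init x)

/-- The configuration `c` is a halting configuration. -/
def Halted (M : ProbMachine ι ο) (c : M.Cfg) : Prop := M.prog c.state = Instr.halt

/-- On input `x` and coin flips `ω` the machine halts with output `y`. -/
def HasOutput (M : ProbMachine ι ο) (x : List ι) (ω : ℕ → Bool) (y : List ο) : Prop :=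
  ∃ t, M.Halted (M.run x ω t) ∧ ((M.run x ω t).stk M.outStack).map M.outSym = y

/-- The number of steps until the machine halts (`⊤` if it does not). -/
def time (M : ProbMachine ι ο) (x : List ι) (ω : ℕ → Bool) : ℕ∞ :=
  ⨅ (t : ℕ) (_ : M.Halted (M.run x ω t)), (t : ℕ∞)

/-- The worst-case running time on a set of inputs. -/
def worstTime (M : ProbMachine ι ο) (X : Set (List ι)) : ℕ∞ :=
  ⨆ x ∈ X, ⨆ ω : ℕ → Bool, M.time x ω

/-- The worst-case running time on `X n` is `O(2 ^ (s * n))` as `n → ∞`. -/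
def RunsInExpTime (M : ProbMachine ι ο) (X : ℕ → Set (List ι)) (s : ℝ) : Prop :=
  ∃ c : ℝ, ∀ᶠ n : ℕ in atTop,
    ((M.worstTime (X n) : ℕ∞) : ℝ≥0∞) ≤ ENNReal.ofReal (c * (2 : ℝ) ^ (s * (n : ℝ)))

end ProbMachine

/-- The law of a sequence of independent fair coin flips. -/
def coinMeasure : Measure (ℕ → Bool) :=
  Measure.infinitePi fun _ : ℕ => (PMF.uniformOfFintype Bool).toMeasure

/-! ### Satisfiability -/

/-- A literal `(i, true)` is the variable `x_i`, and `(i, false)` is its negation; variables are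
numbered from `0`. A clause is a list of literals. -/
abbrev Clause := List (ℕ × Bool)

/-- A formula in conjunctive normal form is a list of clauses. -/
abbrev CNF := List Clause

/-- Some assignment makes a literal of each clause true. -/
def CNF.Satisfiable (α : CNF) : Prop :=
  ∃ x : ℕ → Bool, ∀ c ∈ α, ∃ l ∈ c, x l.1 = l.2

/-- Formulas in the variables `x_0, …, x_{n-1}` with at most `k` literals per clause. -/
def kCNF (k n : ℕ) : Set CNF :=
  {α | ∀ c ∈ α, c.length ≤ k ∧ ∀ l ∈ c, l.1 < n}

/-- Formulas in `kCNF k n` with at most `C * n` clauses. -/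
def sparseKCNF (k C n : ℕ) : Set CNF :=
  {α | α ∈ kCNF k n ∧ α.length ≤ C * n}

/-- The symbols used to write down formulas. -/
inductive CNFSym : Type
  | tick
  | literal (sign : Bool)
  | endClause

/-- The literal `(i, γ)` is written as `i` ticks followed by its sign. -/
def encodeLiteral (l : ℕ × Bool) : List CNFSym :=
  List.replicate l.1 CNFSym.tick ++ [CNFSym.literal l.2]

/-- A formula as a word. -/
def encodeCNF (α : CNF) : List CNFSym :=
  α.flatMap fun c => c.flatMap encodeLiteral ++ [CNFSym.endClause]

/-- `M` is a probabilistic decision algorithm for `k`SAT (output `1` for "satisfiable"): it halts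
on all `k`-CNF formulas, its answer on each of them is correct with probability at least `2/3`, and
a word that does not encode a `k`-CNF formula is accepted with probability at most `1/3`. -/
structure DecidesKSAT (k : ℕ) (M : ProbMachine CNFSym Bool) : Prop where
  halts : ∀ n, ∀ α ∈ kCNF k n, ∀ ω, ∃ y, M.HasOutput (encodeCNF α) ω y
  sat : ∀ n, ∀ α ∈ kCNF k n, α.Satisfiable →
    2 / 3 ≤ coinMeasure {ω | M.HasOutput (encodeCNF α) ω [true]}
  unsat : ∀ n, ∀ α ∈ kCNF k n, ¬ α.Satisfiable →
    2 / 3 ≤ coinMeasure {ω | M.HasOutput (encodeCNF α) ω [false]}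
  invalid : ∀ x : List CNFSym, (∀ n, ∀ α ∈ kCNF k n, encodeCNF α ≠ x) →
    coinMeasure {ω | M.HasOutput x ω [true]} ≤ 1 / 3

/-- The exponent of `k`SAT on formulas with at most `C * n` clauses: the infimum of all `s > 0`
such that `k`SAT has a decision algorithm that takes time `O(2 ^ (s * n))` on these formulas. -/
def sTilde (k C : ℕ) : ℝ :=
  sInf {s : ℝ | 0 < s ∧ ∃ M : ProbMachine CNFSym Bool, DecidesKSAT k M ∧
    M.RunsInExpTime (fun n => encodeCNF '' sparseKCNF k C n) s}

/-! ### Neural networks -/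

/-- Feed-forward networks with `m` inputs, one output and weights in `θ`, given by their weight
matrices and bias vectors, from the first layer to the last. -/
inductive Net (θ : Finset ℝ) : ℕ → Type
  /-- the last layer, which is affine -/
  | last {m : ℕ} (W : Fin m → θ) (b : θ) : Net θ m
  /-- a layer of `p` neurons, followed by the rest of the network -/
  | layer {m p : ℕ} (W : Matrix (Fin p) (Fin m) θ) (b : Fin p → θ) (rest : Net θ p) : Net θ m

namespace Net

variable {θ : Finset ℝ}

/-- The realization of a network with activation function `σ`. -/
def realize (σ : ℝ → ℝ) : {m : ℕ} → Net θ m → (Fin m → ℝ) → ℝ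
  | _, last W b, x => ∑ j, (W j : ℝ) * x j + (b : ℝ)
  | _, layer W b rest, x => rest.realize σ fun i => σ (∑ j, (W i j : ℝ) * x j + (b i : ℝ))

/-- The number of layers. -/
def depth : {m : ℕ} → Net θ m → ℕ
  | _, last _ _ => 1
  | _, layer _ _ rest => rest.depth + 1

/-- All layers, the input and the output layer included, have between `1` and `w` neurons. -/
def WidthLE (w : ℕ) : {m : ℕ} → Net θ m → Prop
  | m, last _ _ => (1 ≤ m ∧ m ≤ w) ∧ 1 ≤ w
  | m, layer _ _ rest => (1 ≤ m ∧ m ≤ w) ∧ rest.WidthLE w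

end Net

/-- Networks with `m` inputs, width at most `w`, depth at most `L` and weights in `θ`. -/
def netClass (m w L : ℕ) (θ : Finset ℝ) : Set (Net θ m) :=
  {Φ | Φ.WidthLE w ∧ Φ.depth ≤ L}

/-- The symbols used to write down networks with weights in `θ`. -/
inductive NetSym (θ : Finset ℝ) : Type
  | weight (a : θ)
  | endNeuron
  | endLayer

/-- A network as a word: layer by layer and neuron by neuron, the weights followed by the bias. -/
def encodeNet {θ : Finset ℝ} : {m : ℕ} → Net θ m → List (NetSym θ)
  | _, .last W b =>
      (List.ofFn fun j => NetSym.weight (W j)) ++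
        [NetSym.weight b, NetSym.endNeuron, NetSym.endLayer]
  | _, .layer W b rest =>
      (List.ofFn fun i => (List.ofFn fun j => NetSym.weight (W i j)) ++
        [NetSym.weight (b i), NetSym.endNeuron]).flatten ++ [NetSym.endLayer] ++ encodeNet rest

/-- The weights and biases that occur when copies of a network with weights in `θr` (together with
`-1`, `0`, `1`) are composed and added up to evaluate a `k`-CNF formula. -/
def cnfWeights (k : ℕ) (θr : Finset ℝ) : Set ℝ :=
  {x | ∃ j : ℤ, |j| ≤ (k : ℤ) ∧ ∃ a ∈ (θr : Set ℝ) ∪ {-1, 0, 1},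
    ∃ b ∈ (θr : Set ℝ) ∪ {-1, 0, 1}, ∃ c ∈ (θr : Set ℝ) ∪ {-1, 0, 1}, x = j * a * b + c}

/-- The networks with `2ℓ` inputs, `1 ≤ ℓ ≤ n`, of width at most `C * (2n) * wr * k` and depth at
most `3 * Lr - 2`, which map `[0,1]^(2ℓ)` to `[0,1]`. -/
def mvmClass (σ : ℝ → ℝ) (k C wr Lr : ℕ) (θ : Finset ℝ) (n : ℕ) : Set (Σ ℓ : ℕ, Net θ (2 * ℓ)) :=
  {Φ | 1 ≤ Φ.1 ∧ Φ.1 ≤ n ∧ Φ.2 ∈ netClass (2 * Φ.1) (C * (2 * n) * wr * k) (3 * Lr - 2) θ ∧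
    ∀ x : Fin (2 * Φ.1) → ℝ, (∀ i, x i ∈ Set.Icc (0 : ℝ) 1) →
      Φ.2.realize σ x ∈ Set.Icc (0 : ℝ) 1}

/-! ### Matrices encoded by networks -/

/-- The digit number `p` (from `0`, most significant digit first) of the binary representation of
`i < 2 ^ d` with `d` digits. -/
def binDigit (d i p : ℕ) : ℝ := if i.testBit (d - 1 - p) then 1 else 0

/-- The `2^d × 2^d` matrix of a network with `2ℓ` inputs, `ℓ ≤ d`: the entry `(i, j)` is the value
at the first `ℓ` binary digits of `i` followed by the first `ℓ` binary digits of `j`. -/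
def netMatrix {θ : Finset ℝ} (σ : ℝ → ℝ) (d : ℕ) {ℓ : ℕ} (Φ : Net θ (2 * ℓ)) :
    Matrix (Fin (2 ^ d)) (Fin (2 ^ d)) ℝ :=
  Matrix.of fun i j => Φ.realize σ fun p =>
    if (p : ℕ) < ℓ then binDigit d i p else binDigit d j ((p : ℕ) - ℓ)

/-- `|M 1| / (‖M‖₂ |1|)` with Euclidean norms, the spectral norm, and the all-ones vector `1`. It
is `0` for `M = 0`. -/
def mvmRatio {N : ℕ} (M : Matrix (Fin N) (Fin N) ℝ) : ℝ :=
  ‖WithLp.toLp 2 (M.mulVec 1)‖ /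
    (‖Matrix.toEuclideanCLM (𝕜 := ℝ) M‖ * ‖WithLp.toLp 2 (1 : Fin N → ℝ)‖)

/-! ### Approximation algorithms -/

/-- The symbols used to write down real numbers. -/
inductive NumSym : Type
  | minus
  | point
  | digit (b : Bool)

/-- A finite binary expansion as a word: sign, integer digits (most significant digit first),
point, fractional digits. -/
def numeral (neg : Bool) (ip fp : List Bool) : List NumSym :=
  (if neg then [NumSym.minus] else []) ++ ip.map NumSym.digit ++ [NumSym.point] ++
    fp.map NumSym.digit

/-- The number `0.b₁b₂…` in binary. -/
def fracValue : List Bool → ℝ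
  | [] => 0
  | b :: l => ((if b then 1 else 0) + fracValue l) / 2

/-- The real number written as `numeral neg ip fp`. -/
def numeralValue (neg : Bool) (ip fp : List Bool) : ℝ :=
  (if neg then -1 else 1) *
    (ip.foldl (fun v b => 2 * v + (if b then 1 else 0)) 0 + fracValue fp)

/-- With probability at least `2/3` the machine `A` halts on input `x` and outputs a number that
differs from `y` by less than `ε`. -/
def Approximates {ι : Type} (A : ProbMachine ι NumSym) (x : List ι) (y ε : ℝ) : Prop :=
  2 / 3 ≤ coinMeasure {ω | ∃ neg ip fp, A.HasOutput x ω (numeral neg ip fp) ∧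
    |numeralValue neg ip fp - y| < ε}

end

/-!
The step function `r` turns truth values into numbers. On a `0`-`1` input the sum of the literals
of a clause is `0` if the clause is false and at least `1` if it is true, so `r` of this sum is the
truth value of the clause, and `r (1 + ∑ (truth value - 1))`, over the clauses, is the truth value
of the formula. Copies of the network for `r`, placed side by side, realize this with few neurons;
writing `-1` as `-r 1` makes the biases of their last layers cancel.

Let the `2ℓ` variables be divided into a row index and a column index. The matrix of this network
is `0` exactly if the formula is unsatisfiable; otherwise it is a `0`-`1` matrix, up to repetition
of size `2 ^ ℓ`, and comparing its Frobenius norm with its row sums shows that the ratio is at least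
`2 ^ (-ℓ / 2)`. A formula in `n` variables is thus decided by approximating the ratio with
`ℓ ≈ n / 2` up to an error of half this bound, in time `2 ^ (t * n / 2)`, whence `s̃ ≤ t / 2`. The
error granted by the theorem is this small since `s̃ ≤ 1` by exhaustive search. For `k = 1`, where
the network may be too wide for the class, `s̃ = 0` because `1`SAT is decided in polynomial time.
-/

noncomputable section

/-! ### Runs of a stack machine -/

namespace ProbMachine

variable {ι ο : Type} {M : ProbMachine ι ο} {ω : ℕ → Bool} {x : List ι}

theorem step_of_halted {c : M.Cfg} (h : M.Halted c) : M.step ω c = c := by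
  unfold Halted at h
  unfold step
  rw [h]

theorem run_eq_of_halted {t t' : ℕ} (h : M.Halted (M.run x ω t)) (htt' : t ≤ t') :
    M.run x ω t' = M.run x ω t := by
  obtain ⟨d, rfl⟩ := Nat.exists_eq_add_of_le' htt'
  rw [run, Function.iterate_add_apply]
  exact Function.iterate_fixed (step_of_halted h) d

theorem HasOutput.unique {y y' : List ο} (h : M.HasOutput x ω y) (h' : M.HasOutput x ω y') :
    y = y' := by
  obtain ⟨t, ht, rfl⟩ := h
  obtain ⟨t', ht', rfl⟩ := h'
  rcases le_total t t' with htt | htt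
  · rw [run_eq_of_halted ht htt]
  · rw [run_eq_of_halted ht' htt]

theorem exists_halted_le {b : ℝ} (h : ((M.time x ω : ℕ∞) : ℝ≥0∞) ≤ ENNReal.ofReal b) :
    ∃ t : ℕ, M.Halted (M.run x ω t) ∧ (t : ℝ) ≤ max b 0 := by
  have hfin : M.time x ω ≠ ⊤ := by
    intro htop
    simp [htop] at h
  obtain ⟨T, hT⟩ := ENat.ne_top_iff_exists.1 hfin
  have hlt : M.time x ω < ((T + 1 : ℕ) : ℕ∞) := by
    rw [← hT]
    exact_mod_cast Nat.lt_succ_self T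
  unfold time at hlt
  simp only [iInf_lt_iff] at hlt
  obtain ⟨t, ht, htT⟩ := hlt
  have hle : t ≤ T := Nat.lt_succ_iff.1 (by exact_mod_cast htT)
  have hTb : (T : ℝ) ≤ max b 0 := by
    rw [← hT] at h
    simpa using ENNReal.toReal_le_of_le_ofReal (le_max_right b 0)
      (h.trans (ENNReal.ofReal_le_ofReal (le_max_left b 0)))
  exact ⟨t, ht, (Nat.cast_le.2 hle).trans hTb⟩

theorem RunsInExpTime.exists_halted {X : ℕ → Set (List ι)} {s : ℝ} (hs : 0 ≤ s)
    (h : M.RunsInExpTime X s) :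
    ∃ c : ℝ, 0 ≤ c ∧ ∀ n x, (∀ m, n ≤ m → x ∈ X m) → ∀ ω, ∃ t : ℕ,
      M.Halted (M.run x ω t) ∧ (t : ℝ) ≤ c * (2 : ℝ) ^ (s * n) := by
  obtain ⟨c, hc⟩ := h
  obtain ⟨n₀, hn₀⟩ := eventually_atTop.1 hc
  refine ⟨max c 0 * (2 : ℝ) ^ (s * n₀), by positivity, fun n x hx ω => ?_⟩
  have h_time : M.time x ω ≤ M.worstTime (X (max n₀ n)) :=
    le_iSup₂_of_le x (hx _ (le_max_right _ _)) (le_iSup (M.time x) ω)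
  obtain ⟨t, h_halted, ht⟩ := exists_halted_le
    ((ENat.toENNReal_le.2 h_time).trans (hn₀ _ (le_max_left _ _)))
  refine ⟨t, h_halted, ht.trans (max_le ?_ (by positivity))⟩
  rw [mul_assoc, ← Real.rpow_add two_pos, ← mul_add]
  have h_max : ((max n₀ n : ℕ) : ℝ) ≤ n₀ + n := by
    exact_mod_cast max_le (Nat.le_add_right _ _) (Nat.le_add_left _ _)
  gcongr
  exacts [le_max_left _ _, one_le_two]

theorem length_step_le (c : M.Cfg) (k : M.K) :
    ((M.step ω c).stk k).length ≤ (c.stk k).length + 1 := by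
  unfold step
  cases M.prog c.state <;> dsimp only
  · simp only [Function.update_apply]
    split_ifs with hk <;> simp_all
  · simp only [Function.update_apply]
    split_ifs with hk <;> simp_all; omega
  · omega
  · omega

theorem length_iterate_le (t : ℕ) (c : M.Cfg) (k : M.K) :
    (((M.step ω)^[t] c).stk k).length ≤ (c.stk k).length + t := by
  induction t with
  | zero => rfl
  | succ t ih =>
    rw [Function.iterate_succ_apply']
    have := length_step_le (ω := ω) ((M.step ω)^[t] c) k
    omega

theorem length_outStack_le (t : ℕ) :
    ((M.run x ω t).stk M.outStack).length ≤ x.length + t := by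
  have h_init : ((M.init x).stk M.outStack).length ≤ x.length := by
    by_cases h_out : M.outStack = M.inStack <;> simp [init, h_out]
  exact (length_iterate_le t (M.init x) M.outStack).trans (by omega)

end ProbMachine

/-! ### Programs for the stack machine -/

/-- The contents of the stacks, together with the number of coins used. -/
structure Memory (K Γ : Type) where
  stk : K → List Γ
  coins : ℕ

namespace Instr

variable {K Γ Λ Λ' : Type}

/-- Relabel the targets of an instruction. -/
def map (f : Λ → Λ') : Instr K Γ Λ → Instr K Γ Λ'
  | push k a n => push k a (f n)
  | pop k g => pop k fun o => f (g o)
  | flip g => flip fun b => f (g b)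
  | halt => halt

/-- Execute one instruction; `none` if it is `halt`. -/
def exec [DecidableEq K] (ω : ℕ → Bool) : Instr K Γ Λ → Memory K Γ → Option (Λ × Memory K Γ)
  | push k a n, m => some (n, ⟨Function.update m.stk k (a :: m.stk k), m.coins⟩)
  | pop k g, m => some (g (m.stk k).head?, ⟨Function.update m.stk k (m.stk k).tail, m.coins⟩)
  | flip g, m => some (g (ω m.coins), ⟨m.stk, m.coins + 1⟩)
  | halt, _ => none

theorem exec_map [DecidableEq K] (ω : ℕ → Bool) (f : Λ → Λ') (i : Instr K Γ Λ) (m : Memory K Γ)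
    {l : Λ} {m' : Memory K Γ} (h : i.exec ω m = some (l, m')) :
    (i.map f).exec ω m = some (f l, m') := by
  cases i <;> simp_all [map, exec]

end Instr

theorem ProbMachine.step_of_exec {ι ο : Type} {M : ProbMachine ι ο} {ω : ℕ → Bool}
    {l l' : M.Λ} {m m' : Memory M.K M.Γ} (h : (M.prog l).exec ω m = some (l', m')) :
    M.step ω ⟨l, m.stk, m.coins⟩ = ⟨l', m'.stk, m'.coins⟩ := by
  unfold ProbMachine.step
  dsimp only
  cases hp : M.prog l <;> rw [hp] at h <;>
    simp only [Instr.exec, Option.some.injEq, Prod.mk.injEq, reduceCtorEq] at h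
  all_goals obtain ⟨rfl, rfl⟩ := h; rfl

/-- A program with finite control that leaves through an exit in `E`. Unlike a `ProbMachine` it can
be composed with others: the exit taken is the value that it returns. -/
structure Routine (K Γ E : Type) where
  Λ : Type
  [fin : Finite Λ]
  start : Λ
  prog : Λ → Instr K Γ (Λ ⊕ E)

namespace Routine

attribute [instance] Routine.fin

variable {K Γ E F S : Type}

/-- From state `l` and memory `m` the routine leaves through `e` with memory `m'` after exactly `t`
steps. -/
inductive Path [DecidableEq K] (p : Routine K Γ E) (ω : ℕ → Bool) :
    p.Λ → Memory K Γ → E → Memory K Γ → ℕ → Prop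
  | exit {l m e m'} : (p.prog l).exec ω m = some (.inr e, m') → Path p ω l m e m' 1
  | next {l m l' m' e m'' t} : (p.prog l).exec ω m = some (.inl l', m') →
      Path p ω l' m' e m'' t → Path p ω l m e m'' (t + 1)

/-- Push one symbol. -/
def push (k : K) (a : Γ) : Routine K Γ Unit where
  Λ := Unit
  start := ()
  prog _ := .push k a (.inr ())

/-- Pop one symbol and return it. -/
def pop (k : K) : Routine K Γ (Option Γ) where
  Λ := Unit
  start := ()
  prog _ := .pop k .inr

/-- Leave with `e` without changing the memory. Every instruction other than `halt` acts on a stack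
or uses a coin, so this takes a push that is undone by a pop. -/
def ret [Inhabited K] [Inhabited Γ] (e : E) : Routine K Γ E where
  Λ := Bool
  start := false
  prog
    | false => .push default default (.inl true)
    | true => .pop default fun _ => .inr e

/-- Sequencing. -/
def bind [Finite E] (p : Routine K Γ E) (f : E → Routine K Γ F) : Routine K Γ F where
  Λ := p.Λ ⊕ Σ e, (f e).Λ
  start := .inl p.start
  prog
    | .inl l => (p.prog l).map
        (Sum.elim (fun l' => .inl (.inl l')) (fun e => .inl (.inr ⟨e, (f e).start⟩)))
    | .inr ⟨e, l⟩ => ((f e).prog l).map (Sum.elim (fun l' => .inl (.inr ⟨e, l'⟩)) .inr)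

/-- Iteration: run `body` until it returns an element of `E`. -/
def loop [Finite S] (body : S → Routine K Γ (S ⊕ E)) (x : S) : Routine K Γ E where
  Λ := Σ y, (body y).Λ
  start := ⟨x, (body x).start⟩
  prog
    | ⟨y, l⟩ => ((body y).prog l).map
        (Sum.elim (fun l' => .inl ⟨y, l'⟩)
          (Sum.elim (fun z => .inl ⟨z, (body z).start⟩) .inr))

variable [DecidableEq K] {ω : ℕ → Bool}

theorem path_push (k : K) (a : Γ) (m : Memory K Γ) :
    (push k a).Path ω () m () ⟨Function.update m.stk k (a :: m.stk k), m.coins⟩ 1 :=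
  .exit rfl

theorem path_pop (k : K) (m : Memory K Γ) :
    (pop k).Path ω () m (m.stk k).head? ⟨Function.update m.stk k (m.stk k).tail, m.coins⟩ 1 :=
  .exit rfl

theorem path_ret [Inhabited K] [Inhabited Γ] (e : E) (m : Memory K Γ) :
    (ret e : Routine K Γ E).Path ω false m e m 2 := by
  refine .next (l' := true) rfl (.exit ?_)
  simp [ret, Instr.exec]

theorem path_bind_right [Finite E] {p : Routine K Γ E} {f : E → Routine K Γ F} {e : E}
    {l m e' m' t} (h : (f e).Path ω l m e' m' t) :
    (p.bind f).Path ω (.inr ⟨e, l⟩) m e' m' t := by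
  induction h with
  | exit h => exact .exit (Instr.exec_map ω _ _ _ h)
  | next h _ ih => exact .next (Instr.exec_map ω _ _ _ h) ih

theorem path_bind [Finite E] {p : Routine K Γ E} {f : E → Routine K Γ F} {l m e m' t e' m'' t'}
    (h : p.Path ω l m e m' t) (h' : (f e).Path ω (f e).start m' e' m'' t') :
    (p.bind f).Path ω (.inl l) m e' m'' (t + t') := by
  induction h with
  | exit h => rw [Nat.add_comm]; exact .next (Instr.exec_map ω _ _ _ h) (path_bind_right h')
  | next h _ ih => rw [Nat.add_right_comm]; exact .next (Instr.exec_map ω _ _ _ h) (ih h')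

theorem path_loop_exit [Finite S] {body : S → Routine K Γ (S ⊕ E)} {x y : S} {l m e m' t}
    (h : (body y).Path ω l m (.inr e) m' t) : (loop body x).Path ω ⟨y, l⟩ m e m' t := by
  generalize hr : (Sum.inr e : S ⊕ E) = r at h
  induction h with
  | exit h => subst hr; exact .exit (Instr.exec_map ω _ _ _ h)
  | next h _ ih => exact .next (Instr.exec_map ω _ _ _ h) (ih hr)

theorem path_loop_again [Finite S] {body : S → Routine K Γ (S ⊕ E)} {x y z : S}
    {l m m' t e m'' t'} (h : (body y).Path ω l m (.inl z) m' t)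
    (h' : (loop body x).Path ω ⟨z, (body z).start⟩ m' e m'' t') :
    (loop body x).Path ω ⟨y, l⟩ m e m'' (t + t') := by
  generalize hr : (Sum.inl z : S ⊕ E) = r at h
  induction h with
  | exit h => subst hr; rw [Nat.add_comm]; exact .next (Instr.exec_map ω _ _ _ h) h'
  | next h _ ih => rw [Nat.add_right_comm]; exact .next (Instr.exec_map ω _ _ _ h) (ih h' hr)

theorem path_loop_start [Finite S] {body : S → Routine K Γ (S ⊕ E)} {x x' : S}
    {l m e m' t} (h : (loop body x).Path ω l m e m' t) : (loop body x').Path ω l m e m' t := by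
  induction h with
  | exit h => exact .exit h
  | next h _ ih => exact .next h ih

/-- The machine that runs a routine and halts at its exits. -/
def toMachine {ι ο : Type} [Fintype K] [Fintype Γ] [Finite E] (p : Routine K Γ E)
    (inStack outStack : K) (inSym : ι → Γ) (outSym : Γ → ο) : ProbMachine ι ο where
  K := K
  Γ := Γ
  Λ := p.Λ ⊕ E
  finΛ := Fintype.ofFinite _
  inStack := inStack
  outStack := outStack
  inSym := inSym
  outSym := outSym
  start := .inl p.start
  prog := Sum.elim p.prog fun _ => .halt

theorem toMachine_iterate {ι ο : Type} [Fintype K] [Fintype Γ] [Finite E] (p : Routine K Γ E)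
    (inStack outStack : K) (inSym : ι → Γ) (outSym : Γ → ο) {l m e m' t}
    (h : p.Path ω l m e m' t) :
    ((p.toMachine inStack outStack inSym outSym).step ω)^[t] ⟨.inl l, m.stk, m.coins⟩ =
      ⟨.inr e, m'.stk, m'.coins⟩ := by
  have key : ∀ (l : p.Λ) (m : Memory K Γ) (x : p.Λ ⊕ E) (m' : Memory K Γ),
      (p.prog l).exec ω m = some (x, m') →
      (p.toMachine inStack outStack inSym outSym).step ω ⟨.inl l, m.stk, m.coins⟩ =
        ⟨x, m'.stk, m'.coins⟩ := fun l m x m' h =>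
    ProbMachine.step_of_exec (M := p.toMachine inStack outStack inSym outSym) (l := .inl l) h
  induction h with
  | exit h => exact key _ _ _ _ h
  | next h _ ih => rw [Function.iterate_succ_apply, key _ _ _ _ h]; exact ih

end Routine

/-- The names of the working stacks: `input` is the word to be read and `saved` the part already
read; `row` holds one entry per variable and `aux` the entries already passed; `units`, `blocks`,
`finished` and `precision` are counters used in writing the network; `net` is the output word
under construction, reversed, and `answer` receives the decision. -/
inductive Reg : Type
  | input | saved | row | aux | units | blocks | finished | precision | net | answer
  deriving DecidableEq

instance : Fintype Reg :=
  ⟨{.input, .saved, .row, .aux, .units, .blocks, .finished, .precision, .net, .answer},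
    fun k => by cases k <;> decide⟩

/-- Contents of the working stacks and of further stacks `Ext`. -/
structure Store (Ext Γ : Type) where
  ext : Ext → List Γ
  input : List Γ
  saved : List Γ
  row : List Γ
  aux : List Γ
  units : List Γ
  blocks : List Γ
  finished : List Γ
  precision : List Γ
  net : List Γ
  answer : List Γ
  coins : ℕ

namespace Store

variable {Ext Γ : Type}

/-- The contents of a register. -/
def get (s : Store Ext Γ) : Reg → List Γ
  | .input => s.input
  | .saved => s.saved
  | .row => s.row
  | .aux => s.aux
  | .units => s.units
  | .blocks => s.blocks
  | .finished => s.finished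
  | .precision => s.precision
  | .net => s.net
  | .answer => s.answer

/-- Overwrite a register. -/
def set (s : Store Ext Γ) (k : Reg) (l : List Γ) : Store Ext Γ :=
  match k with
  | .input => { s with input := l }
  | .saved => { s with saved := l }
  | .row => { s with row := l }
  | .aux => { s with aux := l }
  | .units => { s with units := l }
  | .blocks => { s with blocks := l }
  | .finished => { s with finished := l }
  | .precision => { s with precision := l }
  | .net => { s with net := l }
  | .answer => { s with answer := l }

theorem get_set (s : Store Ext Γ) (k k' : Reg) (l : List Γ) :
    (s.set k l).get k' = if k' = k then l else s.get k' := by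
  cases k <;> cases k' <;> rfl

@[simp] theorem ext_set (s : Store Ext Γ) (k : Reg) (l : List Γ) : (s.set k l).ext = s.ext := by
  cases k <;> rfl

@[simp] theorem coins_set (s : Store Ext Γ) (k : Reg) (l : List Γ) :
    (s.set k l).coins = s.coins := by
  cases k <;> rfl

theorem eq_of_get {s s' : Store Ext Γ} (hext : s.ext = s'.ext) (hcoins : s.coins = s'.coins)
    (hget : ∀ k, s.get k = s'.get k) : s = s' := by
  cases s
  cases s'
  exact (Store.mk.injEq ..).mpr ⟨hext, hget .input, hget .saved, hget .row, hget .aux, hget .units,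
    hget .blocks, hget .finished, hget .precision, hget .net, hget .answer, hcoins⟩

/-- The store as a memory. -/
def toMemory (s : Store Ext Γ) : Memory (Ext ⊕ Reg) Γ := ⟨Sum.elim s.ext s.get, s.coins⟩

theorem toMemory_set [DecidableEq Ext] (s : Store Ext Γ) (k : Reg) (l : List Γ) :
    (s.set k l).toMemory = ⟨Function.update s.toMemory.stk (.inr k) l, s.toMemory.coins⟩ := by
  simp only [toMemory, coins_set, ext_set, Memory.mk.injEq, and_true]
  funext x
  rcases x with x | x
  · simp
  · simp [Function.update_apply, get_set]

theorem toMemory_setExt [DecidableEq Ext] (s : Store Ext Γ) (k : Ext) (l : List Γ) :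
    ({ s with ext := Function.update s.ext k l } : Store Ext Γ).toMemory =
      ⟨Function.update s.toMemory.stk (.inl k) l, s.toMemory.coins⟩ := by
  simp only [toMemory, Memory.mk.injEq, and_true]
  funext x
  rcases x with x | x
  · simp [Function.update_apply]
  · simp; rfl

end Store

instance : Inhabited CNFSym := ⟨.tick⟩

instance : Inhabited Reg := ⟨.aux⟩

instance : Finite CNFSym :=
  Finite.of_injective (β := Option (Option Bool))
    (fun | .tick => none | .endClause => some none | .literal b => some (some b))
    (by rintro (_ | _ | _) (_ | _ | _) h <;> simp_all)

/-- Routines on the working stacks and on further stacks `Ext`, with the symbols of formulas and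
further symbols `X`. -/
abbrev Code (Ext X E : Type) := Routine (Ext ⊕ Reg) (CNFSym ⊕ X) E

namespace Code

variable {Ext X E F S : Type} [DecidableEq Ext]

instance : Inhabited (CNFSym ⊕ X) := ⟨.inl default⟩

/-- The routine `p` started with `s` leaves through `e` with `s'` within `T` steps. -/
def Runs (p : Code Ext X E) (ω : ℕ → Bool) (s : Store Ext (CNFSym ⊕ X)) (e : E)
    (s' : Store Ext (CNFSym ⊕ X)) (T : ℕ) : Prop :=
  ∃ t ≤ T, p.Path ω p.start s.toMemory e s'.toMemory t

/-- Push on a register. -/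
def push (k : Reg) (a : CNFSym ⊕ X) : Code Ext X Unit := Routine.push (.inr k) a

/-- Pop a register. -/
def pop (k : Reg) : Code Ext X (Option (CNFSym ⊕ X)) := Routine.pop (.inr k)

/-- Return a value. -/
def ret (e : E) : Code Ext X E := Routine.ret e

/-- Sequencing. -/
def bind [Finite E] (p : Code Ext X E) (f : E → Code Ext X F) : Code Ext X F := Routine.bind p f

/-- Sequencing, ignoring the value. -/
def andThen (p : Code Ext X Unit) (q : Code Ext X F) : Code Ext X F := p.bind fun _ => q

/-- Iteration. -/
def loop [Finite S] (body : S → Code Ext X (S ⊕ E)) (x : S) : Code Ext X E := Routine.loop body x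

variable {ω : ℕ → Bool} {s s' s'' : Store Ext (CNFSym ⊕ X)} {T T' : ℕ}

theorem Runs.congr {p : Code Ext X E} {e e' : E} (h : Runs p ω s e s' T) (he : e = e')
    (hs : s' = s'') (hT : T ≤ T') : Runs p ω s e' s'' T' := by
  subst hs he
  obtain ⟨t, ht, h⟩ := h
  exact ⟨t, ht.trans hT, h⟩

theorem Runs.mono {p : Code Ext X E} {e : E} (h : Runs p ω s e s' T) (hT : T ≤ T') :
    Runs p ω s e s' T' := h.congr rfl rfl hT

theorem runs_push (k : Reg) (a : CNFSym ⊕ X) :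
    Runs (push k a) ω s () (s.set k (a :: s.get k)) 1 := by
  refine ⟨1, le_rfl, ?_⟩
  rw [Store.toMemory_set]
  exact Routine.path_push _ _ _

theorem runs_pop (k : Reg) :
    Runs (pop k) ω s (s.get k).head? (s.set k (s.get k).tail) 1 := by
  refine ⟨1, le_rfl, ?_⟩
  rw [Store.toMemory_set]
  exact Routine.path_pop _ _

theorem runs_ret (e : E) : Runs (ret e) ω s e s 2 := ⟨2, le_rfl, Routine.path_ret e _⟩

theorem Runs.bind [Finite E] {p : Code Ext X E} {f : E → Code Ext X F} {e : E} {e' : F}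
    (h : Runs p ω s e s' T) (h' : Runs (f e) ω s' e' s'' T') :
    Runs (p.bind f) ω s e' s'' (T + T') := by
  obtain ⟨t, ht, h⟩ := h
  obtain ⟨t', ht', h'⟩ := h'
  exact ⟨t + t', add_le_add ht ht', Routine.path_bind h h'⟩

theorem Runs.andThen {p : Code Ext X Unit} {q : Code Ext X F} {e' : F}
    (h : Runs p ω s () s' T) (h' : Runs q ω s' e' s'' T') :
    Runs (p.andThen q) ω s e' s'' (T + T') := Runs.bind h h'

theorem Runs.loop_exit [Finite S] {body : S → Code Ext X (S ⊕ E)} {x : S} {e : E}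
    (h : Runs (body x) ω s (.inr e) s' T) : Runs (loop body x) ω s e s' T := by
  obtain ⟨t, ht, h⟩ := h
  exact ⟨t, ht, Routine.path_loop_exit h⟩

theorem Runs.loop_again [Finite S] {body : S → Code Ext X (S ⊕ E)} {x y : S} {e : E}
    (h : Runs (body x) ω s (.inl y) s' T) (h' : Runs (loop body y) ω s' e s'' T') :
    Runs (loop body x) ω s e s'' (T + T') := by
  obtain ⟨t, ht, h⟩ := h
  obtain ⟨t', ht', h'⟩ := h'
  exact ⟨t + t', add_le_add ht ht', Routine.path_loop_again h (Routine.path_loop_start h')⟩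

theorem runs_push_andThen {k : Reg} {a : CNFSym ⊕ X} {q : Code Ext X F} {e : F}
    (h : Runs q ω (s.set k (a :: s.get k)) e s' T) : Runs ((push k a).andThen q) ω s e s' (T + 1) :=
  ((runs_push k a).andThen h).mono (Nat.add_comm _ _).le

theorem runs_pop_bind [Finite X] {k : Reg} {f : Option (CNFSym ⊕ X) → Code Ext X F} {e : F}
    (h : Runs (f (s.get k).head?) ω (s.set k (s.get k).tail) e s' T) :
    Runs ((pop k).bind f) ω s e s' (T + 1) :=
  ((runs_pop k).bind h).mono (Nat.add_comm _ _).le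

/-- Append a word to the register `net`. -/
def emit : List (CNFSym ⊕ X) → Code Ext X Unit
  | [] => ret ()
  | a :: w => (push .net a).andThen (emit w)

theorem runs_emit (w : List (CNFSym ⊕ X)) :
    Runs (emit w) ω s () (s.set .net (w.reverse ++ s.get .net)) (w.length + 2) := by
  induction w generalizing s with
  | nil => exact runs_ret ()
  | cons a w ih =>
    refine (runs_push_andThen ih).congr rfl ?_ (by simp)
    simp [Store.set, Store.get]

/-- Move the contents of `src` to `dst`, changing the symbols by `f`, and emit `g a` for every
symbol `a` that is moved. -/
def transfer [Finite X] (src dst : Reg) (f : CNFSym ⊕ X → CNFSym ⊕ X)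
    (g : CNFSym ⊕ X → List (CNFSym ⊕ X)) : Code Ext X Unit :=
  loop (S := Unit) (fun _ => (pop src).bind fun o =>
    match o with
    | none => ret (.inr ())
    | some a => (push dst (f a)).andThen ((emit (g a)).andThen (ret (.inl ())))) ()

theorem runs_transfer [Finite X] {src dst : Reg} (f : CNFSym ⊕ X → CNFSym ⊕ X)
    (g : CNFSym ⊕ X → List (CNFSym ⊕ X)) (h₁ : src ≠ dst) (h₂ : src ≠ .net) (h₃ : dst ≠ .net)
    (G : ℕ) (hG : ∀ a, (g a).length ≤ G) :
    Runs (transfer src dst f g) ω s ()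
      (((s.set src []).set dst (((s.get src).map f).reverse ++ s.get dst)).set .net
        (((s.get src).flatMap g).reverse ++ s.get .net)) ((s.get src).length * (G + 6) + 3) := by
  generalize hl : s.get src = l
  induction l generalizing s with
  | nil =>
    refine Runs.loop_exit ((runs_pop_bind (T := 2) ?_).congr rfl rfl (by simp))
    rw [hl]
    refine (runs_ret _).congr rfl (Store.eq_of_get (by simp) (by simp) fun k => ?_) le_rfl
    simp only [Store.get_set, List.tail_nil]
    split_ifs <;> simp_all
  | cons a l ih =>
    have h := ih (s := ((s.set src l).set dst (f a :: s.get dst)).set .net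
      ((g a).reverse ++ s.get .net)) (by simp [Store.get_set, h₁, h₂])
    refine (Runs.loop_again (T := 1 + (1 + ((g a).length + 2 + 2))) ?_ h).congr rfl ?_ ?_
    · refine (runs_pop src).bind ?_
      rw [hl]
      refine (runs_push _ _).andThen ((runs_emit _).andThen ((runs_ret _).congr rfl ?_ le_rfl))
      refine Store.eq_of_get (by simp) (by simp) fun k => ?_
      simp only [Store.get_set, List.tail_cons]
      split_ifs <;> simp_all
    · refine Store.eq_of_get (by simp) (by simp) fun k => ?_
      simp only [Store.get_set]
      split_ifs <;> simp_all
    · have := hG a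
      simp only [List.length_cons]
      nlinarith

/-- Move the contents of `src` to `dst`. -/
def move [Finite X] (src dst : Reg) : Code Ext X Unit := transfer src dst id fun _ => []

theorem runs_move [Finite X] {src dst : Reg} (h₁ : src ≠ dst) (h₂ : src ≠ .net)
    (h₃ : dst ≠ .net) :
    Runs (move src dst) ω s () ((s.set src []).set dst ((s.get src).reverse ++ s.get dst))
      ((s.get src).length * 6 + 3) := by
  refine (runs_transfer id (fun _ => []) h₁ h₂ h₃ 0 (by simp)).congr rfl ?_ le_rfl
  refine Store.eq_of_get (by simp) (by simp) fun k => ?_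
  simp only [Store.get_set]
  split_ifs <;> simp_all

/-- Emit `g a` for every symbol `a` of the register `k`. -/
def emitMap [Finite X] (k : Reg) (g : CNFSym ⊕ X → List (CNFSym ⊕ X)) : Code Ext X Unit :=
  (transfer k .aux id g).andThen (move .aux k)

theorem runs_emitMap [Finite X] {k : Reg} (g : CNFSym ⊕ X → List (CNFSym ⊕ X))
    (h₁ : k ≠ .aux) (h₂ : k ≠ .net) (hs : s.aux = []) (G : ℕ) (hG : ∀ a, (g a).length ≤ G) :
    Runs (emitMap k g) ω s () (s.set .net (((s.get k).flatMap g).reverse ++ s.get .net))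
      ((s.get k).length * (G + 12) + 6) := by
  have hs' : s.get .aux = [] := hs
  refine ((runs_transfer id g h₁ h₂ (by decide) G hG).andThen
    (runs_move h₁.symm (by decide) h₂)).congr rfl ?_ ?_
  · refine Store.eq_of_get (by simp) (by simp) fun k => ?_
    simp only [Store.get_set]
    split_ifs <;> simp_all
  · simp [Store.get_set, hs']
    nlinarith

/-! ### Scanning a formula -/

/-- Apply `f` to entry number `i` of a list that is continued by `a`s. -/
def touch {α : Type} (a : α) (f : α → α) : ℕ → List α → List α
  | 0, r => f (r.headD a) :: r.tail
  | i + 1, r => r.headD a :: touch a f i r.tail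

theorem length_touch {α : Type} (a : α) (f : α → α) (i : ℕ) (r : List α) :
    (touch a f i r).length = max r.length (i + 1) := by
  induction i generalizing r with
  | zero => cases r <;> simp [touch]
  | succ i ih => cases r <;> simp [touch, ih]

theorem getD_touch {α : Type} (a : α) (f : α → α) (i j : ℕ) (r : List α) :
    (touch a f i r).getD j a = if j = i then f (r.getD i a) else r.getD j a := by
  induction i generalizing r j with
  | zero => cases r <;> cases j <;> simp [touch]
  | succ i ih =>
    cases r <;> cases j <;> simp only [List.getD_eq_getElem?_getD] at ih <;> simp [touch, ih]

/-- Read the input symbol by symbol and save it in `saved`. At a literal, the entry of `row` that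
belongs to its variable is changed by `act`, and the control state by `upd`. At the end of a clause,
`fin` is executed. -/
def scan [Finite X] {Q : Type} [Finite Q] (a₀ : CNFSym ⊕ X)
    (act : Bool → CNFSym ⊕ X → CNFSym ⊕ X) (upd : Q → Bool → CNFSym ⊕ X → Q)
    (fin : Q → Code Ext X Q) (q : Q) : Code Ext X Q :=
  loop (fun q => (pop .input).bind fun o =>
    match o with
    | none => ret (.inr q)
    | some a => (push .saved a).andThen <|
      match a with
      | .inl .tick => (pop .row).bind fun o => (push .aux (o.getD a₀)).andThen (ret (.inl q))
      | .inl (.literal b) => (pop .row).bind fun o =>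
          (push .row (act b (o.getD a₀))).andThen <|
            (move .aux .row).andThen (ret (.inl (upd q b (o.getD a₀))))
      | .inl .endClause => (fin q).bind fun q' => ret (.inl q')
      | .inr _ => ret (.inr q)) q

section Scan

variable [Finite X] {Q : Type} [Finite Q] {a₀ : CNFSym ⊕ X}
  {act : Bool → CNFSym ⊕ X → CNFSym ⊕ X} {upd : Q → Bool → CNFSym ⊕ X → Q}
  {fin : Q → Code Ext X Q} {q q' : Q}

theorem runs_scan_nil (hs : s.input = []) : Runs (scan a₀ act upd fin q) ω s q s 3 := by
  refine Runs.loop_exit (runs_pop_bind (T := 2) ?_)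
  have : s.get .input = [] := hs
  rw [this]
  refine (runs_ret _).congr rfl ?_ le_rfl
  rw [List.tail_nil, ← hs]
  rfl

theorem runs_scan_tick {w : List (CNFSym ⊕ X)} {e : Q} (hs : s.input = .inl .tick :: w)
    (h : Runs (scan a₀ act upd fin q) ω
      { s with
        input := w
        saved := .inl .tick :: s.saved
        row := s.row.tail
        aux := s.row.headD a₀ :: s.aux } e s' T) :
    Runs (scan a₀ act upd fin q) ω s e s' (T + 6) := by
  replace hs : s.get .input = .inl .tick :: w := hs
  refine (Runs.loop_again (T := 1 + (1 + (1 + (1 + 2)))) ?_ h).mono (by omega)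
  refine (runs_pop _).bind ?_
  rw [hs]
  refine (runs_push _ _).andThen <| (runs_pop _).bind <| (runs_push _ _).andThen <|
    (runs_ret _).congr rfl ?_ le_rfl
  simp only [Store.set, Store.get]
  cases s.row <;> rfl

theorem runs_scan_sign {b : Bool} {w : List (CNFSym ⊕ X)} {e : Q}
    (hs : s.input = .inl (.literal b) :: w)
    (h : Runs (scan a₀ act upd fin (upd q b (s.row.headD a₀))) ω
      { s with
        input := w
        saved := .inl (.literal b) :: s.saved
        row := s.aux.reverse ++ act b (s.row.headD a₀) :: s.row.tail
        aux := [] } e s' T) :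
    Runs (scan a₀ act upd fin q) ω s e s' (T + 12 + 6 * s.aux.length) := by
  replace hs : s.get .input = .inl (.literal b) :: w := hs
  refine (Runs.loop_again (T := 1 + (1 + (1 + (1 + ((s.aux.length * 6 + 3) + 2))))) ?_ h).mono
    (by omega)
  refine (runs_pop _).bind ?_
  rw [hs]
  refine (runs_push _ _).andThen <| (runs_pop _).bind <| (runs_push _ _).andThen <|
    ((runs_move (by decide) (by decide) (by decide)).mono le_rfl).andThen <|
    (runs_ret _).congr ?_ ?_ le_rfl
  · rw [List.headD_eq_head?_getD]
    rfl
  · simp only [Store.set, Store.get]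
    cases s.row <;> rfl

theorem runs_scan_literal {i : ℕ} {b : Bool} {w : List (CNFSym ⊕ X)} {e : Q}
    (hs : s.input = (encodeLiteral (i, b)).map .inl ++ w)
    (h : Runs (scan a₀ act upd fin (upd q b (s.row.getD i a₀))) ω
      { s with
        input := w
        saved := ((encodeLiteral (i, b)).map .inl).reverse ++ s.saved
        row := s.aux.reverse ++ touch a₀ (act b) i s.row
        aux := [] } e s' T) :
    Runs (scan a₀ act upd fin q) ω s e s' (T + 12 * (i + 1) + 6 * s.aux.length) := by
  induction i generalizing s with
  | zero =>
    refine (runs_scan_sign (by simpa [encodeLiteral] using hs) ?_).mono le_rfl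
    rw [List.headD_eq_getD]
    simpa only [touch, List.headD_eq_getD, encodeLiteral, List.replicate_zero, List.nil_append,
      List.map_singleton, List.reverse_singleton, List.singleton_append] using h
  | succ i ih =>
    refine (runs_scan_tick (w := (encodeLiteral (i, b)).map .inl ++ w)
      (by simpa [encodeLiteral, List.replicate_succ] using hs) (ih rfl ?_)).mono
      (by simp only [List.length_cons]; omega)
    have hget : s.row.tail.getD i a₀ = s.row.getD (i + 1) a₀ := by cases s.row <;> simp
    convert h using 2
    · exact congrArg (upd q b) hget
    · simp [encodeLiteral, List.replicate_succ]
    · simp [touch]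

/-- The effect of the literals of a clause on the control state. -/
def scanCtl (a₀ : CNFSym ⊕ X) (act : Bool → CNFSym ⊕ X → CNFSym ⊕ X)
    (upd : Q → Bool → CNFSym ⊕ X → Q) : Clause → Q → List (CNFSym ⊕ X) → Q
  | [], q, _ => q
  | l :: c, q, r => scanCtl a₀ act upd c (upd q l.2 (r.getD l.1 a₀)) (touch a₀ (act l.2) l.1 r)

/-- The effect of the literals of a clause on `row`. -/
def scanRow (a₀ : CNFSym ⊕ X) (act : Bool → CNFSym ⊕ X → CNFSym ⊕ X) (c : Clause)
    (r : List (CNFSym ⊕ X)) : List (CNFSym ⊕ X) :=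
  c.foldl (fun r l => touch a₀ (act l.2) l.1 r) r

theorem runs_scan_clause {c : Clause} {w : List (CNFSym ⊕ X)} {e : Q} {s₁ : Store Ext (CNFSym ⊕ X)}
    {Tc : ℕ}
    (hs : s.input = (c.flatMap encodeLiteral ++ [CNFSym.endClause]).map .inl ++ w) (ha : s.aux = [])
    (hfin : Runs (fin (scanCtl a₀ act upd c q s.row)) ω
      { s with
        input := w
        saved := ((c.flatMap encodeLiteral ++ [CNFSym.endClause]).map .inl).reverse ++ s.saved
        row := scanRow a₀ act c s.row } q' s₁ Tc)
    (h : Runs (scan a₀ act upd fin q') ω s₁ e s' T) :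
    Runs (scan a₀ act upd fin q) ω s e s'
      (T + Tc + 12 * (c.flatMap encodeLiteral ++ [CNFSym.endClause]).length) := by
  induction c generalizing s q with
  | nil =>
    have h_input : s.get .input = .inl .endClause :: w := by
      simpa using show s.get .input = _ from hs
    refine (Runs.loop_again (T := 1 + (1 + (Tc + 2))) ?_ h).mono (by simp; omega)
    refine (runs_pop _).bind ?_
    rw [h_input]
    exact (runs_push _ _).andThen <| Runs.bind hfin (runs_ret _)
  | cons l c ih =>
    obtain ⟨i, b⟩ := l
    refine (runs_scan_literal (i := i) (b := b)
      (w := (c.flatMap encodeLiteral ++ [CNFSym.endClause]).map .inl ++ w)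
      (by simpa using hs) (ih rfl rfl ?_)).mono ?_
    · simpa [scanCtl, scanRow, ha] using hfin
    · simp [ha, encodeLiteral]; omega

end Scan

end Code

/-! ### Recognizing formulas -/

/-- The automaton that recognizes words of `k`-CNF formulas. The state holds the number of literals
in the current clause and whether ticks are pending; `none` is the error state. -/
def clauseAutomaton (k : ℕ) : Option (Fin (k + 1) × Bool) → CNFSym → Option (Fin (k + 1) × Bool)
  | none, _ => none
  | some (j, _), .tick => some (j, true)
  | some (j, _), .literal _ => if h : j + 1 < k + 1 then some (⟨j + 1, h⟩, false) else none
  | some (_, t), .endClause => if t then none else some (0, false)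

theorem foldl_clauseAutomaton_none (k : ℕ) (w : List CNFSym) :
    w.foldl (clauseAutomaton k) none = none := by
  induction w with
  | nil => rfl
  | cons _ _ ih => exact ih

theorem exists_encode_of_foldl_clauseAutomaton (k : ℕ) (w : List CNFSym) (j : Fin (k + 1)) (i : ℕ)
    (h : w.foldl (clauseAutomaton k) (some (j, decide (0 < i))) = some (0, false)) :
    (w = [] ∧ (j : ℕ) = 0 ∧ i = 0) ∨
      ∃ (c : Clause) (α : CNF), c.length + j ≤ k ∧ (∀ c ∈ α, c.length ≤ k) ∧
        List.replicate i CNFSym.tick ++ w =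
          (c.flatMap encodeLiteral ++ [CNFSym.endClause]) ++ encodeCNF α := by
  induction w generalizing j i with
  | nil =>
    left
    simp only [List.foldl_nil, Option.some.injEq, Prod.mk.injEq, decide_eq_false_iff_not] at h
    exact ⟨rfl, by simp [h.1], by omega⟩
  | cons a _ ih =>
    right
    rw [List.foldl_cons] at h
    rcases a with _ | b | _
    · rcases ih j (i + 1) (by simpa [clauseAutomaton] using h) with h | ⟨c, α, hc, hα, hw⟩
      · omega
      · refine ⟨c, α, hc, hα, ?_⟩
        rw [← hw, List.replicate_succ']
        simp
    · by_cases hj : (j : ℕ) + 1 < k + 1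
      · rcases ih ⟨j + 1, hj⟩ 0 (by simpa [clauseAutomaton, hj] using h) with
          h | ⟨c, α, hc, hα, hw⟩
        · simp at h
        · refine ⟨(i, b) :: c, α, by simp only [List.length_cons] at hc ⊢; omega, hα, ?_⟩
          simpa [encodeLiteral] using hw
      · simp [clauseAutomaton, hj, foldl_clauseAutomaton_none] at h
    · rcases Nat.eq_zero_or_pos i with rfl | hi
      · rcases ih 0 0 (by simpa [clauseAutomaton] using h) with h | ⟨c, α, hc, hα, hw⟩
        · exact ⟨[], [], by simp; omega, by simp, by simp [h.1, encodeCNF]⟩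
        · exact ⟨[], c :: α, by simp; omega, by simpa using ⟨by simpa using hc, hα⟩,
            by simpa [encodeCNF] using hw⟩
      · simp [clauseAutomaton, hi, foldl_clauseAutomaton_none] at h

theorem exists_foldl_clauseAutomaton_ticks (k : ℕ) (j : Fin (k + 1)) (i : ℕ) (b : Bool) :
    ∃ b', (List.replicate i CNFSym.tick).foldl (clauseAutomaton k) (some (j, b)) =
      some (j, b') := by
  induction i generalizing b with
  | zero => exact ⟨b, rfl⟩
  | succ _ ih => exact ih true

theorem exists_foldl_clauseAutomaton_literals (k : ℕ) (c : Clause) (j : Fin (k + 1))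
    (hj : c.length + j ≤ k) :
    ∃ j', (c.flatMap encodeLiteral).foldl (clauseAutomaton k) (some (j, false)) =
      some (j', false) := by
  induction c generalizing j with
  | nil => exact ⟨j, rfl⟩
  | cons l c ih =>
    rw [List.length_cons] at hj
    obtain ⟨b, hb⟩ := exists_foldl_clauseAutomaton_ticks k j l.1 false
    have hj' : (j : ℕ) + 1 < k + 1 := by omega
    simp only [List.flatMap_cons, encodeLiteral, List.foldl_append, hb, List.foldl_cons,
      List.foldl_nil, clauseAutomaton, hj', dif_pos]
    exact ih ⟨j + 1, hj'⟩ (by dsimp only; omega)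

theorem clauseAutomaton_accepts_iff (k : ℕ) (w : List CNFSym) :
    w.foldl (clauseAutomaton k) (some (0, false)) = some (0, false) ↔
      ∃ α : CNF, (∀ c ∈ α, c.length ≤ k) ∧ encodeCNF α = w := by
  constructor
  · intro h
    rcases exists_encode_of_foldl_clauseAutomaton k w 0 0 (by simpa using h) with
      h | ⟨c, α, hc, hα, hw⟩
    · exact ⟨[], by simp, by simp [h.1, encodeCNF]⟩
    · refine ⟨c :: α, by simpa using ⟨by simpa using hc, hα⟩, ?_⟩
      simpa [encodeCNF] using hw.symm
  · rintro ⟨α, h, rfl⟩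
    induction α with
    | nil => rfl
    | cons c α ih =>
      obtain ⟨j, hj⟩ := exists_foldl_clauseAutomaton_literals k c 0 (by simpa using h c (by simp))
      have := ih fun c hc => h c (by simp [hc])
      simp only [encodeCNF, List.flatMap_cons, List.foldl_append, hj] at this ⊢
      simpa [clauseAutomaton] using this

theorem exists_mem_kCNF {k : ℕ} {α : CNF} (h : ∀ c ∈ α, c.length ≤ k) : ∃ n, α ∈ kCNF k n := by
  obtain ⟨n, hn⟩ := (α.flatten.map Prod.fst).toFinset.exists_nat_subset_range
  refine ⟨n, fun c hc => ⟨h c hc, fun l hl => Finset.mem_range.1 (hn ?_)⟩⟩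
  simpa only [List.mem_toFinset] using List.mem_map_of_mem (List.mem_flatten.2 ⟨c, hc, hl⟩)

theorem length_flatMap_encodeLiteral_le {n : ℕ} {c : Clause} (hc : ∀ l ∈ c, l.1 < n) :
    (c.flatMap encodeLiteral).length ≤ c.length * (n + 1) := by
  induction c with
  | nil => simp
  | cons l c ih =>
    have htail := ih fun l hl => hc l (by simp [hl])
    have hhead := hc l (by simp)
    simp only [List.flatMap_cons, List.length_append, List.length_cons, encodeLiteral,
      List.length_replicate, List.length_nil] at htail ⊢
    nlinarith

theorem length_encodeCNF_le {k n : ℕ} {α : CNF} (hα : α ∈ kCNF k n) :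
    (encodeCNF α).length ≤ α.length * (k * (n + 1) + 1) := by
  induction α with
  | nil => simp [encodeCNF]
  | cons c α ih =>
    have htail := ih fun c hc => hα c (by simp [hc])
    obtain ⟨hlen, hvar⟩ := hα c (by simp)
    have hclause : (c.flatMap encodeLiteral).length ≤ k * (n + 1) :=
      (length_flatMap_encodeLiteral_le hvar).trans (Nat.mul_le_mul_right _ hlen)
    simp only [encodeCNF, List.flatMap_cons, List.length_append, List.length_cons,
      List.length_nil] at htail ⊢
    nlinarith

theorem length_encodeCNF_le_of_sparse {k C n : ℕ} {α : CNF} (hα : α ∈ sparseKCNF k C n) :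
    (encodeCNF α).length ≤ C * (k + 1) * (n + 1) ^ 2 :=
  calc (encodeCNF α).length ≤ C * n * (k * (n + 1) + 1) :=
        (length_encodeCNF_le hα.1).trans (Nat.mul_le_mul_right _ hα.2)
    _ ≤ C * (n + 1) * (k * (n + 1) + (n + 1)) := by gcongr <;> omega
    _ = C * (k + 1) * (n + 1) ^ 2 := by ring

theorem CNF.Satisfiable.mono {P Q : CNF} (h : CNF.Satisfiable Q) (hPQ : P ⊆ Q) :
    CNF.Satisfiable P := by
  obtain ⟨x, hx⟩ := h
  exact ⟨x, fun c hc => hx c (hPQ hc)⟩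

namespace Code

variable {Ext X : Type} [DecidableEq Ext] [Finite X]
  {ω : ℕ → Bool} {s s' : Store Ext (CNFSym ⊕ X)} {T : ℕ}

/-- Read the input, save it in `saved`, and decide whether the automaton accepts it from `q`. -/
def checkFrom (k : ℕ) (q : Option (Fin (k + 1) × Bool)) : Code Ext X Bool :=
  loop (fun q : Option (Fin (k + 1) × Bool) => (pop .input).bind fun o =>
    match o with
    | none => ret (.inr (decide (q = some (0, false))))
    | some a => (push .saved a).andThen <|
      match a with
      | .inl a => ret (.inl (clauseAutomaton k q a))
      | .inr _ => ret (.inr false)) q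

theorem runs_checkFrom (k : ℕ) (q : Option (Fin (k + 1) × Bool)) (w : List CNFSym)
    (hs : s.input = w.map .inl) :
    Runs (checkFrom k q) ω s (decide (w.foldl (clauseAutomaton k) q = some (0, false)))
      { s with input := [], saved := (w.map .inl).reverse ++ s.saved } (4 * w.length + 3) := by
  induction w generalizing s q with
  | nil =>
    refine Runs.loop_exit (runs_pop_bind (T := 2) ?_)
    have h_input : s.get .input = [] := hs
    rw [h_input]
    exact runs_ret _
  | cons a w ih =>
    have h_input : s.get .input = .inl a :: w.map .inl := hs
    have h := ih (s := { s with input := w.map .inl, saved := .inl a :: s.saved })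
      (clauseAutomaton k q a) rfl
    refine (Runs.loop_again (T := 1 + (1 + 2)) ?_ h).congr rfl (by simp) (by simp; omega)
    refine (runs_pop _).bind ?_
    rw [h_input]
    exact (runs_push _ _).andThen (runs_ret _)

/-- The store in which a decider starts on the word `w`. -/
def initStore (Ext : Type) {X : Type} (w : List CNFSym) : Store Ext (CNFSym ⊕ X) :=
  ⟨fun _ => [], w.map .inl, [], [], [], [], [], [], [], [], [], 0⟩

/-- The decision expressed by a symbol on the register `answer`; only `literal b` is ever pushed
there. -/
def answerValue : CNFSym ⊕ X → Bool
  | .inl (.literal b) => b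
  | _ => false

/-- Run `p` on words of `k`-CNF formulas and reject all other words. -/
def decideWith (k : ℕ) (p : Code Ext X Bool) : Code Ext X Unit :=
  (checkFrom k (some (0, false))).bind fun ok =>
    if ok then (move .saved .input).andThen (p.bind fun b => push .answer (.inl (.literal b)))
    else push .answer (.inl (.literal false))

/-- The machine that decides with `p`. -/
def decider [Fintype Ext] (k : ℕ) (p : Code Ext X Bool) : ProbMachine CNFSym Bool :=
  letI : Fintype (CNFSym ⊕ X) := Fintype.ofFinite _
  Routine.toMachine (decideWith k p) (.inr .input) (.inr .answer) .inl answerValue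

/-- With coins `ω` the routine `p` decides `b` on the formula `α`. The register `answer` has to be
left empty, since the decision is pushed on it. -/
def Yields (p : Code Ext X Bool) (ω : ℕ → Bool) (α : CNF) (b : Bool) : Prop :=
  ∃ s' T, Runs p ω (initStore Ext (encodeCNF α)) b s' T ∧ s'.answer = []

variable [Fintype Ext] {k : ℕ} {p : Code Ext X Bool}

theorem decider_of_runs {w : List CNFSym} {b : Bool}
    (h : Runs (decideWith k p) ω (initStore Ext w) () s' T) (hb : s'.answer = [.inl (.literal b)]) :
    (decider k p).HasOutput w ω [b] ∧ (decider k p).time w ω ≤ T := by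
  let _ : Fintype (CNFSym ⊕ X) := Fintype.ofFinite _
  obtain ⟨t, ht, h⟩ := h
  have h_iterate := Routine.toMachine_iterate (ι := CNFSym) (ο := Bool) (decideWith k p)
    (.inr .input) (.inr .answer) .inl answerValue h
  have h_run : (decider k p).run w ω t = ⟨.inr (), s'.toMemory.stk, s'.toMemory.coins⟩ := by
    refine Eq.trans ?_ h_iterate
    refine congrArg ((decider k p).step ω)^[t] ?_
    unfold ProbMachine.init
    congr 1
    funext x
    rcases x with x | x
    · rfl
    · cases x <;> rfl
  have h_halted : (decider k p).Halted ((decider k p).run w ω t) := by rw [h_run]; rfl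
  refine ⟨⟨t, h_halted, ?_⟩, ?_⟩
  · rw [h_run]
    change (s'.answer).map answerValue = [b]
    rw [hb]; rfl
  · exact (iInf₂_le t h_halted).trans (by exact_mod_cast ht)

theorem decider_of_valid {α : CNF} {b : Bool} (hα : ∀ c ∈ α, c.length ≤ k)
    (h : Runs p ω (initStore Ext (encodeCNF α)) b s' T) (hs' : s'.answer = []) :
    (decider k p).HasOutput (encodeCNF α) ω [b] ∧
      (decider k p).time (encodeCNF α) ω ≤ ((10 * (encodeCNF α).length + 7 + T : ℕ) : ℕ∞) := by
  refine decider_of_runs (((runs_checkFrom k _ (encodeCNF α) rfl).bind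
    (T' := ((encodeCNF α).length * 6 + 3) + (T + 1)) ?_).mono (by omega))
    (s' := s'.set .answer (.inl (.literal b) :: s'.get .answer)) ?_
  · rw [decide_eq_true ((clauseAutomaton_accepts_iff k _).2 ⟨α, hα, rfl⟩), if_pos rfl]
    refine ((runs_move (by decide) (by decide) (by decide)).congr rfl ?_ ?_).andThen
      (h.bind (runs_push _ _))
    · simp [Store.set, Store.get, initStore]
    · simp [Store.get, initStore]
  · change _ :: s'.answer = _
    rw [hs']

theorem decider_of_invalid {w : List CNFSym}
    (hw : ¬ ∃ α : CNF, (∀ c ∈ α, c.length ≤ k) ∧ encodeCNF α = w) :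
    (decider k p).HasOutput w ω [false] := by
  refine (decider_of_runs ((runs_checkFrom k _ w rfl).bind (T' := 1) ?_)
    (s' := Store.set { initStore Ext w with
      input := []
      saved := (w.map .inl).reverse ++ [] } .answer [.inl (.literal false)]) rfl).1
  rw [decide_eq_false (mt (clauseAutomaton_accepts_iff k _).1 hw), if_neg (by simp)]
  exact runs_push _ _

theorem decidesKSAT_decider
    (halt : ∀ α : CNF, (∀ c ∈ α, c.length ≤ k) → ∀ ω, ∃ b, Yields p ω α b)
    (sat : ∀ α : CNF, (∀ c ∈ α, c.length ≤ k) → α.Satisfiable →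
      2 / 3 ≤ coinMeasure {ω | Yields p ω α true})
    (unsat : ∀ α : CNF, (∀ c ∈ α, c.length ≤ k) → ¬ α.Satisfiable →
      2 / 3 ≤ coinMeasure {ω | Yields p ω α false}) :
    DecidesKSAT k (decider k p) where
  halts n α hα ω := by
    obtain ⟨b, s', T, h, hs'⟩ := halt α (fun c hc => (hα c hc).1) ω
    exact ⟨_, (decider_of_valid (fun c hc => (hα c hc).1) h hs').1⟩
  sat n α hα hsat := by
    refine (sat α (fun c hc => (hα c hc).1) hsat).trans (measure_mono ?_)
    rintro ω ⟨s', T, h, hs'⟩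
    exact (decider_of_valid (fun c hc => (hα c hc).1) h hs').1
  unsat n α hα hsat := by
    refine (unsat α (fun c hc => (hα c hc).1) hsat).trans (measure_mono ?_)
    rintro ω ⟨s', T, h, hs'⟩
    exact (decider_of_valid (fun c hc => (hα c hc).1) h hs').1
  invalid w hw := by
    have h_empty : {ω | (decider k p).HasOutput w ω [true]} = ∅ := by
      refine Set.eq_empty_of_forall_notMem fun ω hω => ?_
      have h : (decider k p).HasOutput w ω [false] := by
        refine decider_of_invalid ?_
        rintro ⟨α, hα, h_word⟩
        obtain ⟨n, hn⟩ := exists_mem_kCNF hα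
        exact hw n α hn h_word
      simpa using hω.unique h
    rw [h_empty]
    simp

theorem two_thirds_le_coinMeasure_univ : 2 / 3 ≤ coinMeasure Set.univ := by
  have : IsProbabilityMeasure coinMeasure := by
    unfold coinMeasure
    infer_instance
  rw [measure_univ]
  exact ENNReal.div_le_of_le_mul (by norm_num)

theorem decidesKSAT_decider_of_forall
    (h : ∀ α : CNF, (∀ c ∈ α, c.length ≤ k) → ∀ ω, ∃ b,
      Yields p ω α b ∧ (b = true ↔ α.Satisfiable)) :
    DecidesKSAT k (decider k p) := by
  refine decidesKSAT_decider (fun α hα ω => ?_) (fun α hα hs => ?_) fun α hα hs => ?_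
  · obtain ⟨b, hb, -⟩ := h α hα ω
    exact ⟨b, hb⟩
  · refine two_thirds_le_coinMeasure_univ.trans (measure_mono fun ω _ => ?_)
    obtain ⟨b, hb, hb'⟩ := h α hα ω
    rwa [hb'.2 hs] at hb
  · refine two_thirds_le_coinMeasure_univ.trans (measure_mono fun ω _ => ?_)
    obtain ⟨b, hb, hb'⟩ := h α hα ω
    rw [← hb', Bool.not_eq_true] at hs
    rwa [hs] at hb

theorem runsInExpTime_decider {C : ℕ} {u : ℝ} {B : ℕ → ℕ} {c : ℝ}
    (h : ∀ n, ∀ α ∈ sparseKCNF k C n, ∀ ω, ∃ b s' T,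
      Runs p ω (initStore Ext (encodeCNF α)) b s' T ∧ s'.answer = [] ∧
        10 * (encodeCNF α).length + 7 + T ≤ B n)
    (hB : ∀ᶠ n : ℕ in atTop, (B n : ℝ) ≤ c * (2 : ℝ) ^ (u * (n : ℝ))) :
    (decider k p).RunsInExpTime (fun n => encodeCNF '' sparseKCNF k C n) u := by
  refine ⟨c, hB.mono fun n hn => ?_⟩
  have h_time : (decider k p).worstTime (encodeCNF '' sparseKCNF k C n) ≤ (B n : ℕ∞) := by
    refine iSup₂_le fun x hx => iSup_le fun ω => ?_
    obtain ⟨α, hα, rfl⟩ := hx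
    obtain ⟨b, s', T, h_run, h_answer, hT⟩ := h n α hα ω
    exact (decider_of_valid (fun c hc => (hα.1 c hc).1) h_run h_answer).2.trans
      (by exact_mod_cast hT)
  calc (((decider k p).worstTime (encodeCNF '' sparseKCNF k C n) : ℕ∞) : ℝ≥0∞)
      ≤ ((B n : ℕ∞) : ℝ≥0∞) := by exact_mod_cast h_time
    _ = ENNReal.ofReal (B n : ℝ) := by simp
    _ ≤ _ := ENNReal.ofReal_le_ofReal hn

end Code

namespace Code

section ScanPure

variable {Ext X : Type} [DecidableEq Ext] [Finite X] {Q : Type} [Finite Q] {a₀ : CNFSym ⊕ X}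
  {act : Bool → CNFSym ⊕ X → CNFSym ⊕ X} {upd : Q → Bool → CNFSym ⊕ X → Q} {φ : Q → Q}
  {ω : ℕ → Bool} {s : Store Ext (CNFSym ⊕ X)}

/-- The control state after scanning a formula if `φ` is applied at the end of each clause. -/
def scanState (a₀ : CNFSym ⊕ X) (act : Bool → CNFSym ⊕ X → CNFSym ⊕ X)
    (upd : Q → Bool → CNFSym ⊕ X → Q) (φ : Q → Q) : CNF → Q → List (CNFSym ⊕ X) → Q
  | [], q, _ => q
  | c :: α, q, r =>
    scanState a₀ act upd φ α (φ (scanCtl a₀ act upd c q r)) (scanRow a₀ act c r)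

theorem runs_scan_pure (α : CNF) (q : Q) (hs : s.input = (encodeCNF α).map .inl) (ha : s.aux = []) :
    Runs (scan a₀ act upd (fun q => ret (φ q)) q) ω s (scanState a₀ act upd φ α q s.row)
      { s with
        input := []
        saved := ((encodeCNF α).map .inl).reverse ++ s.saved
        row := α.foldl (fun r c => scanRow a₀ act c r) s.row } (14 * (encodeCNF α).length + 3) := by
  induction α generalizing s q with
  | nil =>
    refine (runs_scan_nil (by simpa [encodeCNF] using hs)).congr rfl ?_ (by simp)
    simp only [encodeCNF, List.flatMap_nil, List.map_nil] at hs
    cases s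
    simpa [encodeCNF] using hs
  | cons c α ih =>
    have h := ih (φ (scanCtl a₀ act upd c q s.row)) (s := { s with
      input := (encodeCNF α).map .inl
      saved := ((c.flatMap encodeLiteral ++ [CNFSym.endClause]).map .inl).reverse ++ s.saved
      row := scanRow a₀ act c s.row }) rfl ha
    refine (runs_scan_clause (fin := fun q => ret (φ q)) (c := c) (w := (encodeCNF α).map .inl)
      (by simpa [encodeCNF] using hs) ha (runs_ret _) h).congr rfl ?_ ?_
    · simp [encodeCNF]
    · simp [encodeCNF]; omega

end ScanPure

/-! ### Formulas with at most one literal per clause -/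

/-- Fix the value of a variable that is unset, which is encoded by `tick`. -/
def fixCell (b : Bool) : CNFSym ⊕ Empty → CNFSym ⊕ Empty
  | .inl .tick => .inl (.literal b)
  | a => a

open Classical in
/-- Record whether the clause has a literal, and whether no contradiction has been found. -/
def noteLiteral (q : Bool × Bool) (b : Bool) (a : CNFSym ⊕ Empty) : Bool × Bool :=
  (true, q.2 && decide (a = .inl .tick ∨ a = .inl (.literal b)))

/-- Decide formulas with at most one literal per clause. -/
def unitSat : Code Empty Empty Bool :=
  (scan (.inl .tick) fixCell noteLiteral (fun q => ret (false, q.2 && q.1)) (false, true)).bind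
    fun q => ret q.2

/-- The invariant of `unitSat` after the clauses `P` have been read: the entries of `r` other than
`tick` are forced by clauses of `P`, and `ok` tells whether `P` is satisfiable. -/
structure UnitInv (P : CNF) (ok : Bool) (r : List (CNFSym ⊕ Empty)) : Prop where
  cell : ∀ i, r.getD i (.inl .tick) = .inl .tick ∨
    ∃ b, r.getD i (.inl .tick) = .inl (.literal b) ∧ [(i, b)] ∈ P
  sat : ok = true → ∀ c ∈ P, ∃ i b, c = [(i, b)] ∧ r.getD i (.inl .tick) = .inl (.literal b)
  unsat : ok = false → ¬ CNF.Satisfiable P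

theorem UnitInv.cell_append {P : CNF} {ok : Bool} {r : List (CNFSym ⊕ Empty)} (h : UnitInv P ok r)
    (Q : CNF) (i : ℕ) : r.getD i (.inl .tick) = .inl .tick ∨
      ∃ b, r.getD i (.inl .tick) = .inl (.literal b) ∧ [(i, b)] ∈ P ++ Q :=
  (h.cell i).imp_right fun ⟨b, hb, hP⟩ => ⟨b, hb, List.mem_append_left Q hP⟩

theorem UnitInv.append_empty {P : CNF} {ok : Bool} {r : List (CNFSym ⊕ Empty)}
    (h : UnitInv P ok r) : UnitInv (P ++ [[]]) false r where
  cell := h.cell_append _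
  sat := by simp
  unsat := by
    rintro - ⟨x, hx⟩
    simpa using hx [] (by simp)

theorem UnitInv.append_unset {P : CNF} {ok : Bool} {r : List (CNFSym ⊕ Empty)}
    (h : UnitInv P ok r) {i : ℕ} (hi : r.getD i (.inl .tick) = .inl .tick) (b : Bool) :
    UnitInv (P ++ [[(i, b)]]) ok (touch (.inl .tick) (fixCell b) i r) := by
  have hget := getD_touch (Sum.inl .tick : CNFSym ⊕ Empty) (fixCell b) i (r := r)
  simp only [hi, fixCell] at hget
  refine ⟨fun j => ?_, fun hok c hc => ?_, fun hok hs => h.unsat hok (hs.mono (by simp))⟩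
  · rw [hget]
    split_ifs with hj
    · exact .inr ⟨b, rfl, by simp [hj]⟩
    · exact h.cell_append _ j
  · rcases List.mem_append.1 hc with hc | hc
    · obtain ⟨j, b', hcj, hj⟩ := h.sat hok c hc
      have hji : j ≠ i := by
        rintro rfl
        rw [hi] at hj
        simp at hj
      exact ⟨j, b', hcj, by rw [hget, if_neg hji, hj]⟩
    · exact ⟨i, b, List.mem_singleton.1 hc, by rw [hget, if_pos rfl]⟩

theorem UnitInv.append_set {P : CNF} {ok : Bool} {r : List (CNFSym ⊕ Empty)}
    (h : UnitInv P ok r) {i : ℕ} {b' : Bool} (hi : r.getD i (.inl .tick) = .inl (.literal b'))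
    (b : Bool) :
    UnitInv (P ++ [[(i, b)]]) (ok && decide (b' = b)) (touch (.inl .tick) (fixCell b) i r) := by
  have hget : ∀ j, (touch (Sum.inl .tick) (fixCell b) i r).getD j (.inl .tick) =
      r.getD j (.inl .tick) := fun j => by
    rw [getD_touch]
    split_ifs with hj
    · rw [hj, hi, fixCell]
      simp
    · rfl
  have hP : [(i, b')] ∈ P := by
    obtain hu | ⟨b'', hb'', hP⟩ := h.cell i
    · rw [hi] at hu
      simp at hu
    · rw [hi, Sum.inl.injEq, CNFSym.literal.injEq] at hb''
      rwa [hb'']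
  refine ⟨fun j => hget j ▸ h.cell_append _ j, fun hok c hc => ?_, fun hok hs => ?_⟩
  · obtain ⟨hok', rfl⟩ : ok = true ∧ b' = b := by simpa using hok
    rcases List.mem_append.1 hc with hc | hc
    · obtain ⟨j, b'', hcj, hj⟩ := h.sat hok' c hc
      exact ⟨j, b'', hcj, by rw [hget, hj]⟩
    · exact ⟨i, b', List.mem_singleton.1 hc, by rw [hget, hi]⟩
  · obtain ⟨x, hx⟩ := id hs
    have hxb' : x i = b' := by simpa using hx [(i, b')] (by simp [hP])
    have hxb : x i = b := by simpa using hx [(i, b)] (by simp)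
    have hbb' : b' = b := hxb'.symm.trans hxb
    exact h.unsat (by simpa [hbb'] using hok) (hs.mono (by simp))

theorem UnitInv.step {P : CNF} {ok : Bool} {r : List (CNFSym ⊕ Empty)} (h : UnitInv P ok r)
    {c : Clause} (hc : c.length ≤ 1) :
    UnitInv (P ++ [c])
      ((scanCtl (.inl .tick) fixCell noteLiteral c (false, ok) r).2 &&
        (scanCtl (.inl .tick) fixCell noteLiteral c (false, ok) r).1)
      (scanRow (.inl .tick) fixCell c r) := by
  match c, hc with
  | [], _ => simpa [scanCtl, scanRow] using h.append_empty
  | [(i, b)], _ =>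
    simp only [scanCtl, noteLiteral, scanRow, List.foldl_cons, List.foldl_nil, Bool.and_true]
    rcases h.cell i with hi | ⟨b', hi, -⟩
    · simpa only [hi, true_or, decide_true, Bool.and_true] using h.append_unset hi b
    · simpa only [hi, reduceCtorEq, false_or, Sum.inl.injEq, CNFSym.literal.injEq] using
        h.append_set hi b

theorem UnitInv.scan {P : CNF} {ok : Bool} {r : List (CNFSym ⊕ Empty)} (h : UnitInv P ok r)
    {α : CNF} (hα : ∀ c ∈ α, c.length ≤ 1) :
    UnitInv (P ++ α)
      (scanState (.inl .tick) fixCell noteLiteral (fun q => (false, q.2 && q.1)) α (false, ok) r).2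
      (α.foldl (fun r c => scanRow (.inl .tick) fixCell c r) r) := by
  induction α generalizing P ok r with
  | nil => simpa [scanState] using h
  | cons c α ih =>
    have := ih (h.step (hα c (by simp))) fun c hc => hα c (by simp [hc])
    simpa [scanState] using this

theorem UnitInv.iff {P : CNF} {ok : Bool} {r : List (CNFSym ⊕ Empty)} (h : UnitInv P ok r) :
    ok = true ↔ CNF.Satisfiable P := by
  classical
  refine ⟨fun hok => ⟨fun i => decide (r.getD i (.inl .tick) = .inl (.literal true)), ?_⟩, ?_⟩
  · intro c hc
    obtain ⟨i, b, rfl, hi⟩ := h.sat hok c hc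
    refine ⟨(i, b), by simp, ?_⟩
    simp only [hi]
    cases b <;> simp
  · intro hs
    by_contra hok
    exact h.unsat (by simpa using hok) hs

theorem runs_unitSat {α : CNF} (hα : ∀ c ∈ α, c.length ≤ 1) (ω : ℕ → Bool) :
    ∃ b s', Runs unitSat ω (initStore Empty (encodeCNF α)) b s' (14 * (encodeCNF α).length + 5) ∧
      s'.answer = [] ∧ (b = true ↔ α.Satisfiable) := by
  have hI : UnitInv [] true [] := ⟨by simp, by simp, by simp⟩
  have h := runs_scan_pure (a₀ := .inl .tick) (act := fixCell) (upd := noteLiteral)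
    (φ := fun q => (false, q.2 && q.1)) (ω := ω) (s := initStore Empty (encodeCNF α)) α
    (false, true) rfl rfl
  have h' := Runs.bind (f := fun q : Bool × Bool => ret q.2) h (runs_ret _)
  exact ⟨_, _, h', rfl, (hI.scan hα).iff⟩

end Code

theorem eventually_mul_pow_le (a j : ℕ) {u : ℝ} (hu : 0 < u) :
    ∀ᶠ n : ℕ in atTop, (a : ℝ) * ((n : ℝ) + 1) ^ j ≤ (2 : ℝ) ^ (u * (n : ℝ)) := by
  have h := (isLittleO_pow_const_const_pow_of_one_lt (R := ℝ) j
    (Real.one_lt_rpow one_lt_two hu)).bound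
    (c := 1 / ((a + 1) * 2 ^ j)) (by positivity)
  filter_upwards [h, eventually_ge_atTop 1] with n hn h_one_le
  have h_one_le : (1 : ℝ) ≤ n := by exact_mod_cast h_one_le
  rw [Real.norm_of_nonneg (by positivity), Real.norm_of_nonneg (by positivity),
    ← Real.rpow_natCast (2 ^ u), ← Real.rpow_mul zero_le_two, div_mul_eq_mul_div, one_mul,
    le_div_iff₀ (by positivity)] at hn
  calc (a : ℝ) * ((n : ℝ) + 1) ^ j ≤ (a + 1) * (2 * n) ^ j := by gcongr <;> linarith
    _ = (n : ℝ) ^ j * ((a + 1) * 2 ^ j) := by ring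
    _ ≤ _ := hn

theorem sTilde_le {k C : ℕ} {u : ℝ} (hu : 0 < u) {M : ProbMachine CNFSym Bool}
    (h : DecidesKSAT k M) (h' : M.RunsInExpTime (fun n => encodeCNF '' sparseKCNF k C n) u) :
    sTilde k C ≤ u :=
  csInf_le ⟨0, fun _ hs => hs.1.le⟩ ⟨hu, M, h, h'⟩

theorem sTilde_one_le (C : ℕ) {u : ℝ} (hu : 0 < u) : sTilde 1 C ≤ u := by
  refine sTilde_le hu (M := Code.decider 1 Code.unitSat)
    (Code.decidesKSAT_decider_of_forall fun α hα ω => ?_)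
    (Code.runsInExpTime_decider (B := fun n => 24 * (C * (1 + 1) * (n + 1) ^ 2) + 12) (c := 1)
      (fun n α hα ω => ?_) ?_)
  · obtain ⟨b, s', h_run, h_answer, hb⟩ := Code.runs_unitSat hα ω
    exact ⟨b, ⟨s', _, h_run, h_answer⟩, hb⟩
  · obtain ⟨b, s', h_run, h_answer, -⟩ := Code.runs_unitSat (fun c hc => (hα.1 c hc).1) ω
    have h_length := length_encodeCNF_le_of_sparse hα
    exact ⟨b, s', _, h_run, h_answer, by omega⟩
  · filter_upwards [eventually_mul_pow_le (48 * C + 12) 2 hu] with n hn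
    refine le_trans ?_ (hn.trans (one_mul _).ge)
    have h_le : 24 * (C * (1 + 1) * (n + 1) ^ 2) + 12 ≤ (48 * C + 12) * (n + 1) ^ 2 := by
      linarith [Nat.one_le_pow 2 (n + 1) n.succ_pos]
    exact_mod_cast h_le

/-! ### Exhaustive search -/

/-- The number with the given binary digits, least significant digit first. -/
def bitsValue : List Bool → ℕ
  | [] => 0
  | b :: l => b.toNat + 2 * bitsValue l

/-- Add one to a number with a fixed number of binary digits; `none` on overflow. -/
def incBits : List Bool → Option (List Bool)
  | [] => none
  | false :: l => some (true :: l)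
  | true :: l => (incBits l).map (false :: ·)

theorem testBit_bitsValue (l : List Bool) (i : ℕ) :
    (bitsValue l).testBit i = l.getD i false := by
  induction l generalizing i with
  | nil => simp [bitsValue]
  | cons b l ih =>
    cases i with
    | zero => cases b <;> simp [bitsValue, Nat.testBit_zero, Nat.add_mod]
    | succ i =>
      have h : (b.toNat + 2 * bitsValue l) / 2 = bitsValue l := by
        cases b <;> grind
      rw [Nat.testBit_succ, bitsValue, h, ih]
      simp

theorem bitsValue_lt (l : List Bool) : bitsValue l < 2 ^ l.length := by
  induction l with
  | nil => simp [bitsValue]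
  | cons b l ih =>
    have := b.toNat_lt
    simp only [bitsValue, List.length_cons, pow_succ]
    omega

theorem incBits_eq_none {l : List Bool} (h : incBits l = none) :
    bitsValue l + 1 = 2 ^ l.length := by
  induction l with
  | nil => rfl
  | cons b l ih =>
    cases b with
    | false => simp [incBits] at h
    | true =>
      have := ih (by simpa [incBits] using h)
      simp only [bitsValue, List.length_cons, pow_succ, Bool.toNat_true]
      omega

theorem incBits_eq_some {l l' : List Bool} (h : incBits l = some l') :
    bitsValue l' = bitsValue l + 1 ∧ l'.length = l.length := by
  induction l generalizing l' with
  | nil => simp [incBits] at h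
  | cons b l ih =>
    cases b with
    | false =>
      simp only [incBits, Option.some.injEq] at h
      subst h
      simp [bitsValue]; omega
    | true =>
      simp only [incBits, Option.map_eq_some_iff] at h
      obtain ⟨l₁, hl₁, rfl⟩ := h
      have := ih hl₁
      simp only [bitsValue, Bool.toNat_true, Bool.toNat_false, List.length_cons]
      omega

/-- The assignment `l`, with all further variables false, satisfies `α`. -/
def SatBy (l : List Bool) (α : CNF) : Prop := ∀ c ∈ α, ∃ x ∈ c, l.getD x.1 false = x.2

theorem satBy_congr {α : CNF} {l l' : List Bool} (h : ∀ i, l'.getD i false = l.getD i false) :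
    SatBy l' α ↔ SatBy l α := by
  simp only [SatBy, h]

theorem satBy_of_bitsValue_eq {α : CNF} {l l' : List Bool} (h : bitsValue l' = bitsValue l)
    (hl : SatBy l α) : SatBy l' α :=
  (satBy_congr fun i => by rw [← testBit_bitsValue, ← testBit_bitsValue, h]).2 hl

theorem bitsValue_lt_of_satBy {α : CNF} {l : List Bool} (hns : ¬ SatBy l α)
    (hmin : ∀ l', SatBy l' α → bitsValue l ≤ bitsValue l') {l' : List Bool} (hl' : SatBy l' α) :
    bitsValue l < bitsValue l' :=
  (hmin l' hl').lt_of_ne fun h => hns (satBy_of_bitsValue_eq h hl')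

theorem CNF.Satisfiable.exists_satBy {α : CNF} (hα : α.Satisfiable) {n : ℕ}
    (hn : ∀ c ∈ α, ∀ x ∈ c, x.1 < n) : ∃ l : List Bool, l.length = n ∧ SatBy l α := by
  obtain ⟨a, ha⟩ := hα
  refine ⟨(List.range n).map a, by simp, fun c hc => ?_⟩
  obtain ⟨x, hx, hax⟩ := ha c hc
  exact ⟨x, hx, by simp [hn c hc x hx, hax]⟩

theorem not_satisfiable_of_incBits_eq_none {α : CNF} {l : List Bool} (hl : incBits l = none)
    (hα : ∀ c ∈ α, ∀ x ∈ c, x.1 < l.length) (hns : ¬ SatBy l α)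
    (hmin : ∀ l', SatBy l' α → bitsValue l ≤ bitsValue l') : ¬ α.Satisfiable := by
  intro hsat
  obtain ⟨l', hlen, hl'⟩ := hsat.exists_satBy hα
  have hlt := bitsValue_lt_of_satBy hns hmin hl'
  have hmax := incBits_eq_none hl
  have hl'_lt := bitsValue_lt l'
  rw [hlen] at hl'_lt
  omega

namespace Code

/-- The symbol for a truth value. -/
def bit (b : Bool) : CNFSym ⊕ Empty := .inl (.literal b)

open Classical in
/-- Record whether the clause has a true literal. -/
def noteTrue (q : Bool × Bool) (b : Bool) (a : CNFSym ⊕ Empty) : Bool × Bool :=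
  (q.1 || decide (a = bit b), q.2)

/-- Evaluate the formula under the assignment in `row`. -/
def evaluate : Code Empty Empty Bool :=
  (scan (bit false) (fun _ => id) noteTrue (fun q => ret (false, q.2 && q.1)) (false, true)).bind
    fun q => (move .saved .input).andThen (ret q.2)

/-- Go on to the next assignment in `row`. -/
def nextRow : Code Empty Empty Bool :=
  loop (S := Unit) (fun _ => (pop .row).bind fun o =>
    match o with
    | none => ret (.inr false)
    | some (.inl (.literal false)) => (push .row (bit true)).andThen <|
        (move .aux .row).andThen (ret (.inr true))
    | some _ => (push .aux (bit false)).andThen (ret (.inl ()))) ()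

/-- Evaluate the formula and, if it is false, go on to the next assignment. -/
def searchStep : Code Empty Empty (Unit ⊕ Bool) :=
  evaluate.bind fun sat =>
    bif sat then ret (.inr true) else
      nextRow.bind fun ok => ret (bif ok then .inl () else .inr false)

/-- Try all assignments. -/
def search : Code Empty Empty Bool :=
  loop (S := Unit) (fun _ => searchStep) ()

variable {ω : ℕ → Bool} {s : Store Empty (CNFSym ⊕ Empty)}

theorem runs_nextRow_some {l l' : List Bool} (hs : s.row = l.map bit) (h : incBits l = some l') :
    Runs nextRow ω s true { s with row := s.aux.reverse ++ l'.map bit, aux := [] }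
      (10 * l.length + 6 * s.aux.length + 8) := by
  induction l generalizing s l' with
  | nil => simp [incBits] at h
  | cons b l ih =>
    have h_row : s.get .row = bit b :: l.map bit := hs
    cases b with
    | false =>
      simp only [incBits, Option.some.injEq] at h
      subst h
      refine Runs.loop_exit (Runs.mono (T := 1 + (1 + (s.aux.length * 6 + 3 + 2))) ?_
        (by simp; omega))
      refine (runs_pop _).bind ?_
      rw [h_row]
      refine (runs_push _ _).andThen <| (runs_move (by decide) (by decide) (by decide)).andThen <|
        (runs_ret _).congr rfl ?_ le_rfl
      simp [Store.set, Store.get]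
    | true =>
      simp only [incBits, Option.map_eq_some_iff] at h
      obtain ⟨l₁, hl₁, rfl⟩ := h
      have h_rest := ih (s := { s with row := l.map bit, aux := bit false :: s.aux }) rfl hl₁
      refine (Runs.loop_again (T := 1 + (1 + 2)) ?_ h_rest).congr rfl (by simp) (by simp; omega)
      refine (runs_pop _).bind ?_
      rw [h_row]
      exact (runs_push _ _).andThen (runs_ret _)

theorem runs_nextRow_none {l : List Bool} (hs : s.row = l.map bit) (h : incBits l = none) :
    ∃ s', Runs nextRow ω s false s' (4 * l.length + 3) ∧ s'.answer = s.answer := by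
  induction l generalizing s with
  | nil =>
    have h_row : s.get .row = [] := hs
    refine ⟨s.set .row (s.get .row).tail,
      Runs.loop_exit (Runs.mono (T := 1 + 2) ((runs_pop _).bind ?_) (by simp)), rfl⟩
    rw [h_row]
    exact runs_ret _
  | cons b l ih =>
    have h_row : s.get .row = bit b :: l.map bit := hs
    cases b with
    | false => simp [incBits] at h
    | true =>
      obtain ⟨s', h_rest, h_answer⟩ := ih
        (s := { s with row := l.map bit, aux := bit false :: s.aux }) rfl
        (by simpa [incBits] using h)
      refine ⟨s', (Runs.loop_again (T := 1 + (1 + 2)) ?_ h_rest).mono (by simp; omega), h_answer⟩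
      refine (runs_pop _).bind ?_
      rw [h_row]
      exact (runs_push _ _).andThen (runs_ret _)

/-- The assignment `l'` is `l`, continued by zeros just far enough for the variables of `c`. -/
structure Pads (c : Clause) (l l' : List Bool) : Prop where
  getD_eq (i : ℕ) : l'.getD i false = l.getD i false
  le_length : l.length ≤ l'.length
  lt_length : ∀ x ∈ c, x.1 < l'.length
  length_le {n : ℕ} : l.length ≤ n → (∀ x ∈ c, x.1 < n) → l'.length ≤ n

namespace Pads

variable {c c' : Clause} {l l₁ l' : List Bool}

theorem nil (l : List Bool) : Pads [] l l :=
  ⟨fun _ => rfl, le_rfl, by simp, fun h _ => h⟩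

theorem trans (h : Pads c l l₁) (h' : Pads c' l₁ l') : Pads (c ++ c') l l' where
  getD_eq i := (h'.getD_eq i).trans (h.getD_eq i)
  le_length := h.le_length.trans h'.le_length
  lt_length x hx := (List.mem_append.1 hx).elim (fun hx => (h.lt_length x hx).trans_le h'.le_length)
    (h'.lt_length x)
  length_le hn hc := by
    simp only [List.mem_append, or_imp, forall_and] at hc
    exact h'.length_le (h.length_le hn hc.1) hc.2

theorem touch (x : ℕ × Bool) (l : List Bool) : Pads [x] l (touch false id x.1 l) where
  getD_eq i := by
    rw [getD_touch]
    split_ifs with h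
    · rw [h]; rfl
    · rfl
  le_length := by rw [length_touch]; omega
  lt_length := by simp [length_touch]
  length_le hn hx := by
    simp only [List.mem_singleton, forall_eq] at hx
    rw [length_touch]
    omega

theorem bitsValue_eq (h : Pads c l l') : bitsValue l' = bitsValue l :=
  Nat.eq_of_testBit_eq fun i => by rw [testBit_bitsValue, testBit_bitsValue, h.getD_eq]

end Pads

theorem touch_map_bit (i : ℕ) (l : List Bool) :
    touch (bit false) id i (l.map bit) = (touch false id i l).map bit := by
  induction i generalizing l with
  | zero => cases l <;> simp [touch]
  | succ i ih =>
    cases l with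
    | nil => simpa [touch] using ih []
    | cons b l => simpa [touch] using ih l

theorem exists_pads_scanRow (c : Clause) (l : List Bool) :
    ∃ l', scanRow (bit false) (fun _ => id) c (l.map bit) = l'.map bit ∧ Pads c l l' := by
  induction c generalizing l with
  | nil => exact ⟨l, rfl, .nil l⟩
  | cons x c ih =>
    obtain ⟨l', hrow, hpad⟩ := ih (touch false id x.1 l)
    exact ⟨l', by rw [← hrow, ← touch_map_bit]; rfl, (Pads.touch x l).trans hpad⟩

open Classical in
theorem scanCtl_noteTrue (c : Clause) (l : List Bool) (q : Bool × Bool) :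
    scanCtl (bit false) (fun _ => id) noteTrue c q (l.map bit) =
      (q.1 || c.any fun x => l.getD x.1 false == x.2, q.2) := by
  have key : ∀ (r : List (CNFSym ⊕ Empty)) (q : Bool × Bool),
      (∀ i, r.getD i (bit false) = bit (l.getD i false)) →
      scanCtl (bit false) (fun _ => id) noteTrue c q r =
        (q.1 || c.any fun x => l.getD x.1 false == x.2, q.2) := by
    induction c with
    | nil => intro r q _; simp [scanCtl]
    | cons x c ih =>
      intro r q hr
      rw [scanCtl, ih]
      · rw [noteTrue, hr]
        have : decide (bit (l.getD x.1 false) = bit x.2) = (l.getD x.1 false == x.2) := by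
          cases l.getD x.1 false <;> cases x.2 <;> simp [bit]
        simp only [this, List.any_cons, Bool.or_assoc]
      · intro i
        rw [getD_touch]
        split_ifs with h
        · rw [h, ← hr]; rfl
        · exact hr i
  refine key _ q fun i => ?_
  simp only [List.getD_eq_getElem?_getD, List.getElem?_map]
  cases l[i]? <;> rfl

theorem exists_pads_scanState (α : CNF) (l : List Bool) (q : Bool) :
    ∃ l', α.foldl (fun r c => scanRow (bit false) (fun _ => id) c r) (l.map bit) = l'.map bit ∧
      Pads α.flatten l l' ∧
      ((scanState (bit false) (fun _ => id) noteTrue (fun q => (false, q.2 && q.1)) α (false, q)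
        (l.map bit)).2 = true ↔ q = true ∧ SatBy l α) := by
  induction α generalizing l q with
  | nil => exact ⟨l, rfl, .nil l, by simp [scanState, SatBy]⟩
  | cons c α ih =>
    obtain ⟨l₁, hrow₁, hpad₁⟩ := exists_pads_scanRow c l
    obtain ⟨l', hrow', hpad', hsat'⟩ := ih l₁ (q && c.any fun x => l.getD x.1 false == x.2)
    refine ⟨l', by rw [List.foldl_cons, hrow₁, hrow'], hpad₁.trans hpad', ?_⟩
    rw [scanState, scanCtl_noteTrue, hrow₁]
    simp only [Bool.false_or]
    rw [hsat', satBy_congr hpad₁.getD_eq]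
    simp only [SatBy, List.mem_cons, forall_eq_or_imp, Bool.and_eq_true, List.any_eq_true,
      beq_iff_eq, and_assoc]

theorem exists_runs_evaluate {α : CNF} {l : List Bool}
    (h_input : s.input = (encodeCNF α).map .inl) (hsaved : s.saved = []) (haux : s.aux = [])
    (hrow : s.row = l.map bit) :
    ∃ b l', Runs evaluate ω s b { s with row := l'.map bit } (20 * (encodeCNF α).length + 10) ∧
      Pads α.flatten l l' ∧ (b = true ↔ SatBy l α) := by
  obtain ⟨l', hrow', hpad, hsat⟩ := exists_pads_scanState α l true
  have hscan := runs_scan_pure (a₀ := bit false) (act := fun _ => id) (upd := noteTrue)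
    (φ := fun q => (false, q.2 && q.1)) (ω := ω) (s := s) α (false, true) h_input haux
  rw [hrow, hrow'] at hscan
  refine ⟨_, l', (hscan.bind (T' := 6 * (encodeCNF α).length + 5) ?_).mono (by omega), hpad,
    by simpa using hsat⟩
  refine ((runs_move (by decide) (by decide) (by decide)).andThen (runs_ret _)).congr rfl ?_ ?_
  · simp [Store.set, Store.get, hsaved, h_input]
  · simp [Store.get, hsaved]; omega

theorem runs_searchStep_of_true {s' : Store Empty (CNFSym ⊕ Empty)} {T : ℕ}
    (h : Runs evaluate ω s true s' T) : Runs searchStep ω s (.inr true) s' (T + 2) :=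
  h.bind (runs_ret _)

theorem runs_searchStep_of_false {s₁ s' : Store Empty (CNFSym ⊕ Empty)} {T T' : ℕ} {ok : Bool}
    (h : Runs evaluate ω s false s₁ T) (h' : Runs nextRow ω s₁ ok s' T') :
    Runs searchStep ω s (bif ok then .inl () else .inr false) s' (T + (T' + 2)) :=
  h.bind (h'.bind (runs_ret _))

theorem runs_search {α : CNF} {n : ℕ} (hα : ∀ c ∈ α, ∀ x ∈ c, x.1 < n) (f : ℕ) {l : List Bool}
    (h_input : s.input = (encodeCNF α).map .inl) (hsaved : s.saved = []) (haux : s.aux = [])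
    (hrow : s.row = l.map bit) (hl : l.length ≤ n) (hf : 2 ^ n ≤ bitsValue l + f)
    (hmin : ∀ l', SatBy l' α → bitsValue l ≤ bitsValue l') :
    ∃ b s', Runs search ω s b s' (f * (20 * (encodeCNF α).length + 10 * n + 30)) ∧
      s'.answer = s.answer ∧ (b = true ↔ α.Satisfiable) := by
  induction f generalizing s l with
  | zero =>
    have := bitsValue_lt l
    have := Nat.pow_le_pow_right (n := 2) (by norm_num) hl
    omega
  | succ f ih =>
    obtain ⟨b, l', hev, hpad, hb⟩ := exists_runs_evaluate (ω := ω) h_input hsaved haux hrow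
    have hl' : l'.length ≤ n := hpad.length_le hl (by simpa using fun x c hc hx => hα c hc x hx)
    rw [← hpad.bitsValue_eq] at hf hmin
    rw [← satBy_congr hpad.getD_eq] at hb
    cases b with
    | true =>
      exact ⟨true, { s with row := l'.map bit },
        (Runs.loop_exit (runs_searchStep_of_true hev)).mono (by nlinarith), rfl,
        iff_of_true rfl ⟨fun i => l'.getD i false, hb.1 rfl⟩⟩
    | false =>
      have hns : ¬ SatBy l' α := by simpa using hb
      rcases hinc : incBits l' with _ | l₁
      · obtain ⟨s', hnext, hans⟩ :=
          runs_nextRow_none (ω := ω) (s := { s with row := l'.map bit }) rfl hinc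
        have hunsat : ¬ α.Satisfiable := not_satisfiable_of_incBits_eq_none hinc
          (fun c hc x hx => hpad.lt_length x (List.mem_flatten.2 ⟨c, hc, hx⟩)) hns hmin
        exact ⟨false, s', (Runs.loop_exit (runs_searchStep_of_false hev hnext)).mono (by nlinarith),
          hans, by simpa using hunsat⟩
      · obtain ⟨hval, hlen⟩ := incBits_eq_some hinc
        have hnext : Runs nextRow ω { s with row := l'.map bit } true { s with row := l₁.map bit }
            (10 * l'.length + 8) :=
          (runs_nextRow_some rfl hinc).congr rfl (by simp [haux]) (by simp [haux])
        obtain ⟨b, s', hrest, hans, hsat⟩ := ih (s := { s with row := l₁.map bit })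
          h_input hsaved haux rfl (by omega) (by omega) fun l'' hl'' => by
            have := bitsValue_lt_of_satBy hns hmin hl''
            omega
        exact ⟨b, s', (Runs.loop_again (runs_searchStep_of_false hev hnext) hrest).mono
          (by nlinarith), hans, hsat⟩

theorem runs_search_init {α : CNF} {n : ℕ} (hα : ∀ c ∈ α, ∀ x ∈ c, x.1 < n) (ω : ℕ → Bool) :
    ∃ b s', Runs search ω (initStore Empty (encodeCNF α)) b s'
      (2 ^ n * (20 * (encodeCNF α).length + 10 * n + 30)) ∧
      s'.answer = [] ∧ (b = true ↔ α.Satisfiable) :=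
  runs_search hα (2 ^ n) (l := []) rfl rfl rfl rfl (by simp) (by simp) (by simp [bitsValue])

end Code

theorem search_time_le (a n : ℕ) :
    10 * (a * (n + 1) ^ 2) + 7 + 2 ^ n * (20 * (a * (n + 1) ^ 2) + 10 * n + 30) ≤
      2 ^ n * ((30 * a + 50) * (n + 1) ^ 2) := by
  generalize h_length : a * (n + 1) ^ 2 = L
  calc 10 * L + 7 + 2 ^ n * (20 * L + 10 * n + 30)
      ≤ 2 ^ n * (10 * L + 7) + 2 ^ n * (20 * L + 10 * n + 30) := by
        gcongr
        exact Nat.le_mul_of_pos_left _ (by positivity)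
    _ = 2 ^ n * (30 * L + 10 * n + 37) := by ring
    _ ≤ 2 ^ n * ((30 * a + 50) * (n + 1) ^ 2) := by gcongr; nlinarith

theorem sTilde_le_one (k C : ℕ) : sTilde k C ≤ 1 := by
  refine le_of_forall_pos_le_add fun u hu => sTilde_le (by positivity)
    (M := Code.decider k Code.search)
    (Code.decidesKSAT_decider_of_forall fun α hα ω => ?_)
    (Code.runsInExpTime_decider
      (B := fun n => 10 * (C * (k + 1) * (n + 1) ^ 2) + 7 +
        2 ^ n * (20 * (C * (k + 1) * (n + 1) ^ 2) + 10 * n + 30)) (c := 1)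
      (fun n α hα ω => ?_) ?_)
  · obtain ⟨n, hn⟩ := exists_mem_kCNF hα
    obtain ⟨b, s', hrun, hans, hb⟩ := Code.runs_search_init (fun c hc => (hn c hc).2) ω
    exact ⟨b, ⟨s', _, hrun, hans⟩, hb⟩
  · obtain ⟨b, s', hrun, hans, -⟩ := Code.runs_search_init (fun c hc => (hα.1 c hc).2) ω
    refine ⟨b, s', _, hrun, hans, ?_⟩
    have := length_encodeCNF_le_of_sparse hα
    gcongr
  · filter_upwards [eventually_mul_pow_le (30 * (C * (k + 1)) + 50) 2 hu] with n hn
    rw [one_mul, add_mul, Real.rpow_add two_pos, one_mul, Real.rpow_natCast]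
    calc _ ≤ ((2 ^ n * ((30 * (C * (k + 1)) + 50) * (n + 1) ^ 2) : ℕ) : ℝ) := by
          exact_mod_cast search_time_le (C * (k + 1)) n
      _ = 2 ^ n * (((30 * (C * (k + 1)) + 50 : ℕ) : ℝ) * ((n : ℝ) + 1) ^ 2) := by push_cast; ring
      _ ≤ _ := by gcongr

/-! ### The network of a formula -/

section ListLemmas

variable {α β : Type}

theorem flatten_ofFn_comp {n : ℕ} (f : Fin n → α) (g : α → List β) :
    (List.ofFn fun c => g (f c)).flatten = (List.ofFn f).flatMap g := by
  rw [List.flatMap_def, List.map_ofFn]; rfl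

theorem flatten_ofFn_get (l : List α) (g : α → List β) :
    (List.ofFn fun c : Fin l.length => g (l.get c)).flatten = l.flatMap g := by
  rw [flatten_ofFn_comp, List.ofFn_get]

theorem flatten_ofFn_val (n : ℕ) (g : ℕ → List β) :
    (List.ofFn fun c : Fin n => g c).flatten = (List.range n).flatMap g := by
  rw [flatten_ofFn_comp (fun c : Fin n => (c : ℕ))]
  exact congrArg (List.flatMap g) (List.ext_getElem (by simp) (by simp))

theorem ofFn_divNat_modNat {m n : ℕ} (f : Fin m → Fin n → α) :
    (List.ofFn fun z : Fin (m * n) => f z.divNat z.modNat) =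
      (List.ofFn fun c => List.ofFn fun i => f c i).flatten := by
  rw [List.ofFn_mul]
  congr 1
  refine congrArg List.ofFn (funext fun c => congrArg List.ofFn (funext fun i => ?_))
  have hn : 0 < n := i.pos
  congr 1
  · ext
    simp only [Fin.coe_divNat]
    rw [Nat.add_comm, Nat.add_mul_div_right _ _ hn, Nat.div_eq_of_lt i.2, Nat.zero_add]
  · ext
    simp [Fin.modNat, Nat.mod_eq_of_lt i.2]

theorem ofFn_ite_eq {n : ℕ} (c : Fin n) (x y : α) :
    (List.ofFn fun c' : Fin n => if c = c' then x else y) =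
      List.replicate c y ++ [x] ++ List.replicate (n - 1 - c) y := by
  refine List.ext_getElem (by simp; omega) fun i _ _ => ?_
  simp only [List.getElem_ofFn, List.getElem_append, List.getElem_replicate, List.length_append,
    List.length_replicate, List.length_singleton, List.getElem_singleton, Fin.ext_iff]
  split_ifs <;> first | rfl | omega

end ListLemmas

/-- The real number `x` as a weight in `θ`; the default weight if `x ∉ θ`. -/
def toWeight (θ : Finset ℝ) [Inhabited θ] (x : ℝ) : θ := if h : x ∈ θ then ⟨x, h⟩ else default

theorem coe_toWeight {θ : Finset ℝ} [Inhabited θ] {x : ℝ} (h : x ∈ θ) : (toWeight θ x : ℝ) = x := by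
  simp [toWeight, h]

/-- The sign with which a copy of a network enters a sum: `true` is plus, `false` is minus. -/
def blockSign (b : Bool) : ℝ := if b then 1 else -1

namespace cnfWeights

variable {k : ℕ} {θr θ : Finset ℝ}

theorem intCast_mul_mul_add_mem (hθ : cnfWeights k θr ⊆ (θ : Set ℝ)) {j : ℤ} (hj : |j| ≤ (k : ℤ))
    {a b c : ℝ} (ha : a ∈ (θr : Set ℝ) ∪ {-1, 0, 1}) (hb : b ∈ (θr : Set ℝ) ∪ {-1, 0, 1})
    (hc : c ∈ (θr : Set ℝ) ∪ {-1, 0, 1}) : j * a * b + c ∈ θ :=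
  hθ ⟨j, hj, a, ha, b, hb, c, hc, rfl⟩

theorem intCast_mul_add_mem (hθ : cnfWeights k θr ⊆ (θ : Set ℝ)) {j : ℤ} (hj : |j| ≤ (k : ℤ))
    (a c : θr) : (j : ℝ) * a + c ∈ θ := by
  simpa using intCast_mul_mul_add_mem hθ hj (b := 1) (.inl a.2) (by simp) (.inl c.2)

theorem intCast_mul_mem (hθ : cnfWeights k θr ⊆ (θ : Set ℝ)) {j : ℤ} (hj : |j| ≤ (k : ℤ))
    (a : θr) : (j : ℝ) * a ∈ θ := by
  simpa using intCast_mul_mul_add_mem hθ hj (b := 1) (c := 0) (.inl a.2) (by simp) (by simp)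

theorem coe_mem (hθ : cnfWeights k θr ⊆ (θ : Set ℝ)) (a : θr) : (a : ℝ) ∈ θ := by
  simpa using intCast_mul_add_mem hθ (j := 0) (by simp) a a

theorem zero_mem (hθ : cnfWeights k θr ⊆ (θ : Set ℝ)) : (0 : ℝ) ∈ θ := by
  simpa using intCast_mul_mul_add_mem hθ (j := 0) (by simp) (a := 0) (b := 0) (c := 0) (by simp)
    (by simp) (by simp)

theorem add_mem (hθ : cnfWeights k θr ⊆ (θ : Set ℝ)) (hk : 1 ≤ k) (a b : θr) : (a : ℝ) + b ∈ θ := by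
  simpa using intCast_mul_add_mem hθ (j := 1) (by simpa using hk) a b

theorem blockSign_mul_mul_mem (hθ : cnfWeights k θr ⊆ (θ : Set ℝ)) (hk : 1 ≤ k) (s : Bool)
    (a b : θr) : blockSign s * (a : ℝ) * b ∈ θ := by
  have key (j : ℤ) (hj : |j| ≤ 1) : (j : ℝ) * a * b ∈ θ := by
    simpa using intCast_mul_mul_add_mem hθ (hj.trans (by exact_mod_cast hk)) (c := 0)
      (.inl a.2) (.inl b.2) (by simp)
  cases s
  · simpa [blockSign] using key (-1) (by simp)
  · simpa [blockSign] using key 1 (by simp)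

end cnfWeights

theorem sum_toWeight_mul {θ : Finset ℝ} [Inhabited θ] {B q : ℕ} {w : Fin B → Fin q → ℝ}
    (hw : ∀ c j, w c j ∈ θ) (x : Fin B → Fin q → ℝ) :
    ∑ z : Fin (B * q), (toWeight θ (w z.divNat z.modNat) : ℝ) * x z.divNat z.modNat =
      ∑ c, ∑ j, w c j * x c j := by
  simp only [coe_toWeight (hw _ _)]
  rw [← Fintype.sum_prod_type' fun c j => w c j * x c j]
  exact finProdFinEquiv.symm.sum_comp fun y : Fin B × Fin q => w y.1 y.2 * x y.1 y.2

namespace Net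

variable {θr : Finset ℝ} (θ : Finset ℝ) [Inhabited θ]

/-- A network with weights in `θr` as a network with weights in `θ`. -/
def lift : {m : ℕ} → Net θr m → Net θ m
  | _, .last W b => .last (fun j => toWeight θ (W j)) (toWeight θ b)
  | _, .layer W b rest =>
      layer (.of fun i j => toWeight θ (W i j)) (fun i => toWeight θ (b i)) rest.lift

/-- Run `B` copies of a network side by side, add up the results with signs, and feed one plus the
sum into the network with first layer `W₁`, `b₁`, and further layers `tail`. -/
def parallel {B p : ℕ} (sg : Fin B → Bool) (W₁ : Matrix (Fin p) (Fin 1) θr) (b₁ : Fin p → θr)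
    (tail : Net θr p) : {q : ℕ} → Net θr q → Net θ (B * q)
  | _, .last W _ =>
      .layer (.of fun i z => toWeight θ (blockSign (sg z.divNat) * W₁ i 0 * W z.modNat))
        (fun i => toWeight θ (W₁ i 0 + b₁ i)) (tail.lift θ)
  | _, .layer (p := p') W b rest =>
      .layer (p := B * p')
        (.of fun y z =>
          if y.divNat = z.divNat then toWeight θ (W y.modNat z.modNat) else toWeight θ 0)
        (fun y => toWeight θ (b y.modNat)) (parallel sg W₁ b₁ tail rest)

/-- Affine forms in `m` variables with integer coefficients, as pairs of the linear part and the
constant term. -/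
abbrev Form (m : ℕ) := (Fin m → ℤ) × ℤ

/-- The value of an affine form. -/
def Form.eval {m : ℕ} (f : Form m) (x : Fin m → ℝ) : ℝ := ∑ v, (f.1 v : ℝ) * x v + f.2

/-- Apply a network to one plus the signed sum of its values at affine forms. -/
def ofForms {m p : ℕ} (items : List (Bool × Form m)) (W₁ : Matrix (Fin p) (Fin 1) θr)
    (b₁ : Fin p → θr) (rest : Net θr p) : Net θ m :=
  .layer (p := items.length * p)
    (.of fun y v => toWeight θ ((items.get y.divNat).2.1 v * W₁ y.modNat 0))
    (fun y => toWeight θ ((items.get y.divNat).2.2 * W₁ y.modNat 0 + b₁ y.modNat))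
    (parallel θ (fun c => (items.get c).1) W₁ b₁ rest rest)

variable {θ}

section Realize

variable {σ : ℝ → ℝ} {k : ℕ}

omit [Inhabited θ] in
theorem realize_layer {m p : ℕ} (W : Matrix (Fin p) (Fin m) θ) (b : Fin p → θ) (rest : Net θ p)
    (x : Fin m → ℝ) : (layer W b rest).realize σ x =
      rest.realize σ fun i => σ (∑ j, (W i j : ℝ) * x j + (b i : ℝ)) := rfl

theorem realize_lift (hθ : cnfWeights k θr ⊆ (θ : Set ℝ)) {m : ℕ} (Φ : Net θr m) (x : Fin m → ℝ) :
    (Φ.lift θ).realize σ x = Φ.realize σ x := by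
  induction Φ with
  | last W b => simp [lift, realize, coe_toWeight (cnfWeights.coe_mem hθ _)]
  | layer W b rest ih => simp [lift, realize, coe_toWeight (cnfWeights.coe_mem hθ _), ih]

-- Since the signs add up to zero, the bias of `last W b` cancels.
theorem realize_parallel_last (hθ : cnfWeights k θr ⊆ (θ : Set ℝ)) (hk : 1 ≤ k) {B p q : ℕ}
    (sg : Fin B → Bool) (hsg : ∑ c, blockSign (sg c) = 0) (W₁ : Matrix (Fin p) (Fin 1) θr)
    (b₁ : Fin p → θr) (tail : Net θr p) (W : Fin q → θr) (b : θr) (x : Fin B → Fin q → ℝ) :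
    (parallel θ sg W₁ b₁ tail (.last W b)).realize σ (fun z => x z.divNat z.modNat) =
      (Net.layer W₁ b₁ tail).realize σ
        (fun _ => 1 + ∑ c, blockSign (sg c) * (∑ j, (W j : ℝ) * x c j + b)) := by
  refine (realize_layer _ _ _ _).trans ((realize_lift hθ _ _).trans ?_)
  refine congrArg (tail.realize σ) (funext fun i => congrArg σ ?_)
  have hsum : ∑ z : Fin (B * q), (toWeight θ (blockSign (sg z.divNat) * W₁ i 0 * W z.modNat) : ℝ) *
      x z.divNat z.modNat = W₁ i 0 * ∑ c, blockSign (sg c) * ∑ j, (W j : ℝ) * x c j := by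
    rw [sum_toWeight_mul (w := fun c j => blockSign (sg c) * W₁ i 0 * W j)
      fun c j => cnfWeights.blockSign_mul_mul_mem hθ hk _ _ _]
    simp only [Finset.mul_sum]
    exact Finset.sum_congr rfl fun c _ => Finset.sum_congr rfl fun j _ => by ring
  have hbias : ∑ c, blockSign (sg c) * (∑ j, (W j : ℝ) * x c j + b) =
      ∑ c, blockSign (sg c) * ∑ j, (W j : ℝ) * x c j := by
    simp only [mul_add, Finset.sum_add_distrib, ← Finset.sum_mul, hsg, zero_mul, add_zero]
  simp only [Matrix.of_apply, Finset.univ_unique, Finset.sum_singleton, Fin.default_eq_zero]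
  rw [hsum, hbias, coe_toWeight (cnfWeights.add_mem hθ hk _ _)]
  ring

theorem realize_parallel (hθ : cnfWeights k θr ⊆ (θ : Set ℝ)) (hk : 1 ≤ k) {B p : ℕ}
    (sg : Fin B → Bool) (hsg : ∑ c, blockSign (sg c) = 0)
    (W₁ : Matrix (Fin p) (Fin 1) θr) (b₁ : Fin p → θr) (tail : Net θr p) {q : ℕ} (Φ : Net θr q)
    (x : Fin B → Fin q → ℝ) :
    (parallel θ sg W₁ b₁ tail Φ).realize σ (fun z => x z.divNat z.modNat) =
      (Net.layer W₁ b₁ tail).realize σ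
        (fun _ => 1 + ∑ c, blockSign (sg c) * Φ.realize σ (x c)) := by
  induction Φ with
  | last W b => exact realize_parallel_last hθ hk sg hsg W₁ b₁ tail W b x
  | layer W b rest ih =>
    refine (realize_layer _ _ _ _).trans (Eq.trans ?_
      (ih fun c i => σ (∑ j, (W i j : ℝ) * x c j + (b i : ℝ))))
    refine congrArg (realize σ _) (funext fun y => congrArg σ ?_)
    have hw (c : Fin B) j : (if y.divNat = c then (W y.modNat j : ℝ) else 0) ∈ θ := by
      split_ifs
      exacts [cnfWeights.coe_mem hθ _, cnfWeights.zero_mem hθ]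
    simp only [Matrix.of_apply, ← apply_ite (toWeight θ), sum_toWeight_mul hw,
      coe_toWeight (cnfWeights.coe_mem hθ _), ite_mul, zero_mul, Finset.sum_ite_irrel,
      Finset.sum_const_zero, Finset.sum_ite_eq, Finset.mem_univ, if_true]

theorem realize_ofForms (hθ : cnfWeights k θr ⊆ (θ : Set ℝ)) (hk : 1 ≤ k) {m p : ℕ}
    (items : List (Bool × Form m))
    (hitems : ∀ f ∈ items, (∀ v, |f.2.1 v| ≤ (k : ℤ)) ∧ |f.2.2| ≤ (k : ℤ))
    (hsg : (items.map fun f => blockSign f.1).sum = 0)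
    (W₁ : Matrix (Fin p) (Fin 1) θr) (b₁ : Fin p → θr) (rest : Net θr p) (x : Fin m → ℝ) :
    (ofForms θ items W₁ b₁ rest).realize σ x =
      (Net.layer W₁ b₁ rest).realize σ fun _ => 1 + (items.map fun f =>
        blockSign f.1 * (Net.layer W₁ b₁ rest).realize σ fun _ => f.2.eval x).sum := by
  have hsum (g : Bool × Form m → ℝ) : (items.map g).sum = ∑ c, g (items.get c) := by
    rw [← List.sum_ofFn, ← Function.comp_def, ← List.map_ofFn, List.ofFn_get]
  rw [hsum] at hsg ⊢
  refine (realize_layer _ _ _ _).trans (Eq.trans ?_ (realize_parallel hθ hk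
    (fun c => (items.get c).1) hsg W₁ b₁ rest rest fun c i =>
      σ (∑ j, (W₁ i j : ℝ) * (items.get c).2.eval x + (b₁ i : ℝ))))
  refine congrArg (realize σ _) (funext fun y => congrArg σ ?_)
  obtain ⟨hlin, hconst⟩ := hitems _ (List.get_mem items y.divNat)
  simp only [Matrix.of_apply, coe_toWeight (cnfWeights.intCast_mul_mem hθ (hlin _) _),
    coe_toWeight (cnfWeights.intCast_mul_add_mem hθ hconst _ _), Form.eval, Finset.univ_unique,
    Finset.sum_singleton, Fin.default_eq_zero, mul_add, Finset.mul_sum]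
  rw [mul_comm (W₁ y.modNat 0 : ℝ), add_assoc]
  congr 1
  exact Finset.sum_congr rfl fun v _ => by ring

theorem depth_lift {m : ℕ} (Φ : Net θr m) : (Φ.lift θ).depth = Φ.depth := by
  induction Φ with
  | last => rfl
  | layer _ _ rest ih => exact congrArg (· + 1) ih

theorem depth_parallel {B p q : ℕ} (sg : Fin B → Bool) (W₁ : Matrix (Fin p) (Fin 1) θr)
    (b₁ : Fin p → θr) (tail : Net θr p) (Φ : Net θr q) :
    (parallel θ sg W₁ b₁ tail Φ).depth = Φ.depth + tail.depth := by
  induction Φ with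
  | last => simp [parallel, depth, depth_lift]; omega
  | layer _ _ rest ih => simp [parallel, depth, ih]; omega

theorem depth_ofForms {m p : ℕ} (items : List (Bool × Form m)) (W₁ : Matrix (Fin p) (Fin 1) θr)
    (b₁ : Fin p → θr) (rest : Net θr p) :
    (ofForms θ items W₁ b₁ rest).depth = 2 * rest.depth + 1 := by
  simp [ofForms, depth, depth_parallel]; omega

theorem widthLE_lift {m w w' : ℕ} {Φ : Net θr m} (h : Φ.WidthLE w) (hw : w ≤ w') :
    (Φ.lift θ).WidthLE w' := by
  induction Φ with
  | last W b => exact ⟨⟨h.1.1, h.1.2.trans hw⟩, h.2.trans hw⟩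
  | layer W b rest ih => exact ⟨⟨h.1.1, h.1.2.trans hw⟩, ih h.2⟩

theorem widthLE_parallel {B p q w w' : ℕ} (sg : Fin B → Bool) (W₁ : Matrix (Fin p) (Fin 1) θr)
    (b₁ : Fin p → θr) {tail : Net θr p} {Φ : Net θr q} (hB : 1 ≤ B) (hw : B * w ≤ w')
    (ht : tail.WidthLE w) (hΦ : Φ.WidthLE w) : (parallel θ sg W₁ b₁ tail Φ).WidthLE w' := by
  have hw' : w ≤ w' := (Nat.le_mul_of_pos_left w hB).trans hw
  induction Φ with
  | last W b =>
    exact ⟨⟨Nat.mul_pos hB hΦ.1.1, (Nat.mul_le_mul_left B hΦ.1.2).trans hw⟩, widthLE_lift ht hw'⟩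
  | layer W b rest ih =>
    exact ⟨⟨Nat.mul_pos hB hΦ.1.1, (Nat.mul_le_mul_left B hΦ.1.2).trans hw⟩, ih hΦ.2⟩

theorem widthLE_ofForms {m p w w' : ℕ} {items : List (Bool × Form m)}
    (W₁ : Matrix (Fin p) (Fin 1) θr) (b₁ : Fin p → θr) {rest : Net θr p}
    (hm : 1 ≤ m) (hm' : m ≤ w') (hB : 1 ≤ items.length) (hw : items.length * w ≤ w')
    (h : rest.WidthLE w) : (ofForms θ items W₁ b₁ rest).WidthLE w' :=
  ⟨⟨hm, hm'⟩, widthLE_parallel _ W₁ b₁ hB hw h h⟩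

end Realize

section Encode

/-- The word of a block diagonal layer with `B` equal blocks, given by the words of the rows and of
the biases; `Z` is the word of a row of a zero block. -/
def blockWord {α : Type} (B : ℕ) (Z : List α) (rows : List (List α × List α)) : List α :=
  (List.range B).flatMap fun c => rows.flatMap fun R =>
    (List.replicate c Z).flatten ++ R.1 ++ (List.replicate (B - 1 - c) Z).flatten ++ R.2

/-- The words of the rows and of the biases of a layer, in the format of `blockWord`. -/
def layerRows {p q : ℕ} (W : Matrix (Fin p) (Fin q) θr) (b : Fin p → θr) :
    List (List (NetSym θ) × List (NetSym θ)) :=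
  List.ofFn fun i => (List.ofFn fun j => NetSym.weight (toWeight θ (W i j)),
    [NetSym.weight (toWeight θ (b i)), NetSym.endNeuron])

theorem encodeNet_parallel_layer {B p q p' : ℕ} (sg : Fin B → Bool)
    (W₁ : Matrix (Fin p) (Fin 1) θr) (b₁ : Fin p → θr) (tail : Net θr p)
    (W : Matrix (Fin p') (Fin q) θr) (b : Fin p' → θr) (rest : Net θr p') :
    encodeNet (parallel θ sg W₁ b₁ tail (.layer W b rest)) =
      blockWord B (List.replicate q (NetSym.weight (toWeight θ 0))) (layerRows W b) ++
        [NetSym.endLayer] ++ encodeNet (parallel θ sg W₁ b₁ tail rest) := by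
  refine congrArg (· ++ [NetSym.endLayer] ++ encodeNet (parallel θ sg W₁ b₁ tail rest)) ?_
  refine (congrArg List.flatten (ofFn_divNat_modNat fun (c : Fin B) (i : Fin p') =>
    (List.ofFn fun z : Fin (B * q) => NetSym.weight (if c = z.divNat then
      toWeight θ (W i z.modNat) else toWeight θ 0)) ++
      [NetSym.weight (toWeight θ (b i)), NetSym.endNeuron])).trans ?_
  rw [List.flatten_flatten, List.map_ofFn, blockWord, ← flatten_ofFn_val]
  refine congrArg List.flatten (congrArg List.ofFn (funext fun c => ?_))
  rw [layerRows, ← flatten_ofFn_comp]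
  refine congrArg List.flatten (congrArg List.ofFn (funext fun i => ?_))
  have h := ofFn_divNat_modNat fun (c' : Fin B) (j : Fin q) =>
    (NetSym.weight (if c = c' then toWeight θ (W i j) else toWeight θ 0) : NetSym θ)
  have h' : (fun c' : Fin B => List.ofFn fun j : Fin q =>
      (NetSym.weight (if c = c' then toWeight θ (W i j) else toWeight θ 0) : NetSym θ)) =
      fun c' => if c = c' then List.ofFn fun j => NetSym.weight (toWeight θ (W i j)) else
        List.replicate q (NetSym.weight (toWeight θ 0)) := by
    funext c'
    split_ifs
    · rfl
    · exact List.ofFn_const _ _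
  rw [h, h', ofFn_ite_eq]
  simp

theorem encodeNet_parallel_last {m p q : ℕ} (items : List (Bool × Form m))
    (W₁ : Matrix (Fin p) (Fin 1) θr) (b₁ : Fin p → θr) (tail : Net θr p)
    (W : Fin q → θr) (b : θr) :
    encodeNet (parallel θ (fun c => (items.get c).1) W₁ b₁ tail (.last W b)) =
      ((List.ofFn fun i => ((items.map Prod.fst).flatMap fun s =>
        List.ofFn fun j => NetSym.weight (toWeight θ (blockSign s * W₁ i 0 * W j))) ++
          [NetSym.weight (toWeight θ (W₁ i 0 + b₁ i)), NetSym.endNeuron]).flatten) ++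
        [NetSym.endLayer] ++ encodeNet (tail.lift θ) := by
  refine congrArg (· ++ [NetSym.endLayer] ++ encodeNet (tail.lift θ)) ?_
  refine congrArg List.flatten (congrArg List.ofFn (funext fun i => ?_))
  refine congrArg (· ++ [NetSym.weight (toWeight θ (W₁ i 0 + b₁ i)), NetSym.endNeuron]) ?_
  refine (ofFn_divNat_modNat fun (c : Fin items.length) (j : Fin q) =>
    (NetSym.weight (toWeight θ (blockSign (items.get c).1 * W₁ i 0 * W j)) : NetSym θ)).trans ?_
  rw [List.flatMap_map]
  exact flatten_ofFn_get items fun it =>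
    List.ofFn fun j => NetSym.weight (toWeight θ (blockSign it.1 * W₁ i 0 * W j))

/-- The word of the neurons that evaluate the first layer of a network at an affine form. -/
def formWord {m p : ℕ} (W₁ : Matrix (Fin p) (Fin 1) θr) (b₁ : Fin p → θr) (f : Form m) :
    List (NetSym θ) :=
  (List.ofFn fun i => (List.ofFn fun v => NetSym.weight (toWeight θ (f.1 v * W₁ i 0))) ++
    [NetSym.weight (toWeight θ (f.2 * W₁ i 0 + b₁ i)), NetSym.endNeuron]).flatten

theorem encodeNet_ofForms {m p : ℕ} (items : List (Bool × Form m))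
    (W₁ : Matrix (Fin p) (Fin 1) θr) (b₁ : Fin p → θr) (rest : Net θr p) :
    encodeNet (ofForms θ items W₁ b₁ rest) =
      (items.flatMap fun f => formWord W₁ b₁ f.2) ++ [NetSym.endLayer] ++
        encodeNet (parallel θ (fun c => (items.get c).1) W₁ b₁ rest rest) := by
  refine congrArg (· ++ [NetSym.endLayer] ++
    encodeNet (parallel θ (fun c => (items.get c).1) W₁ b₁ rest rest)) ?_
  refine (congrArg List.flatten (ofFn_divNat_modNat fun (c : Fin items.length) (i : Fin p) =>
    (List.ofFn fun v => NetSym.weight (toWeight θ ((items.get c).2.1 v * W₁ i 0))) ++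
      [NetSym.weight (toWeight θ ((items.get c).2.2 * W₁ i 0 + b₁ i)), NetSym.endNeuron])).trans ?_
  rw [List.flatten_flatten, List.map_ofFn]
  exact flatten_ofFn_get items fun it => formWord W₁ b₁ it.2

end Encode

end Net

/-! ### The matrix of a network with values `0` and `1` -/

theorem norm_toEuclideanCLM_le {N : ℕ} (M : Matrix (Fin N) (Fin N) ℝ) :
    ‖Matrix.toEuclideanCLM (𝕜 := ℝ) M‖ ≤ √(∑ i, ∑ j, M i j ^ 2) := by
  refine ContinuousLinearMap.opNorm_le_bound _ (Real.sqrt_nonneg _) fun x => ?_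
  rw [EuclideanSpace.norm_eq, EuclideanSpace.norm_eq, ← Real.sqrt_mul (by positivity)]
  refine Real.sqrt_le_sqrt ?_
  rw [Finset.sum_mul]
  refine Finset.sum_le_sum fun i _ => ?_
  simp only [Real.norm_eq_abs, sq_abs]
  exact Finset.sum_mul_sq_le_sq_mul_sq Finset.univ (fun j => M i j) fun j => x j

theorem sqrt_mul_sum_le_norm_mulVec_one {N : ℕ} {M : Matrix (Fin N) (Fin N) ℝ} {R : ℝ}
    (hM : ∀ i j, M i j = 0 ∨ M i j = 1) (hrow : ∀ i j, M i j = 1 → R ≤ ∑ j, M i j) :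
    √(R * ∑ i, ∑ j, M i j) ≤ ‖WithLp.toLp 2 (M.mulVec 1)‖ := by
  have hrow_nonneg (i : Fin N) : 0 ≤ ∑ j, M i j :=
    Finset.sum_nonneg fun j _ => by rcases hM i j with h | h <;> simp [h]
  rw [EuclideanSpace.norm_eq, Finset.mul_sum]
  refine Real.sqrt_le_sqrt (Finset.sum_le_sum fun i _ => ?_)
  have hmulVec : M.mulVec 1 i = ∑ j, M i j := by simp [Matrix.mulVec, dotProduct]
  rw [PiLp.toLp_apply, hmulVec, Real.norm_eq_abs, sq_abs]
  by_cases h : ∃ j, M i j = 1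
  · obtain ⟨j, hj⟩ := h
    rw [sq]
    exact mul_le_mul_of_nonneg_right (hrow i j hj) (hrow_nonneg i)
  · push Not at h
    simp [fun j => (hM i j).resolve_right (h j)]

theorem le_mvmRatio {N : ℕ} {M : Matrix (Fin N) (Fin N) ℝ} {R : ℝ}
    (hM : ∀ i j, M i j = 0 ∨ M i j = 1) (hone : ∃ i j, M i j = 1) (hR : 0 ≤ R)
    (hrow : ∀ i j, M i j = 1 → R ≤ ∑ j, M i j) :
    √(R / N) ≤ mvmRatio M := by
  obtain ⟨i₀, j₀, h₀⟩ := hone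
  have hN : (0 : ℝ) < N := by exact_mod_cast i₀.pos
  set S := ∑ i, ∑ j, M i j
  have hsq : ∑ i, ∑ j, M i j ^ 2 = S :=
    Finset.sum_congr rfl fun i _ => Finset.sum_congr rfl fun j _ => by
      rcases hM i j with h | h <;> simp [h]
  have hS : 0 ≤ S := hsq ▸ by positivity
  have hnorm : ‖Matrix.toEuclideanCLM (𝕜 := ℝ) M‖ ≤ √S := hsq ▸ norm_toEuclideanCLM_le M
  have hpos : 0 < ‖Matrix.toEuclideanCLM (𝕜 := ℝ) M‖ := by
    rw [norm_pos_iff]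
    intro h
    have : M = 0 := by simpa using h
    simp [this] at h₀
  rw [mvmRatio, show ‖WithLp.toLp 2 (1 : Fin N → ℝ)‖ = √N by simp [EuclideanSpace.norm_eq],
    le_div_iff₀ (mul_pos hpos (Real.sqrt_pos.2 hN))]
  calc √(R / N) * (‖Matrix.toEuclideanCLM (𝕜 := ℝ) M‖ * √N) ≤ √(R / N) * (√S * √N) := by gcongr
    _ = √(R * S) := by
      rw [← Real.sqrt_mul hS, ← Real.sqrt_mul (by positivity)]
      congr 1
      field_simp
    _ ≤ _ := sqrt_mul_sum_le_norm_mulVec_one hM hrow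

/-- The first `ℓ` binary digits of `i` followed by the binary digits of `j`, where `i` and `j` have
`d` digits: the input at which the entry `(i, j)` of `netMatrix` is evaluated. -/
def concatBits (ℓ d i j p : ℕ) : Bool :=
  if p < ℓ then i.testBit (d - 1 - p) else j.testBit (d - 1 - (p - ℓ))

theorem exists_concatBits_eq {ℓ d : ℕ} (hd : ℓ ≤ d) (x : ℕ → Bool) :
    ∃ i j : Fin (2 ^ d), ∀ p < 2 * ℓ, concatBits ℓ d i j p = x p := by
  refine ⟨⟨_, Nat.ofBits_lt_two_pow fun q : Fin d => x (d - 1 - q)⟩,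
    ⟨_, Nat.ofBits_lt_two_pow fun q : Fin d => x (ℓ + (d - 1 - q))⟩, fun p hp => ?_⟩
  rw [concatBits]
  split_ifs with h
  · rw [Nat.testBit_ofBits_lt _ _ (by omega)]
    congr 1; dsimp only; omega
  · rw [Nat.testBit_ofBits_lt _ _ (by omega)]
    congr 1; dsimp only; omega

theorem concatBits_eq_of_div_eq {ℓ d i j j' p : ℕ} (hd : ℓ ≤ d) (hp : p < 2 * ℓ)
    (hj : j / 2 ^ (d - ℓ) = j' / 2 ^ (d - ℓ)) : concatBits ℓ d i j p = concatBits ℓ d i j' p := by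
  rw [concatBits, concatBits]
  split_ifs with h
  · rfl
  · rw [show d - 1 - (p - ℓ) = (ℓ - 1 - (p - ℓ)) + (d - ℓ) by omega, ← Nat.testBit_div_two_pow,
      ← Nat.testBit_div_two_pow, hj]

theorem le_card_filter_div_eq {m n : ℕ} (hm : 0 < m) (hmn : m ∣ n) (j : Fin n) :
    m ≤ (Finset.univ.filter fun j' : Fin n => (j' : ℕ) / m = (j : ℕ) / m).card := by
  obtain ⟨a, rfl⟩ := hmn
  have hlt (u : Fin m) : m * ((j : ℕ) / m) + u < m * a :=
    calc m * ((j : ℕ) / m) + u < m * ((j : ℕ) / m) + m := by omega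
      _ = m * ((j : ℕ) / m + 1) := by ring
      _ ≤ m * a := Nat.mul_le_mul_left m (Nat.div_lt_of_lt_mul j.2)
  calc m = (Finset.univ : Finset (Fin m)).card := by simp
    _ ≤ _ := Finset.card_le_card_of_injOn (fun u => ⟨_, hlt u⟩)
      (fun u _ => by simp [Nat.mul_add_div hm, Nat.div_eq_of_lt u.2])
      fun u _ v _ huv => by simpa [Fin.ext_iff] using huv

theorem netMatrix_apply {θ : Finset ℝ} (σ : ℝ → ℝ) {ℓ : ℕ} (Φ : Net θ (2 * ℓ)) (d : ℕ)
    (i j : Fin (2 ^ d)) : netMatrix σ d Φ i j =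
      Φ.realize σ fun p => if concatBits ℓ d i j p then 1 else 0 := by
  rw [netMatrix, Matrix.of_apply]
  congr 1
  funext p
  simp only [binDigit, concatBits]
  split_ifs <;> rfl

section TruthValues

variable {θ : Finset ℝ} {σ : ℝ → ℝ} {ℓ : ℕ} {Φ : Net θ (2 * ℓ)} {P : (ℕ → Bool) → Prop}
  [DecidablePred P]

theorem netMatrix_apply_eq_ite
    (hΦ : ∀ x : ℕ → Bool, Φ.realize σ (fun p => if x p then 1 else 0) = if P x then 1 else 0)
    (d : ℕ) (i j : Fin (2 ^ d)) :
    netMatrix σ d Φ i j = if P (concatBits ℓ d i j) then 1 else 0 := by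
  rw [netMatrix_apply, hΦ]

theorem mvmRatio_netMatrix_eq_zero
    (hΦ : ∀ x : ℕ → Bool, Φ.realize σ (fun p => if x p then 1 else 0) = if P x then 1 else 0)
    (hP : ¬ ∃ x, P x) (d : ℕ) : mvmRatio (netMatrix σ d Φ) = 0 := by
  push Not at hP
  have : netMatrix σ d Φ = 0 := by
    ext i j
    rw [netMatrix_apply_eq_ite hΦ, if_neg (hP _), Matrix.zero_apply]
  simp [mvmRatio, this]

theorem two_pow_le_sum_netMatrix
    (hΦ : ∀ x : ℕ → Bool, Φ.realize σ (fun p => if x p then 1 else 0) = if P x then 1 else 0)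
    {d : ℕ} (hd : ℓ ≤ d) {i j : Fin (2 ^ d)} (hij : netMatrix σ d Φ i j = 1) :
    (2 : ℝ) ^ (d - ℓ) ≤ ∑ j', netMatrix σ d Φ i j' := by
  have hnonneg (j' : Fin (2 ^ d)) : 0 ≤ netMatrix σ d Φ i j' := by
    rw [netMatrix_apply_eq_ite hΦ]
    split_ifs <;> norm_num
  have hone (j' : Fin (2 ^ d)) (hj' : (j' : ℕ) / 2 ^ (d - ℓ) = j / 2 ^ (d - ℓ)) :
      netMatrix σ d Φ i j' = 1 := by
    rw [← hij, netMatrix_apply, netMatrix_apply]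
    congr 1
    funext p
    rw [concatBits_eq_of_div_eq hd p.2 hj']
  let s := Finset.univ.filter fun j' : Fin (2 ^ d) => (j' : ℕ) / 2 ^ (d - ℓ) = j / 2 ^ (d - ℓ)
  calc (2 : ℝ) ^ (d - ℓ) ≤ s.card := by
        exact_mod_cast le_card_filter_div_eq (by positivity)
          (pow_dvd_pow 2 (Nat.sub_le d ℓ)) j
    _ = ∑ j' ∈ s, netMatrix σ d Φ i j' := by
        rw [Finset.sum_congr rfl fun j' hj' => hone j' (Finset.mem_filter.1 hj').2]
        rw [Finset.sum_const, nsmul_one]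
    _ ≤ ∑ j', netMatrix σ d Φ i j' :=
        Finset.sum_le_sum_of_subset_of_nonneg (Finset.subset_univ _) fun j' _ _ => hnonneg j'

theorem le_mvmRatio_netMatrix
    (hΦ : ∀ x : ℕ → Bool, Φ.realize σ (fun p => if x p then 1 else 0) = if P x then 1 else 0)
    (hP : ∃ x, P x) {d : ℕ} (hd : ℓ ≤ d) :
    √((2 : ℝ) ^ ℓ)⁻¹ ≤ mvmRatio (netMatrix σ d Φ) := by
  obtain ⟨x, hx⟩ := hP
  have h01 (i j) : netMatrix σ d Φ i j = 0 ∨ netMatrix σ d Φ i j = 1 := by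
    rw [netMatrix_apply_eq_ite hΦ]
    exact (ite_eq_or_eq _ _ _).symm
  have hone : ∃ i j, netMatrix σ d Φ i j = 1 := by
    obtain ⟨i, j, hij⟩ := exists_concatBits_eq hd x
    refine ⟨i, j, ?_⟩
    rw [netMatrix_apply]
    refine Eq.trans ?_ ((hΦ x).trans (if_pos hx))
    congr 1
    funext p
    rw [hij p p.2]
  refine le_trans (Real.sqrt_le_sqrt (le_of_eq ?_)) (le_mvmRatio h01 hone (by positivity)
    fun i j => two_pow_le_sum_netMatrix hΦ hd)
  push_cast
  rw [eq_div_iff (by positivity), inv_mul_eq_iff_eq_mul₀ (by positivity), ← pow_add,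
    Nat.add_sub_cancel' hd]

end TruthValues

/-! ### Formulas as signed lists of affine forms -/

/-- The coefficient of the variable `v` in the sum of the literals of a clause. -/
def Clause.coef (c : Clause) (v : ℕ) : ℤ :=
  (c.map fun l => if l.1 = v then (if l.2 then 1 else -1) else 0).sum

/-- The number of negative literals of a clause. -/
def Clause.negs (c : Clause) : ℤ := (c.map fun l => if l.2 then 0 else 1).sum

/-- The sum of the literals of a clause, where the negation of `x` is `1 - x`. -/
def Clause.form (m : ℕ) (c : Clause) : Net.Form m := (fun v => c.coef v, c.negs)

/-- The constant affine form `1`. -/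
def Net.Form.one (m : ℕ) : Net.Form m := (fun _ => 0, 1)

/-- The signed forms of a formula: every clause contributes its form minus the constant `1`. The
leading pair `1 - 1` makes the list nonempty. -/
def CNF.items (m : ℕ) (α : CNF) : List (Bool × Net.Form m) :=
  [(true, .one m), (false, .one m)] ++
    α.flatMap fun c => [(true, Clause.form m c), (false, .one m)]

/-- The network of a formula: for a step function `Ψ`, given by its first layer `W₁`, `b₁` and its
further layers `rest`, it computes `Ψ (1 + ∑ (Ψ (form of c) - Ψ 1))`, where `c` runs through the
clauses. -/
def CNF.net {θr : Finset ℝ} (θ : Finset ℝ) [Inhabited θ] (m : ℕ) (α : CNF) {p : ℕ}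
    (W₁ : Matrix (Fin p) (Fin 1) θr) (b₁ : Fin p → θr) (rest : Net θr p) : Net θ m :=
  Net.ofForms θ (CNF.items m α) W₁ b₁ rest

/-- The network realizes a function with values in `[0,1]` which is `0` up to `0` and `1` from
`1` on. -/
structure Net.IsStep (σ : ℝ → ℝ) {θr : Finset ℝ} (Ψ : Net θr 1) : Prop where
  mem_Icc : ∀ x : ℝ, Ψ.realize σ (fun _ => x) ∈ Set.Icc (0 : ℝ) 1
  eq_zero : ∀ x : ℝ, x ≤ 0 → Ψ.realize σ (fun _ => x) = 0
  eq_one : ∀ x : ℝ, 1 ≤ x → Ψ.realize σ (fun _ => x) = 1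

theorem Net.IsStep.ne_last {σ : ℝ → ℝ} {θr : Finset ℝ} {Ψ : Net θr 1} (hΨ : Ψ.IsStep σ)
    (W : Fin 1 → θr) (b : θr) : Ψ ≠ .last W b := by
  rintro rfl
  have h_neg := hΨ.eq_zero (-1) (by norm_num)
  have h_zero := hΨ.eq_zero 0 le_rfl
  have h_one := hΨ.eq_one 1 le_rfl
  simp only [Net.realize, Finset.univ_unique, Finset.sum_singleton] at h_neg h_zero h_one
  linarith

theorem Clause.coef_cons (l : ℕ × Bool) (c : Clause) (v : ℕ) :
    Clause.coef (l :: c) v =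
      (if l.1 = v then (if l.2 then 1 else -1) else 0) + Clause.coef c v := by
  simp [Clause.coef]

theorem Clause.negs_cons (l : ℕ × Bool) (c : Clause) :
    Clause.negs (l :: c) = (if l.2 then 0 else 1) + Clause.negs c := by
  simp [Clause.negs]

theorem Clause.abs_coef_le (c : Clause) (v : ℕ) : |c.coef v| ≤ c.length := by
  induction c with
  | nil => simp [Clause.coef]
  | cons l c ih =>
    rw [Clause.coef_cons, List.length_cons, Nat.cast_add, Nat.cast_one]
    rw [abs_le] at ih ⊢
    split_ifs <;> constructor <;> linarith [ih.1, ih.2]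

theorem Clause.abs_negs_le (c : Clause) : |c.negs| ≤ c.length := by
  induction c with
  | nil => simp [Clause.negs]
  | cons l c ih =>
    rw [Clause.negs_cons, List.length_cons, Nat.cast_add, Nat.cast_one]
    rw [abs_le] at ih ⊢
    split_ifs <;> constructor <;> linarith [ih.1, ih.2]

theorem Net.Form.eval_one (m : ℕ) (x : Fin m → ℝ) : (Net.Form.one m).eval x = 1 := by
  simp [Net.Form.eval, Net.Form.one]

theorem Clause.eval_form {m : ℕ} {c : Clause} (hc : ∀ l ∈ c, l.1 < m) (x : ℕ → Bool) :
    (Clause.form m c).eval (fun v => if x v then 1 else 0) =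
      (c.map fun l => if x l.1 = l.2 then (1 : ℝ) else 0).sum := by
  induction c with
  | nil => simp [Net.Form.eval, Clause.form, Clause.coef, Clause.negs]
  | cons l c ih =>
    have ih' := ih fun l hl => hc l (by simp [hl])
    simp only [Net.Form.eval, Clause.form, Clause.coef, Clause.negs] at ih'
    simp only [Net.Form.eval, Clause.form, Clause.coef, Clause.negs, List.map_cons, List.sum_cons,
      ← ih']
    push_cast
    simp only [add_mul, Finset.sum_add_distrib]
    have hvar : ∑ v : Fin m, (if l.1 = (v : ℕ) then (if l.2 = true then (1 : ℝ) else -1) else 0) *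
        (if x v = true then 1 else 0) =
        (if l.2 = true then (1 : ℝ) else -1) * (if x l.1 = true then 1 else 0) := by
      rw [Finset.sum_eq_single ⟨l.1, hc l (by simp)⟩]
      · simp
      · intro v _ hv
        rw [if_neg fun h => hv (Fin.ext h.symm), zero_mul]
      · simp
    have hlit : (if x l.1 = l.2 then (1 : ℝ) else 0) =
        (if l.2 = true then (1 : ℝ) else -1) * (if x l.1 = true then 1 else 0) +
          (if l.2 = true then 0 else 1) := by
      cases l.2 <;> cases x l.1 <;> simp
    rw [hvar, hlit]
    ring

theorem Clause.eval_form_eq_zero {m : ℕ} {c : Clause} (hc : ∀ l ∈ c, l.1 < m) (x : ℕ → Bool)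
    (h : ¬ ∃ l ∈ c, x l.1 = l.2) : (Clause.form m c).eval (fun v => if x v then 1 else 0) = 0 := by
  push Not at h
  rw [Clause.eval_form hc]
  refine List.sum_eq_zero ?_
  simp only [List.mem_map, forall_exists_index, and_imp]
  rintro _ l hl rfl
  rw [if_neg (h l hl)]

theorem Clause.one_le_eval_form {m : ℕ} {c : Clause} (hc : ∀ l ∈ c, l.1 < m) (x : ℕ → Bool)
    (h : ∃ l ∈ c, x l.1 = l.2) : 1 ≤ (Clause.form m c).eval (fun v => if x v then 1 else 0) := by
  obtain ⟨l, hl, h⟩ := h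
  rw [Clause.eval_form hc]
  refine List.single_le_sum ?_ _ (List.mem_map.2 ⟨l, hl, if_pos h⟩)
  simp only [List.mem_map, forall_exists_index, and_imp]
  rintro _ l _ rfl
  split_ifs <;> norm_num

theorem CNF.sum_items {m : ℕ} (α : CNF) (g : Net.Form m → ℝ) :
    ((CNF.items m α).map fun f => blockSign f.1 * g f.2).sum =
      (α.map fun c => g (Clause.form m c) - g (.one m)).sum := by
  rw [CNF.items, List.map_append, List.sum_append, List.map_flatMap,
    List.flatMap_def, List.sum_flatten, List.map_map]
  simp [blockSign, sub_eq_add_neg, Function.comp_def]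

theorem CNF.sum_sign_items (m : ℕ) (α : CNF) :
    ((CNF.items m α).map fun f => blockSign f.1).sum = 0 := by
  simpa using CNF.sum_items (m := m) α fun _ => 1

theorem CNF.length_items (m : ℕ) (α : CNF) : (CNF.items m α).length = 2 * (α.length + 1) := by
  simp only [CNF.items, List.length_append, List.length_flatMap, List.length_cons,
    List.length_nil, List.map_const', List.sum_replicate, smul_eq_mul]
  ring

theorem Net.Form.abs_one_le {k : ℕ} (hk : 1 ≤ k) (m : ℕ) :
    (∀ v, |(Net.Form.one m).1 v| ≤ (k : ℤ)) ∧ |(Net.Form.one m).2| ≤ (k : ℤ) :=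
  ⟨fun _ => by simp [Net.Form.one], by simpa [Net.Form.one] using hk⟩

theorem CNF.items_le {k m : ℕ} (hk : 1 ≤ k) {α : CNF} (hα : ∀ c ∈ α, c.length ≤ k) :
    ∀ f ∈ CNF.items m α, (∀ v, |f.2.1 v| ≤ (k : ℤ)) ∧ |f.2.2| ≤ (k : ℤ) := by
  intro f hf
  simp only [CNF.items, List.cons_append, List.nil_append, List.mem_cons, List.mem_flatMap,
    List.not_mem_nil, or_false] at hf
  rcases hf with rfl | rfl | ⟨c, hc, rfl | rfl⟩
  · exact Net.Form.abs_one_le hk m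
  · exact Net.Form.abs_one_le hk m
  · have hck : (c.length : ℤ) ≤ k := by exact_mod_cast hα c hc
    exact ⟨fun v => (Clause.abs_coef_le c v).trans hck, (Clause.abs_negs_le c).trans hck⟩
  · exact Net.Form.abs_one_le hk m

theorem sum_map_sub_one_le_neg_one {β : Type} {l : List β} {g : β → ℝ} (hg : ∀ c ∈ l, g c ≤ 1)
    {c : β} (hc : c ∈ l) (hgc : g c = 0) : (l.map fun c => g c - 1).sum ≤ -1 := by
  have hle : 1 ≤ (l.map fun c => 1 - g c).sum := by
    refine List.single_le_sum ?_ _ (List.mem_map.2 ⟨c, hc, by rw [hgc, sub_zero]⟩)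
    simp only [List.mem_map, forall_exists_index, and_imp]
    rintro _ c hc rfl
    exact sub_nonneg.2 (hg c hc)
  have hneg : (l.map fun c => g c - 1) = (l.map fun c => 1 - g c).map Neg.neg := by simp
  rw [hneg, ← List.sum_neg]
  exact neg_le_neg hle

section CNFNet

variable {k : ℕ} {σ : ℝ → ℝ} {θr θ : Finset ℝ} [Inhabited θ] {p : ℕ}
  {W₁ : Matrix (Fin p) (Fin 1) θr} {b₁ : Fin p → θr} {rest : Net θr p}

theorem CNF.realize_net (hΨ : (Net.layer W₁ b₁ rest).IsStep σ) (hk : 1 ≤ k)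
    (hθ : cnfWeights k θr ⊆ (θ : Set ℝ)) {m : ℕ} {α : CNF} (hα : ∀ c ∈ α, c.length ≤ k)
    (hm : ∀ c ∈ α, ∀ l ∈ c, l.1 < m) (x : ℕ → Bool) :
    (CNF.net θ m α W₁ b₁ rest).realize σ (fun v => if x v then 1 else 0) =
      if ∀ c ∈ α, ∃ l ∈ c, x l.1 = l.2 then 1 else 0 := by
  rw [CNF.net, Net.realize_ofForms hθ hk _ (CNF.items_le hk hα) (CNF.sum_sign_items _ _),
    CNF.sum_items α fun f => (Net.layer W₁ b₁ rest).realize σ fun _ =>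
      f.eval fun v => if x v then 1 else 0]
  simp only [Net.Form.eval_one, hΨ.eq_one 1 le_rfl]
  split_ifs with h
  · refine hΨ.eq_one _ (le_add_of_nonneg_right (List.sum_nonneg ?_))
    simp only [List.mem_map, forall_exists_index, and_imp]
    rintro _ c hc rfl
    rw [hΨ.eq_one _ (Clause.one_le_eval_form (hm c hc) x (h c hc)), sub_self]
  · push Not at h
    obtain ⟨c, hc, h⟩ := h
    have hzero := hΨ.eq_zero _ (Clause.eval_form_eq_zero (hm c hc) x (by push Not; exact h)).le
    exact hΨ.eq_zero _ (le_neg_iff_add_nonpos_left.1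
      (sum_map_sub_one_le_neg_one (fun c _ => (hΨ.mem_Icc _).2) hc hzero))

theorem CNF.net_mem_mvmClass (hΨ : (Net.layer W₁ b₁ rest).IsStep σ) {wr Lr : ℕ}
    (hmem : Net.layer W₁ b₁ rest ∈ netClass 1 wr Lr θr) (hk : 2 ≤ k)
    (hθ : cnfWeights k θr ⊆ (θ : Set ℝ)) {α : CNF} (hα : ∀ c ∈ α, c.length ≤ k) {C ℓ n : ℕ}
    (hℓ : 1 ≤ ℓ) (hn : ℓ ≤ n) (hC : α.length + 1 ≤ C * (2 * ℓ)) :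
    (⟨ℓ, CNF.net θ (2 * ℓ) α W₁ b₁ rest⟩ : Σ ℓ : ℕ, Net θ (2 * ℓ)) ∈
      mvmClass σ k C wr Lr θ n := by
  obtain ⟨⟨⟨-, hwr⟩, hwidth⟩, hdepth⟩ := hmem
  have hC_pos : 0 < C := Nat.pos_of_ne_zero fun h => by simp [h] at hC
  refine ⟨hℓ, hn, ⟨Net.widthLE_ofForms (m := 2 * ℓ) W₁ b₁ (by omega) ?_ ?_ ?_ hwidth, ?_⟩,
    fun x _ => ?_⟩
  · calc 2 * ℓ ≤ 2 * n := by omega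
      _ ≤ (2 * n) * (C * wr * k) := Nat.le_mul_of_pos_right _ (by positivity)
      _ = C * (2 * n) * wr * k := by ring
  · rw [CNF.length_items]
    omega
  · rw [CNF.length_items]
    calc 2 * (α.length + 1) * wr ≤ k * (C * (2 * n)) * wr := by gcongr; exact hC.trans (by gcongr)
      _ = C * (2 * n) * wr * k := by ring
  · have hLr : rest.depth + 1 ≤ Lr := hdepth
    have hrest : 1 ≤ rest.depth := by cases rest <;> simp [Net.depth]
    rw [CNF.net, Net.depth_ofForms]
    omega
  · dsimp only
    rw [CNF.net, Net.realize_ofForms hθ (by omega) _ (CNF.items_le (by omega) hα)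
      (CNF.sum_sign_items _ _)]
    exact hΨ.mem_Icc _

theorem CNF.mvmRatio_net_eq_zero (hΨ : (Net.layer W₁ b₁ rest).IsStep σ) (hk : 1 ≤ k)
    (hθ : cnfWeights k θr ⊆ (θ : Set ℝ)) {α : CNF} (hα : ∀ c ∈ α, c.length ≤ k) {ℓ : ℕ}
    (hℓ : ∀ c ∈ α, ∀ l ∈ c, l.1 < 2 * ℓ) (hsat : ¬ α.Satisfiable) (d : ℕ) :
    mvmRatio (netMatrix σ d (CNF.net θ (2 * ℓ) α W₁ b₁ rest)) = 0 :=
  mvmRatio_netMatrix_eq_zero (CNF.realize_net hΨ hk hθ hα hℓ) hsat d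

theorem CNF.le_mvmRatio_net (hΨ : (Net.layer W₁ b₁ rest).IsStep σ) (hk : 1 ≤ k)
    (hθ : cnfWeights k θr ⊆ (θ : Set ℝ)) {α : CNF} (hα : ∀ c ∈ α, c.length ≤ k) {ℓ : ℕ}
    (hℓ : ∀ c ∈ α, ∀ l ∈ c, l.1 < 2 * ℓ) (hsat : α.Satisfiable) {d : ℕ} (hd : ℓ ≤ d) :
    √((2 : ℝ) ^ ℓ)⁻¹ ≤ mvmRatio (netMatrix σ d (CNF.net θ (2 * ℓ) α W₁ b₁ rest)) :=
  le_mvmRatio_netMatrix (CNF.realize_net hΨ hk hθ hα hℓ) hsat hd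

end CNFNet

/-! ### Writing the network of a formula -/

/-- Integers of absolute value at most `k`. -/
abbrev Cell (k : ℕ) := Set.Icc (-(k : ℤ)) k

/-- The element of `Cell k` closest to `j`. -/
def Cell.clamp (k : ℕ) (j : ℤ) : Cell k :=
  ⟨max (-(k : ℤ)) (min j k), le_max_left _ _, max_le (by omega) (min_le_right _ _)⟩

theorem Cell.coe_clamp {k : ℕ} {j : ℤ} (hj : |j| ≤ (k : ℤ)) : (Cell.clamp k j : ℤ) = j := by
  rw [abs_le] at hj
  simp only [Cell.clamp]
  omega

namespace Code

variable {Ext X E F S : Type} [DecidableEq Ext] [Finite X] {ω : ℕ → Bool}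
  {s s' s'' : Store Ext (CNFSym ⊕ X)} {T T' : ℕ}

/-- For each entry `(g, w)` of the list, emit `g a` for all symbols `a` of the register `k`, and
then `w`. -/
def emitRows (k : Reg) : List ((CNFSym ⊕ X → List (CNFSym ⊕ X)) × List (CNFSym ⊕ X)) →
    Code Ext X Unit
  | [] => ret ()
  | R :: L => (emitMap k R.1).andThen ((emit R.2).andThen (emitRows k L))

theorem runs_emitRows {k : Reg} (h₁ : k ≠ .aux) (h₂ : k ≠ .net) (hs : s.aux = []) (G : ℕ)
    (L : List ((CNFSym ⊕ X → List (CNFSym ⊕ X)) × List (CNFSym ⊕ X)))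
    (hG : ∀ R ∈ L, (∀ a, (R.1 a).length ≤ G) ∧ R.2.length ≤ G) :
    Runs (emitRows k L) ω s ()
      (s.set .net ((L.flatMap fun R => (s.get k).flatMap R.1 ++ R.2).reverse ++ s.get .net))
      (L.length * ((s.get k).length * (G + 12) + G + 8) + 2) := by
  induction L generalizing s with
  | nil => exact (runs_ret _).congr rfl rfl (by simp)
  | cons R L ih =>
    have hR := hG R (by simp)
    refine ((runs_emitMap R.1 h₁ h₂ hs G hR.1).andThen ((runs_emit R.2).andThen
      (ih (by exact hs) fun R hR => hG R (by simp [hR])))).congr rfl ?_ ?_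
    · refine Store.eq_of_get (by simp) (by simp) fun k' => ?_
      simp only [Store.get_set, h₂, if_false]
      split_ifs <;> simp
    · simp only [Store.get_set, h₂, if_false, List.length_cons]
      nlinarith [hR.2]

/-- The rows of a block diagonal layer that belong to the current block. -/
def emitBlock (Z : List (CNFSym ⊕ X)) : List (List (CNFSym ⊕ X) × List (CNFSym ⊕ X)) →
    Code Ext X Unit
  | [] => ret ()
  | R :: L => (emitMap .finished fun _ => Z).andThen <| (emit R.1).andThen <|
      (emitMap .blocks fun _ => Z).andThen <| (emit R.2).andThen <| emitBlock Z L

theorem runs_emitBlock (hs : s.aux = []) (G : ℕ) (Z : List (CNFSym ⊕ X)) (hZ : Z.length ≤ G)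
    (L : List (List (CNFSym ⊕ X) × List (CNFSym ⊕ X)))
    (hG : ∀ R ∈ L, R.1.length ≤ G ∧ R.2.length ≤ G) :
    Runs (emitBlock Z L) ω s ()
      { s with net := (L.flatMap fun R => (List.replicate s.finished.length Z).flatten ++ R.1 ++
          (List.replicate s.blocks.length Z).flatten ++ R.2).reverse ++ s.net }
      (L.length * ((s.finished.length + s.blocks.length) * (G + 12) + 2 * G + 16) + 2) := by
  have hmap : ∀ l : List (CNFSym ⊕ X),
      (l.flatMap fun _ => Z) = (List.replicate l.length Z).flatten := by
    intro l
    rw [List.flatMap_def, List.map_const']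
  induction L generalizing s with
  | nil => exact (runs_ret _).congr rfl rfl (by simp)
  | cons R L ih =>
    have hR := hG R (by simp)
    refine Runs.congr (T := s.finished.length * (G + 12) + 6 + (R.1.length + 2 +
      (s.blocks.length * (G + 12) + 6 + (R.2.length + 2 +
        (L.length * ((s.finished.length + s.blocks.length) * (G + 12) + 2 * G + 16) + 2)))))
      ((runs_emitMap (fun _ => Z) (by decide) (by decide) hs G fun _ => hZ).andThen <|
        (runs_emit R.1).andThen <|
        (runs_emitMap (fun _ => Z) (by decide) (by decide) (by exact hs) G fun _ => hZ).andThen <|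
        (runs_emit R.2).andThen <| ih (by exact hs) fun R hR => hG R (by simp [hR])) rfl ?_ ?_
    · simp [Store.set, Store.get, hmap]
    · simp only [List.length_cons]
      nlinarith [hR.1, hR.2]

/-- Emit the blocks of a block diagonal layer, where `finished` and `blocks` hold one symbol for
each finished and each remaining block. -/
def emitRemainingBlocks (Z : List (CNFSym ⊕ X))
    (L : List (List (CNFSym ⊕ X) × List (CNFSym ⊕ X))) : Code Ext X Unit :=
  loop (S := Unit) (fun _ => (pop .blocks).bind fun o =>
    match o with
    | none => ret (.inr ())
    | some a => (emitBlock Z L).andThen ((push .finished a).andThen (ret (.inl ())))) ()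

theorem runs_emitRemainingBlocks (G : ℕ) (Z : List (CNFSym ⊕ X)) (hZ : Z.length ≤ G)
    (L : List (List (CNFSym ⊕ X) × List (CNFSym ⊕ X)))
    (hG : ∀ R ∈ L, R.1.length ≤ G ∧ R.2.length ≤ G) (l : List (CNFSym ⊕ X)) (hl : s.blocks = l)
    (hs : s.aux = []) :
    Runs (emitRemainingBlocks Z L) ω s ()
      { s with
        blocks := []
        finished := l.reverse ++ s.finished
        net := ((List.range l.length).flatMap fun c => L.flatMap fun R =>
          (List.replicate (s.finished.length + c) Z).flatten ++ R.1 ++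
            (List.replicate (l.length - 1 - c) Z).flatten ++ R.2).reverse ++ s.net }
      (l.length *
        (L.length * ((s.finished.length + l.length) * (G + 12) + 2 * G + 16) + 6) + 3) := by
  induction l generalizing s with
  | nil =>
    have hget : s.get .blocks = [] := hl
    refine Runs.loop_exit (Runs.mono (T := 1 + 2) ((runs_pop _).bind ?_) (by simp))
    rw [hget]
    exact runs_ret _
  | cons a l ih =>
    have hget : s.get .blocks = a :: l := hl
    have hblock := runs_emitBlock (ω := ω) (s := { s with blocks := l }) hs G Z hZ L hG
    have hloop := ih (s := { s with
      blocks := l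
      finished := a :: s.finished
      net := (L.flatMap fun R => (List.replicate s.finished.length Z).flatten ++ R.1 ++
        (List.replicate l.length Z).flatten ++ R.2).reverse ++ s.net }) rfl hs
    refine Runs.congr (Runs.loop_again (T := 1 +
      (L.length * ((s.finished.length + l.length) * (G + 12) + 2 * G + 16) + 2 + (1 + 2)))
      ?_ hloop) rfl ?_ ?_
    · refine (runs_pop _).bind ?_
      rw [hget]
      exact hblock.andThen ((runs_push _ _).andThen (runs_ret _))
    · simp only [List.length_cons, List.range_succ_eq_map, List.flatMap_cons, List.flatMap_map]
      congr 1
      · simp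
      · simp only [List.reverse_append, List.append_assoc, Nat.add_zero, Nat.sub_zero,
          Nat.add_sub_cancel]
        congr 3
        funext c
        have h_left : s.finished.length + 1 + c = s.finished.length + c.succ := by omega
        have h_right : l.length - 1 - c = l.length - c.succ := by omega
        rw [h_left, h_right]
    · have hlen : s.finished.length + 1 + l.length = s.finished.length + (l.length + 1) := by omega
      have hmono : L.length * ((s.finished.length + l.length) * (G + 12) + 2 * G + 16) ≤
          L.length * ((s.finished.length + (l.length + 1)) * (G + 12) + 2 * G + 16) := by
        gcongr
        omega
      simp only [List.length_cons, hlen]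
      nlinarith

/-- A block diagonal layer with as many blocks as there are symbols in `blocks`. -/
def emitBlocks (Z : List (CNFSym ⊕ X)) (L : List (List (CNFSym ⊕ X) × List (CNFSym ⊕ X))) :
    Code Ext X Unit :=
  (emitRemainingBlocks Z L).andThen (move .finished .blocks)

theorem runs_emitBlocks (hs : s.aux = []) (h_finished : s.finished = []) (G : ℕ)
    (Z : List (CNFSym ⊕ X)) (hZ : Z.length ≤ G)
    (L : List (List (CNFSym ⊕ X) × List (CNFSym ⊕ X)))
    (hG : ∀ R ∈ L, R.1.length ≤ G ∧ R.2.length ≤ G) :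
    Runs (emitBlocks Z L) ω s ()
      { s with net := (Net.blockWord s.blocks.length Z L).reverse ++ s.net }
      ((s.blocks.length + 1) *
        (L.length * (s.blocks.length * (G + 12) + 2 * G + 16) + 12)) := by
  refine Runs.congr ((runs_emitRemainingBlocks G Z hZ L hG s.blocks rfl hs).andThen
    (runs_move (by decide) (by decide) (by decide))) rfl ?_ ?_
  · simp [Store.set, Store.get, h_finished, Net.blockWord]
  · simp only [Store.get, h_finished, List.append_nil, List.length_reverse, List.length_nil,
      zero_add]
    generalize L.length * (s.blocks.length * (G + 12) + 2 * G + 16) = A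
    nlinarith

end Code

namespace Code

section Parallel

variable {Ext X : Type} [DecidableEq Ext] [Finite X] {ω : ℕ → Bool} {θr θ : Finset ℝ}
  [Inhabited θ] {s : Store Ext (CNFSym ⊕ X)}

/-- The word that belongs to a block of the given sign. -/
def signWord (em : NetSym θ → CNFSym ⊕ X) {q : ℕ} (w : ℝ) (W : Fin q → θr) :
    CNFSym ⊕ X → List (CNFSym ⊕ X)
  | .inl (.literal s) => List.ofFn fun j => em (.weight (toWeight θ (blockSign s * w * W j)))
  | _ => []

omit [Finite X] in
theorem length_signWord_le (em : NetSym θ → CNFSym ⊕ X) {q : ℕ} (w : ℝ) (W : Fin q → θr)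
    (a : CNFSym ⊕ X) : (signWord em w W a).length ≤ q := by
  unfold signWord
  split <;> simp

/-- Write the network `Net.parallel`, with signs in `blocks`. -/
def parallelCode (em : NetSym θ → CNFSym ⊕ X) {p : ℕ} (W₁ : Matrix (Fin p) (Fin 1) θr)
    (b₁ : Fin p → θr) (tail : Net θr p) : {q : ℕ} → Net θr q → Code Ext X Unit
  | _, .last W _ =>
      (emitRows .blocks (List.ofFn fun i => (signWord em (W₁ i 0) W,
        [em (.weight (toWeight θ (W₁ i 0 + b₁ i))), em .endNeuron]))).andThen
        (emit (em .endLayer :: (encodeNet (tail.lift θ)).map em))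
  | q, .layer W b rest =>
      (emitBlocks ((List.replicate q (NetSym.weight (toWeight θ 0))).map em)
        ((Net.layerRows W b).map fun R => (R.1.map em, R.2.map em))).andThen <|
      (emit [em .endLayer]).andThen (parallelCode em W₁ b₁ tail rest)

theorem map_blockWord {α β : Type} (f : α → β) (B : ℕ) (Z : List α)
    (L : List (List α × List α)) :
    (Net.blockWord B Z L).map f =
      Net.blockWord B (Z.map f) (L.map fun R => (R.1.map f, R.2.map f)) := by
  simp only [Net.blockWord, List.map_flatMap, List.flatMap_map, List.map_append, List.map_flatten,
    List.map_replicate]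

theorem runs_parallelCode_last (em : NetSym θ → CNFSym ⊕ X) {p q m : ℕ}
    (W₁ : Matrix (Fin p) (Fin 1) θr) (b₁ : Fin p → θr) (tail : Net θr p) (W : Fin q → θr) (b : θr)
    {items : List (Bool × Net.Form m)} (hs : s.aux = [])
    (h_blocks : s.blocks = items.map fun f => .inl (.literal f.1)) :
    Runs (parallelCode em W₁ b₁ tail (.last W b)) ω s ()
      { s with net := ((encodeNet (Net.parallel θ (fun c => (items.get c).1) W₁ b₁ tail
        (.last W b))).map em).reverse ++ s.net }
      (p * (items.length * (q + 14) + (q + 10)) + (encodeNet (tail.lift θ)).length + 5) := by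
  have hget : s.get .blocks = items.map fun f => .inl (.literal f.1) := h_blocks
  refine Runs.congr ((runs_emitRows (ω := ω) (s := s) (k := .blocks) (by decide) (by decide) hs
    (q + 2) (List.ofFn fun i => (signWord em (W₁ i 0) W,
      [em (.weight (toWeight θ (W₁ i 0 + b₁ i))), em .endNeuron])) ?_).andThen (runs_emit _))
    rfl ?_ ?_
  · simp only [List.mem_ofFn, forall_exists_index, forall_apply_eq_imp_iff]
    exact fun i => ⟨fun a => (length_signWord_le em _ W a).trans (by omega), by simp⟩
  · rw [Net.encodeNet_parallel_last, hget]
    simp only [Store.set, Store.get]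
    congr 1
    rw [← List.append_assoc, ← List.reverse_append]
    congr 2
    simp only [List.map_append, List.map_flatten, List.map_ofFn, List.map_cons, List.append_assoc,
      List.cons_append, List.nil_append]
    congr 1
    rw [← flatten_ofFn_comp]
    congr 1
    refine congrArg List.ofFn (funext fun i => ?_)
    simp only [Function.comp, List.map_append, List.map_flatMap, List.flatMap_map, List.map_cons,
      List.map_nil, List.map_ofFn, signWord]
    rfl
  · simp only [hget, List.length_ofFn, List.length_map, List.length_cons]
    linarith

theorem runs_parallelCode_layer (em : NetSym θ → CNFSym ⊕ X) {p q q' m : ℕ}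
    (W₁ : Matrix (Fin p) (Fin 1) θr) (b₁ : Fin p → θr) (tail : Net θr p)
    (W : Matrix (Fin q') (Fin q) θr) (b : Fin q' → θr) (rest : Net θr q')
    {items : List (Bool × Net.Form m)} (hs : s.aux = []) (h_finished : s.finished = [])
    (h_blocks : s.blocks = items.map fun f => .inl (.literal f.1)) {T : ℕ}
    (h_rest : ∀ s : Store Ext (CNFSym ⊕ X), s.aux = [] → s.finished = [] →
      (s.blocks = items.map fun f => .inl (.literal f.1)) →
      Runs (parallelCode em W₁ b₁ tail rest) ω s ()
        { s with net := ((encodeNet (Net.parallel θ (fun c => (items.get c).1) W₁ b₁ tail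
          rest)).map em).reverse ++ s.net } T) :
    Runs (parallelCode em W₁ b₁ tail (.layer W b rest)) ω s ()
      { s with net := ((encodeNet (Net.parallel θ (fun c => (items.get c).1) W₁ b₁ tail
        (.layer W b rest))).map em).reverse ++ s.net }
      ((items.length + 1) * (q' * (items.length * (q + 14) + (2 * q + 20)) + 12) + 3 + T) := by
  have h_layer := runs_emitBlocks (ω := ω) hs h_finished (q + 2)
    ((List.replicate q (NetSym.weight (toWeight θ 0))).map em) (by simp)
    ((Net.layerRows W b).map fun R => (R.1.map em, R.2.map em)) (by
      simp only [Net.layerRows, List.map_ofFn, List.mem_ofFn, forall_exists_index,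
        forall_apply_eq_imp_iff]
      intro i
      simp)
  refine Runs.congr (h_layer.andThen ((runs_emit _).andThen (h_rest _ hs h_finished h_blocks)))
    rfl ?_ ?_
  · rw [Net.encodeNet_parallel_layer]
    simp only [Store.set, Store.get, h_blocks, List.length_map, List.map_append, map_blockWord,
      List.reverse_append, List.append_assoc, List.map_cons, List.map_nil]
  · simp only [h_blocks, List.length_map, Net.layerRows, List.length_ofFn, List.length_cons,
      List.length_nil]
    linarith

theorem exists_runs_parallelCode (em : NetSym θ → CNFSym ⊕ X) {p : ℕ}
    (W₁ : Matrix (Fin p) (Fin 1) θr) (b₁ : Fin p → θr) (tail : Net θr p) {q : ℕ} (Φ : Net θr q) :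
    ∃ a : ℕ, ∀ {m : ℕ} (items : List (Bool × Net.Form m)) (ω : ℕ → Bool)
      (s : Store Ext (CNFSym ⊕ X)), s.aux = [] → s.finished = [] →
      s.blocks = items.map (fun f => .inl (.literal f.1)) →
      Runs (parallelCode em W₁ b₁ tail Φ) ω s ()
        { s with net := ((encodeNet (Net.parallel θ (fun c => (items.get c).1) W₁ b₁ tail Φ)).map
          em).reverse ++ s.net } (a * (items.length + 1) ^ 2) := by
  induction Φ with
  | @last q W b =>
    set E := (encodeNet (tail.lift θ)).length
    refine ⟨p * (2 * q + 24) + E + 5, fun items ω s hs _ h_blocks =>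
      (runs_parallelCode_last em W₁ b₁ tail W b hs h_blocks).mono ?_⟩
    have hpos : 0 < (items.length + 1) ^ 2 := by positivity
    have hle : items.length ≤ (items.length + 1) ^ 2 := by nlinarith
    generalize (items.length + 1) ^ 2 = N at *
    calc p * (items.length * (q + 14) + (q + 10)) + E + 5
      _ ≤ p * (N * (q + 14) + N * (q + 10)) + N * E + N * 5 := by
        gcongr <;> exact Nat.le_mul_of_pos_left _ hpos
      _ = (p * (2 * q + 24) + E + 5) * N := by ring
  | @layer q q' W b rest ih =>
    obtain ⟨a, ih⟩ := ih
    refine ⟨q' * (3 * q + 34) + 15 + a, fun items ω s hs h_finished h_blocks =>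
      (runs_parallelCode_layer em W₁ b₁ tail W b rest hs h_finished h_blocks
        (ih items ω)).mono ?_⟩
    have hle : items.length ≤ items.length + 1 := by omega
    have hpos : 0 < items.length + 1 := by omega
    generalize items.length + 1 = N at *
    calc N * (q' * (items.length * (q + 14) + (2 * q + 20)) + 12) + 3 + a * N ^ 2
      _ ≤ N * (q' * (N * (q + 14) + N * (2 * q + 20)) + N * 12) + N ^ 2 * 3 + a * N ^ 2 := by
        gcongr
        · exact Nat.le_mul_of_pos_left _ hpos
        · exact Nat.le_mul_of_pos_left _ hpos
        · exact Nat.le_mul_of_pos_left _ (by positivity)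
      _ = (q' * (3 * q + 34) + 15 + a) * N ^ 2 := by ring

end Parallel

section Forms

variable {Ext Y : Type} [DecidableEq Ext] [Finite Y] {ω : ℕ → Bool} {θr θ : Finset ℝ}
  [Inhabited θ] {k : ℕ}

/-- The symbol for a coefficient. -/
def cell (j : ℤ) : CNFSym ⊕ (Cell k ⊕ Y) := .inr (.inl (Cell.clamp k j))

/-- The coefficient denoted by a symbol. -/
def cellValue : CNFSym ⊕ (Cell k ⊕ Y) → ℤ
  | .inr (.inl c) => c
  | _ => 0

omit [Finite Y] in
theorem cellValue_cell {j : ℤ} (hj : |j| ≤ (k : ℤ)) :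
    cellValue (cell j : CNFSym ⊕ (Cell k ⊕ Y)) = j := Cell.coe_clamp hj

/-- Add a literal to a coefficient. -/
def addLiteral (b : Bool) (a : CNFSym ⊕ (Cell k ⊕ Y)) : CNFSym ⊕ (Cell k ⊕ Y) :=
  cell (cellValue a + if b then 1 else -1)

/-- Count negative literals. -/
def countNeg (q : Cell k) (b : Bool) (_ : CNFSym ⊕ (Cell k ⊕ Y)) : Cell k :=
  if b then q else Cell.clamp k (q + 1)

/-- Write the first layer of a network at the form with coefficients in `row` and constant `q`. -/
def emitForm (em : NetSym θ → CNFSym ⊕ (Cell k ⊕ Y)) {p : ℕ} (W₁ : Matrix (Fin p) (Fin 1) θr)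
    (b₁ : Fin p → θr) (q : Cell k) : Code Ext (Cell k ⊕ Y) Unit :=
  emitRows .row (List.ofFn fun i =>
    (fun a => [em (.weight (toWeight θ (cellValue a * W₁ i 0)))],
      [em (.weight (toWeight θ ((q : ℤ) * W₁ i 0 + b₁ i))), em .endNeuron]))

/-- The coefficients of a form as a word. -/
def formRow {m : ℕ} (f : Net.Form m) : List (CNFSym ⊕ (Cell k ⊕ Y)) :=
  List.ofFn fun v => cell (f.1 v)

variable {s : Store Ext (CNFSym ⊕ (Cell k ⊕ Y))}

theorem runs_emitForm (em : NetSym θ → CNFSym ⊕ (Cell k ⊕ Y)) {p m : ℕ}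
    (W₁ : Matrix (Fin p) (Fin 1) θr) (b₁ : Fin p → θr) {f : Net.Form m}
    (hf : (∀ v, |f.1 v| ≤ (k : ℤ)) ∧ |f.2| ≤ (k : ℤ)) (hs : s.aux = []) (hrow : s.row = formRow f) :
    Runs (emitForm em W₁ b₁ (Cell.clamp k f.2)) ω s ()
      { s with net := ((Net.formWord W₁ b₁ f).map em).reverse ++ s.net }
      (p * (14 * m + 10) + 2) := by
  have hget : s.get .row = formRow f := hrow
  refine (runs_emitRows (ω := ω) (s := s) (k := .row) (by decide) (by decide) hs 2 _ (by
    simp only [List.mem_ofFn, forall_exists_index, forall_apply_eq_imp_iff]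
    intro i
    simp)).congr rfl ?_ ?_
  · rw [hget]
    simp only [Store.set, Store.get]
    congr 3
    rw [← flatten_ofFn_comp, Net.formWord, List.map_flatten, List.map_ofFn]
    congr 1
    refine congrArg List.ofFn (funext fun i => ?_)
    simp only [Function.comp, List.map_append, List.map_cons, List.map_nil, List.map_ofFn,
      Cell.coe_clamp hf.2]
    congr 1
    rw [formRow, ← flatten_ofFn_comp]
    simp only [cellValue_cell (hf.1 _)]
    exact (flatten_ofFn_comp (fun v => em (.weight (toWeight θ (f.1 v * W₁ i 0))))
      fun a => [a]).trans (List.flatMap_singleton' _)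
  · rw [hget]
    simp only [formRow, List.length_ofFn]
    exact le_of_eq (by ring)

omit [Finite Y] in
theorem scanCtl_countNeg (c : Clause) (j : ℤ) (hj : |j| + c.length ≤ (k : ℤ))
    (r : List (CNFSym ⊕ (Cell k ⊕ Y))) :
    scanCtl (cell 0) addLiteral countNeg c (Cell.clamp k j) r = Cell.clamp k (j + c.negs) := by
  induction c generalizing j r with
  | nil => simp [scanCtl, Clause.negs]
  | cons l c ih =>
    simp only [List.length_cons, Nat.cast_add, Nat.cast_one] at hj
    rw [scanCtl, countNeg, Clause.negs_cons]
    split_ifs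
    · rw [ih j (by omega)]
      simp
    · have hj' := abs_add_le j 1
      rw [abs_one] at hj'
      rw [Cell.coe_clamp (by omega), ih (j + 1) (by omega), add_assoc]

omit [Finite Y] in
theorem scanRow_addLiteral {m : ℕ} (c : Clause) (hc : ∀ l ∈ c, l.1 < m) (g : ℕ → ℤ)
    (hg : ∀ v, |g v| + c.length ≤ (k : ℤ)) (r : List (CNFSym ⊕ (Cell k ⊕ Y)))
    (h_length : r.length = m) (hr : ∀ v, v < m → r.getD v (cell 0) = cell (g v)) :
    scanRow (cell 0) addLiteral c r = List.ofFn fun v : Fin m => cell (g v + c.coef v) := by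
  induction c generalizing g r with
  | nil =>
    refine List.ext_getElem (by simp [scanRow, h_length]) fun i hi₁ hi₂ => ?_
    have h_get := hr i (by simpa using hi₂)
    rw [List.getD_eq_getElem _ _ (by simpa [scanRow] using hi₁)] at h_get
    simp only [scanRow, List.foldl_nil, List.getElem_ofFn, Clause.coef, List.map_nil, List.sum_nil,
      add_zero]
    exact h_get
  | cons l c ih =>
    have hl := hc l (by simp)
    simp only [List.length_cons, Nat.cast_add, Nat.cast_one] at hg
    have habs : ∀ v, |g v + if l.1 = v then (if l.2 then 1 else -1) else 0| ≤ |g v| + 1 := by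
      intro v
      refine (abs_add_le _ _).trans ?_
      gcongr
      split_ifs <;> simp
    have h_touch : ∀ v, v < m → (touch (cell 0) (addLiteral l.2) l.1 r).getD v (cell 0) =
        cell (g v + if l.1 = v then (if l.2 then 1 else -1) else 0) := by
      intro v hv
      rw [getD_touch]
      by_cases hlv : l.1 = v
      · subst hlv
        have hgl := hg l.1
        rw [if_pos rfl, if_pos rfl, hr l.1 hl, addLiteral, cellValue_cell (by omega)]
      · rw [if_neg (Ne.symm hlv), if_neg hlv, hr v hv, add_zero]
    simp only [Clause.coef_cons, ← add_assoc]
    exact ih (fun l hl => hc l (by simp [hl]))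
      (fun v => g v + if l.1 = v then (if l.2 then 1 else -1) else 0)
      (fun v => by have := hg v; have := habs v; omega) (touch (cell 0) (addLiteral l.2) l.1 r)
      (by rw [length_touch, h_length]; omega) h_touch

/-- Set all coefficients in `row` to zero. -/
def clearRow : Code Ext (Cell k ⊕ Y) Unit :=
  (transfer .row .aux (fun _ => cell 0) fun _ => []).andThen (move .aux .row)

theorem runs_clearRow (hs : s.aux = []) :
    Runs clearRow ω s () { s with row := List.replicate s.row.length (cell 0) }
      (12 * s.row.length + 6) := by
  refine ((runs_transfer _ _ (by decide) (by decide) (by decide) 0 (by simp)).andThen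
    (runs_move (by decide) (by decide) (by decide))).congr rfl ?_ ?_
  · simp [Store.set, Store.get, hs, List.map_const']
  · simp [Store.set, Store.get, hs]; omega

/-- Write the two blocks of a clause. -/
def emitClause (em : NetSym θ → CNFSym ⊕ (Cell k ⊕ Y)) {p : ℕ} (W₁ : Matrix (Fin p) (Fin 1) θr)
    (b₁ : Fin p → θr) (q : Cell k) : Code Ext (Cell k ⊕ Y) (Cell k) :=
  (emitForm em W₁ b₁ q).andThen <| clearRow.andThen <|
    (emitForm em W₁ b₁ (Cell.clamp k 1)).andThen (ret (Cell.clamp k 0))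

omit [Finite Y] in
theorem formRow_one (m : ℕ) :
    (formRow (Net.Form.one m) : List (CNFSym ⊕ (Cell k ⊕ Y))) = List.replicate m (cell 0) := by
  simp [formRow, Net.Form.one, List.ofFn_const]

theorem runs_emitClause (hk : 1 ≤ k) (em : NetSym θ → CNFSym ⊕ (Cell k ⊕ Y)) {p m : ℕ}
    (W₁ : Matrix (Fin p) (Fin 1) θr) (b₁ : Fin p → θr) {f : Net.Form m}
    (hf : (∀ v, |f.1 v| ≤ (k : ℤ)) ∧ |f.2| ≤ (k : ℤ)) (hs : s.aux = []) (hrow : s.row = formRow f) :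
    Runs (emitClause em W₁ b₁ (Cell.clamp k f.2)) ω s (Cell.clamp k 0)
      { s with
        row := List.replicate m (cell 0)
        net := ((Net.formWord W₁ b₁ f ++ Net.formWord W₁ b₁ (.one m)).map em).reverse ++ s.net }
      ((28 * p + 12) * (m + 1) + 2) := by
  have h_clause := runs_emitForm (ω := ω) em W₁ b₁ hf hs hrow
  have h_clear := runs_clearRow (ω := ω)
    (s := { s with net := ((Net.formWord W₁ b₁ f).map em).reverse ++ s.net }) hs
  have hlen : s.row.length = m := by rw [hrow, formRow, List.length_ofFn]
  simp only [hlen] at h_clear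
  have h_one := runs_emitForm (ω := ω) em W₁ b₁ (Net.Form.abs_one_le hk m)
    (s := { s with
      row := List.replicate m (cell 0)
      net := ((Net.formWord W₁ b₁ f).map em).reverse ++ s.net }) hs (formRow_one m).symm
  refine Runs.congr (h_clause.andThen (h_clear.andThen (h_one.andThen (runs_ret _)))) rfl ?_ ?_
  · simp
  · nlinarith

theorem runs_scan_emitClause (hk : 1 ≤ k) (em : NetSym θ → CNFSym ⊕ (Cell k ⊕ Y)) {p m : ℕ}
    (W₁ : Matrix (Fin p) (Fin 1) θr) (b₁ : Fin p → θr) {α : CNF}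
    (hα : ∀ c ∈ α, c.length ≤ k ∧ ∀ l ∈ c, l.1 < m) (hs : s.aux = [])
    (hrow : s.row = List.replicate m (cell 0)) (h_input : s.input = (encodeCNF α).map .inl) :
    Runs (scan (cell 0) addLiteral countNeg (emitClause em W₁ b₁) (Cell.clamp k 0)) ω s
      (Cell.clamp k 0)
      { s with
        input := []
        saved := ((encodeCNF α).map .inl).reverse ++ s.saved
        net := ((α.flatMap fun c => Net.formWord W₁ b₁ (Clause.form m c) ++
          Net.formWord W₁ b₁ (.one m)).map em).reverse ++ s.net }
      (12 * (encodeCNF α).length + α.length * ((28 * p + 12) * (m + 1) + 2) + 3) := by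
  induction α generalizing s with
  | nil =>
    refine (runs_scan_nil (by simpa [encodeCNF] using h_input)).congr rfl ?_ (by simp)
    cases s
    simpa [encodeCNF] using h_input
  | cons c α ih =>
    have hc := hα c (by simp)
    have hck : (c.length : ℤ) ≤ k := by exact_mod_cast hc.1
    have hctl := scanCtl_countNeg (Y := Y) c 0 (by simpa using hck) s.row
    rw [zero_add] at hctl
    have h_scanned : scanRow (cell 0) addLiteral c s.row =
        (formRow (Clause.form m c) : List (CNFSym ⊕ (Cell k ⊕ Y))) := by
      rw [scanRow_addLiteral c hc.2 (fun _ => 0) (by simpa using hck) s.row (by simp [hrow])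
        fun v hv => by simp [hrow, hv]]
      simp [formRow, Clause.form]
    set s₁ : Store Ext (CNFSym ⊕ (Cell k ⊕ Y)) := { s with
      input := (encodeCNF α).map .inl
      saved := ((c.flatMap encodeLiteral ++ [CNFSym.endClause]).map .inl).reverse ++ s.saved
      row := scanRow (cell 0) addLiteral c s.row } with hs₁
    have h_clause := runs_emitClause (ω := ω) (s := s₁) hk em W₁ b₁ (f := Clause.form m c)
      ⟨fun v => (Clause.abs_coef_le c v).trans hck, (Clause.abs_negs_le c).trans hck⟩ hs h_scanned
    rw [show (Clause.form m c).2 = c.negs from rfl, ← hctl] at h_clause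
    have h_clauses := ih (s := { s₁ with
      row := List.replicate m (cell 0)
      net := ((Net.formWord W₁ b₁ (Clause.form m c) ++ Net.formWord W₁ b₁ (.one m)).map
        em).reverse ++ s₁.net }) (fun c hc => hα c (by simp [hc])) hs rfl rfl
    refine Runs.congr (runs_scan_clause (c := c) (w := (encodeCNF α).map .inl)
      (by simpa [encodeCNF] using h_input) hs h_clause h_clauses) rfl ?_ ?_
    · simp [encodeCNF, hrow, hs₁]
    · simp only [encodeCNF, List.flatMap_cons, List.length_append, List.length_cons]
      ring_nf
      omega

end Forms

end Code

/-- Least `u₀` such that `r ≤ 4 * u₀` and `u ≤ C * (4 * u₀)`. -/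
def unitCount (C r u : ℕ) : ℕ := max (r ⌈/⌉ 4) (u ⌈/⌉ (4 * C))

theorem unitCount_le_iff {C : ℕ} (hC : 1 ≤ C) {r u n : ℕ} :
    unitCount C r u ≤ n ↔ r ≤ 4 * n ∧ u ≤ C * (4 * n) := by
  rw [unitCount, max_le_iff, ceilDiv_le_iff_le_mul (by norm_num),
    ceilDiv_le_iff_le_mul (by omega), mul_comm 4 C, mul_assoc]

theorem unitCount_sub {C : ℕ} (hC : 1 ≤ C) (r u : ℕ) :
    unitCount C (r - 4) (u - 4 * C) = unitCount C r u - 1 :=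
  eq_of_forall_ge_iff fun n => by
    rw [Nat.sub_le_iff_le_add, unitCount_le_iff hC, unitCount_le_iff hC, Nat.sub_le_iff_le_add,
      Nat.sub_le_iff_le_add, mul_add, mul_add, mul_comm 4 C]

theorem unitCount_eq_zero {C : ℕ} (hC : 1 ≤ C) {r u : ℕ} :
    unitCount C r u = 0 ↔ r = 0 ∧ u = 0 := by
  rw [← Nat.le_zero, unitCount_le_iff hC]
  simp

/-- The number of variables: one more than the largest index of a variable that occurs. -/
def CNF.numVars (α : CNF) : ℕ := (α.flatten.map fun l => l.1 + 1).foldr max 0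

theorem CNF.numVars_le_iff {α : CNF} {n : ℕ} :
    α.numVars ≤ n ↔ ∀ c ∈ α, ∀ l ∈ c, l.1 < n := by
  have h_flat : ∀ L : Clause,
      (L.map fun l => l.1 + 1).foldr max 0 ≤ n ↔ ∀ l ∈ L, l.1 < n := by
    intro L
    induction L with
    | nil => simp
    | cons l L ih => simp [ih]
  rw [CNF.numVars, h_flat]
  simp only [List.mem_flatten]
  exact ⟨fun h c hc l hl => h l ⟨c, hc, hl⟩, fun h l ⟨c, hc, hl⟩ => h c hc l hl⟩

/-- The network that is written for `α` has `4 * quarterInputs C α` inputs; this is enough for the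
variables of `α` and makes room for all clauses within the width allowed. -/
def CNF.quarterInputs (C : ℕ) (α : CNF) : ℕ := unitCount C α.numVars α.length + 1

namespace CNF

variable {C : ℕ} {α : CNF}

theorem lt_quarterInputs (hC : 1 ≤ C) (α : CNF) :
    ∀ c ∈ α, ∀ l ∈ c, l.1 < 2 * (2 * quarterInputs C α) := by
  have h := ((unitCount_le_iff hC).1 (le_refl (unitCount C α.numVars α.length))).1
  exact numVars_le_iff.1 (by simp only [quarterInputs]; omega)

theorem length_lt_quarterInputs (hC : 1 ≤ C) (α : CNF) :
    α.length + 1 ≤ C * (2 * (2 * quarterInputs C α)) := by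
  have h := ((unitCount_le_iff hC).1 (le_refl (unitCount C α.numVars α.length))).2
  simp only [quarterInputs]
  linarith

theorem quarterInputs_le (hC : 1 ≤ C) {n : ℕ} (hα : ∀ c ∈ α, ∀ l ∈ c, l.1 < n)
    (h_length : α.length ≤ C * n) : 2 * (2 * quarterInputs C α) ≤ n + 7 := by
  have h : unitCount C α.numVars α.length ≤ (n + 3) / 4 := by
    have hn : n ≤ 4 * ((n + 3) / 4) := by omega
    exact (unitCount_le_iff hC).2
      ⟨(numVars_le_iff.2 hα).trans hn, h_length.trans (Nat.mul_le_mul_left C hn)⟩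
  simp only [quarterInputs]
  omega

end CNF

namespace Code

section Count

variable {Ext X : Type} [DecidableEq Ext] [Finite X] {ω : ℕ → Bool} {s : Store Ext (CNFSym ⊕ X)}

/-- Pop up to `n` symbols; tell whether there were any. -/
def popMany (k : Reg) : ℕ → Code Ext X Bool
  | 0 => ret false
  | n + 1 => (pop k).bind fun o => (popMany k n).bind fun b => ret (o.isSome || b)

theorem runs_popMany (k : Reg) (n : ℕ) :
    Runs (popMany k n) ω s (decide (n ≠ 0 ∧ s.get k ≠ [])) (s.set k ((s.get k).drop n))
      (3 * n + 2) := by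
  induction n generalizing s with
  | zero =>
    refine (runs_ret _).congr (by simp) (Store.eq_of_get (by simp) (by simp) fun k' => ?_) le_rfl
    rw [Store.get_set]
    split_ifs with h <;> simp [h]
  | succ n ih =>
    refine Runs.mono (T := 1 + (3 * n + 2 + 2)) ?_ (by omega)
    refine (runs_pop k).bind (ih.bind ((runs_ret _).congr ?_ ?_ le_rfl))
    · rw [Store.get_set, if_pos rfl]
      cases s.get k <;> simp
    · refine Store.eq_of_get (by simp) (by simp) fun k' => ?_
      simp only [Store.get_set]
      split_ifs <;> simp

/-- Count one more unit, in unary on `precision` and with four symbols on `finished`. -/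
def bump (a₀ : CNFSym ⊕ X) : Code Ext X Unit :=
  (push .precision (.inl .tick)).andThen <| (push .finished a₀).andThen <|
    (push .finished a₀).andThen <| (push .finished a₀).andThen (push .finished a₀)

omit [Finite X] in
theorem runs_bump (a₀ : CNFSym ⊕ X) :
    Runs (bump a₀) ω s () { s with
      precision := .inl .tick :: s.precision
      finished := List.replicate 4 a₀ ++ s.finished } 5 :=
  (runs_push _ _).andThen <| (runs_push _ _).andThen <| (runs_push _ _).andThen <|
    (runs_push _ _).andThen (runs_push _ _)

/-- Remove four symbols from `row` and `4 * C` symbols from `units`, and count a unit if there were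
any. -/
def countUnit (C : ℕ) (a₀ : CNFSym ⊕ X) : Code Ext X (Unit ⊕ Unit) :=
  (popMany .row 4).bind fun b => (popMany .units (4 * C)).bind fun b' =>
    if b || b' then (bump a₀).andThen (ret (.inl ())) else ret (.inr ())

theorem runs_countUnit_nil {C : ℕ} (a₀ : CNFSym ⊕ X) (h_row : s.row = []) (h_units : s.units = []) :
    Runs (countUnit C a₀) ω s (.inr ()) { s with row := [], units := [] } (12 * C + 25) := by
  have h_get_row : s.get .row = [] := h_row
  have h_get_units : (s.set .row []).get .units = [] := h_units
  refine Runs.mono (T := 14 + (3 * (4 * C) + 2 + 2))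
    ((runs_popMany .row 4).bind ((runs_popMany .units (4 * C)).bind ?_)) (by omega)
  simp only [h_get_row, List.drop_nil, h_get_units, ne_eq, not_true_eq_false, and_false,
    decide_false, Bool.or_false, Bool.false_eq_true, if_false]
  exact (runs_ret _).congr rfl (by simp [Store.set]) le_rfl

theorem runs_countUnit_step {C : ℕ} (hC : 1 ≤ C) (a₀ : CNFSym ⊕ X)
    (h_ne : ¬ (s.row = [] ∧ s.units = [])) :
    Runs (countUnit C a₀) ω s (.inl ()) { s with
      row := s.row.drop 4
      units := s.units.drop (4 * C)
      precision := .inl .tick :: s.precision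
      finished := List.replicate 4 a₀ ++ s.finished } (12 * C + 25) := by
  refine Runs.mono (T := 14 + (3 * (4 * C) + 2 + (5 + 2)))
    ((runs_popMany .row 4).bind ((runs_popMany .units (4 * C)).bind ?_)) (by omega)
  have h_any : (decide (4 ≠ 0 ∧ s.get .row ≠ []) ||
      decide (4 * C ≠ 0 ∧ (s.set .row ((s.get .row).drop 4)).get .units ≠ [])) = true := by
    rw [Bool.or_eq_true, decide_eq_true_eq, decide_eq_true_eq]
    by_cases h_row : s.row = []
    · exact .inr ⟨by omega, fun h_units => h_ne ⟨h_row, h_units⟩⟩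
    · exact .inl ⟨by norm_num, h_row⟩
  rw [if_pos h_any]
  exact (runs_bump a₀).andThen (runs_ret _)

/-- Count units of four symbols of `row` and `4 * C` symbols of `units`. -/
def countUnits (C : ℕ) (a₀ : CNFSym ⊕ X) : Code Ext X Unit :=
  loop (S := Unit) (fun _ => countUnit C a₀) ()

theorem runs_countUnits {C : ℕ} (hC : 1 ≤ C) (a₀ : CNFSym ⊕ X) {h : ℕ}
    (hh : unitCount C s.row.length s.units.length = h) :
    Runs (countUnits C a₀) ω s () { s with
      row := []
      units := []
      precision := List.replicate h (.inl .tick) ++ s.precision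
      finished := List.replicate (4 * h) a₀ ++ s.finished } ((h + 1) * (12 * C + 26)) := by
  induction h generalizing s with
  | zero =>
    simp only [unitCount_eq_zero hC, List.length_eq_zero_iff] at hh
    exact (Runs.loop_exit (runs_countUnit_nil a₀ hh.1 hh.2)).congr rfl (by simp) (by omega)
  | succ h ih =>
    have h_ne : ¬ (s.row = [] ∧ s.units = []) := by
      rintro ⟨h_row, h_units⟩
      simp [h_row, h_units, (unitCount_eq_zero hC).2] at hh
    refine (Runs.loop_again (runs_countUnit_step hC a₀ h_ne) (ih ?_)).congr rfl ?_ (by linarith)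
    · simp only [List.length_drop, unitCount_sub hC, hh, Nat.add_sub_cancel]
    · simp only [← List.append_assoc, List.replicate_append_replicate,
        List.replicate_succ' (n := h), Nat.mul_add, Nat.mul_one]
      simp

/-- Note that there is one more clause, with one block for it and one for the constant form. -/
def countClause : Code Ext X Unit :=
  (push .units (.inl .tick)).andThen <| (push .blocks (.inl (.literal false))).andThen <|
    push .blocks (.inl (.literal true))

omit [Finite X] in
theorem runs_countClause : Runs countClause ω s () { s with
    units := .inl .tick :: s.units
    blocks := .inl (.literal true) :: .inl (.literal false) :: s.blocks } 3 :=
  (runs_push _ _).andThen ((runs_push _ _).andThen (runs_push _ _))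

/-- Scan the formula to find out the number of its variables and of its clauses. -/
def countClauses (a₀ : CNFSym ⊕ X) : Code Ext X Unit :=
  scan a₀ (fun _ _ => a₀) (fun _ _ _ => ()) (fun _ => countClause) ()

/-- Signs of blocks that come in pairs. -/
def pairSigns (n : ℕ) : List (CNFSym ⊕ X) :=
  (List.replicate n [.inl (.literal true), .inl (.literal false)]).flatten

omit [Finite X] in
theorem length_scanRow_le_iff (a₀ : CNFSym ⊕ X) (act : Bool → CNFSym ⊕ X → CNFSym ⊕ X)
    (c : Clause) {r : List (CNFSym ⊕ X)} {n : ℕ} :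
    (scanRow a₀ act c r).length ≤ n ↔ r.length ≤ n ∧ ∀ l ∈ c, l.1 < n := by
  induction c generalizing r with
  | nil => simp [scanRow]
  | cons l c ih =>
    have h_cons : scanRow a₀ act (l :: c) r = scanRow a₀ act c (touch a₀ (act l.2) l.1 r) := rfl
    rw [h_cons, ih, length_touch, max_le_iff, List.forall_mem_cons, Nat.succ_le_iff, and_assoc]

omit [Finite X] in
theorem length_scanRow_flatten (a₀ : CNFSym ⊕ X) (act : Bool → CNFSym ⊕ X → CNFSym ⊕ X) (α : CNF) :
    (scanRow a₀ act α.flatten []).length = α.numVars :=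
  eq_of_forall_ge_iff fun n => by
    simp only [length_scanRow_le_iff, CNF.numVars_le_iff, List.length_nil, Nat.zero_le, true_and,
      List.mem_flatten]
    exact ⟨fun h c hc l hl => h l ⟨c, hc, hl⟩, fun h l ⟨c, hc, hl⟩ => h c hc l hl⟩

theorem runs_countClauses (a₀ : CNFSym ⊕ X) {α : CNF} (h_input : s.input = (encodeCNF α).map .inl)
    (hs : s.aux = []) :
    Runs (countClauses a₀) ω s () { s with
      input := []
      saved := ((encodeCNF α).map .inl).reverse ++ s.saved
      row := scanRow a₀ (fun _ _ => a₀) α.flatten s.row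
      units := List.replicate α.length (.inl .tick) ++ s.units
      blocks := pairSigns α.length ++ s.blocks }
      (12 * (encodeCNF α).length + 3 * α.length + 3) := by
  induction α generalizing s with
  | nil =>
    refine (runs_scan_nil (by simpa [encodeCNF] using h_input)).congr rfl ?_ (by simp)
    cases s
    simpa [encodeCNF, pairSigns, scanRow] using h_input
  | cons c α ih =>
    set s₁ : Store Ext (CNFSym ⊕ X) := { s with
      input := (encodeCNF α).map .inl
      saved := ((c.flatMap encodeLiteral ++ [CNFSym.endClause]).map .inl).reverse ++ s.saved
      row := scanRow a₀ (fun _ _ => a₀) c s.row } with hs₁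
    have h_clauses := ih (s := { s₁ with
      units := .inl .tick :: s.units
      blocks := .inl (.literal true) :: .inl (.literal false) :: s.blocks }) rfl hs
    refine Runs.congr (runs_scan_clause (c := c) (w := (encodeCNF α).map .inl) (Tc := 3)
      (by simpa [encodeCNF] using h_input) hs (runs_countClause (s := s₁)) h_clauses) rfl ?_ ?_
    · simp [encodeCNF, hs₁, pairSigns, scanRow, List.replicate_succ', List.append_assoc]
    · simp only [encodeCNF, List.flatMap_cons, List.length_append, List.length_cons]
      omega

/-- Prepare the network of the formula: after this, `precision` holds `CNF.quarterInputs` in unary,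
`row` one symbol `a₀` for each input and `blocks` the signs of all blocks. -/
def measureFormula (C : ℕ) (a₀ : CNFSym ⊕ X) : Code Ext X Unit :=
  (push .blocks (.inl (.literal false))).andThen <| (push .blocks (.inl (.literal true))).andThen <|
  (countClauses a₀).andThen <| (move .saved .input).andThen <|
  (countUnits C a₀).andThen <| (bump a₀).andThen (move .finished .row)

/-- The registers after `measureFormula`. -/
def measuredStore (Ext : Type) {X : Type} (C : ℕ) (a₀ : CNFSym ⊕ X) (α : CNF) :
    Store Ext (CNFSym ⊕ X) :=
  { initStore Ext (encodeCNF α) with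
    row := List.replicate (2 * (2 * α.quarterInputs C)) a₀
    blocks := pairSigns (α.length + 1)
    precision := List.replicate (α.quarterInputs C) (.inl .tick) }

theorem runs_measureFormula {C : ℕ} (hC : 1 ≤ C) (a₀ : CNFSym ⊕ X) (α : CNF) :
    Runs (measureFormula C a₀) ω (initStore Ext (encodeCNF α)) () (measuredStore Ext C a₀ α)
      (18 * (encodeCNF α).length + 3 * α.length + α.quarterInputs C * (12 * C + 50) + 16) := by
  set s₁ : Store Ext (CNFSym ⊕ X) := { initStore Ext (encodeCNF α) with blocks := pairSigns 1 }
  set s₂ : Store Ext (CNFSym ⊕ X) := { s₁ with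
    row := scanRow a₀ (fun _ _ => a₀) α.flatten []
    units := List.replicate α.length (.inl .tick)
    blocks := pairSigns (α.length + 1) } with hs₂
  set h := unitCount C α.numVars α.length with hh
  have h_clauses : Runs (countClauses a₀) ω s₁ () { s₂ with
      input := []
      saved := ((encodeCNF α).map .inl).reverse }
      (12 * (encodeCNF α).length + 3 * α.length + 3) :=
    (runs_countClauses (s := s₁) a₀ (α := α) rfl rfl).congr rfl
      (by simp [hs₂, s₁, initStore, pairSigns, List.replicate_succ']) le_rfl
  have h_restore : Runs (move .saved .input) ω { s₂ with
      input := []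
      saved := ((encodeCNF α).map .inl).reverse } () s₂ (6 * (encodeCNF α).length + 3) := by
    refine (runs_move (by decide) (by decide) (by decide)).congr rfl ?_ ?_
    · simp [Store.set, Store.get, s₂, s₁, initStore]
    · simp [Store.get, mul_comm]
  have h_units := runs_countUnits (ω := ω) (s := s₂) hC a₀ (h := h)
    (by simp only [hs₂, length_scanRow_flatten, List.length_replicate, hh])
  refine Runs.congr ((runs_push _ _).andThen <| (runs_push _ _).andThen <| h_clauses.andThen <|
    h_restore.andThen <| h_units.andThen <| (runs_bump a₀).andThen <|
    runs_move (by decide) (by decide) (by decide)) rfl ?_ ?_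
  · simp only [measuredStore, CNF.quarterInputs, ← hh, Store.set, Store.get, s₂, s₁, initStore,
      List.append_nil, List.replicate_append_replicate, List.reverse_replicate,
      ← List.replicate_succ]
    congr 2
    ring
  · simp only [Store.get, s₂, s₁, initStore, CNF.quarterInputs, ← hh, List.append_nil,
      List.length_append, List.length_replicate]
    linarith

end Count

section Write

variable {Ext Y : Type} [DecidableEq Ext] [Finite Y] {θr θ : Finset ℝ} [Inhabited θ] {k : ℕ}

/-- Write the first layer of the network of a formula. -/
def emitItems (em : NetSym θ → CNFSym ⊕ (Cell k ⊕ Y)) {p : ℕ} (W₁ : Matrix (Fin p) (Fin 1) θr)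
    (b₁ : Fin p → θr) : Code Ext (Cell k ⊕ Y) (Cell k) :=
  (emitForm em W₁ b₁ (Cell.clamp k 1)).andThen <| (emitForm em W₁ b₁ (Cell.clamp k 1)).andThen <|
    scan (cell 0) addLiteral countNeg (emitClause em W₁ b₁) (Cell.clamp k 0)

theorem runs_emitItems (hk : 1 ≤ k) (em : NetSym θ → CNFSym ⊕ (Cell k ⊕ Y)) {p m : ℕ}
    (W₁ : Matrix (Fin p) (Fin 1) θr) (b₁ : Fin p → θr) {α : CNF}
    (hα : ∀ c ∈ α, c.length ≤ k ∧ ∀ l ∈ c, l.1 < m) {ω : ℕ → Bool}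
    {s : Store Ext (CNFSym ⊕ (Cell k ⊕ Y))} (hs : s.aux = [])
    (hrow : s.row = List.replicate m (cell 0)) (h_input : s.input = (encodeCNF α).map .inl) :
    Runs (emitItems em W₁ b₁) ω s (Cell.clamp k 0)
      { s with
        input := []
        saved := ((encodeCNF α).map .inl).reverse ++ s.saved
        net := (((CNF.items m α).flatMap fun f => Net.formWord W₁ b₁ f.2).map em).reverse ++ s.net }
      (12 * (encodeCNF α).length + (α.length + 1) * ((28 * p + 12) * (m + 1) + 2) + 5) := by
  have h_one := runs_emitForm (ω := ω) em W₁ b₁ (Net.Form.abs_one_le hk m) (s := s) hs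
    (hrow.trans (formRow_one m).symm)
  have h_one' := runs_emitForm (ω := ω) em W₁ b₁ (Net.Form.abs_one_le hk m)
    (s := { s with net := ((Net.formWord W₁ b₁ (.one m)).map em).reverse ++ s.net }) hs
    (hrow.trans (formRow_one m).symm)
  have h_scan := runs_scan_emitClause (ω := ω) hk em W₁ b₁ hα (s := { s with
    net := ((Net.formWord W₁ b₁ (.one m)).map em).reverse ++
      (((Net.formWord W₁ b₁ (.one m)).map em).reverse ++ s.net) }) hs hrow h_input
  refine Runs.congr (h_one.andThen (h_one'.andThen h_scan)) rfl ?_ ?_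
  · simp [CNF.items, List.flatMap_assoc]
  · nlinarith

/-- Write the network of a formula. -/
def writeNet (C : ℕ) (em : NetSym θ → CNFSym ⊕ (Cell k ⊕ Y)) {p : ℕ}
    (W₁ : Matrix (Fin p) (Fin 1) θr) (b₁ : Fin p → θr) (rest : Net θr p) :
    Code Ext (Cell k ⊕ Y) Unit :=
  (measureFormula C (cell 0)).andThen <| (emitItems em W₁ b₁).bind fun _ =>
    (emit [em .endLayer]).andThen (parallelCode em W₁ b₁ rest rest)

omit [Finite Y] in
theorem pairSigns_eq_items (m : ℕ) (α : CNF) :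
    (pairSigns (α.length + 1) : List (CNFSym ⊕ (Cell k ⊕ Y))) =
      (CNF.items m α).map fun f => .inl (.literal f.1) := by
  have h_clauses : (pairSigns α.length : List (CNFSym ⊕ (Cell k ⊕ Y))) =
      (α.flatMap fun c => [(true, Clause.form m c), (false, Net.Form.one m)]).map
        fun f => .inl (.literal f.1) := by
    induction α with
    | nil => simp [pairSigns]
    | cons c α ih =>
      simp only [pairSigns] at ih
      simp [pairSigns, List.replicate_succ, ih]
  simp only [pairSigns] at h_clauses
  simp [pairSigns, CNF.items, List.replicate_succ, h_clauses]

theorem writeNet_time_le (a p C e l h : ℕ) :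
    18 * e + 3 * l + h * (12 * C + 50) + 16 +
      (12 * e + (l + 1) * ((28 * p + 12) * (2 * (2 * h) + 1) + 2) + 5 +
        (3 + a * (2 * (l + 1) + 1) ^ 2)) ≤
      (9 * a + 140 * p + 12 * C + 200) * (e + l + h + 1) ^ 2 := by
  set N := e + l + h + 1 with hN
  have hN_sq : N ≤ N ^ 2 := Nat.le_self_pow (by norm_num) _
  have hp : (l + 1) * ((28 * p + 12) * (2 * (2 * h) + 1) + 2) ≤
      N * ((28 * p + 12) * (5 * N) + 2 * N) := by gcongr <;> omega
  have ha : a * (2 * (l + 1) + 1) ^ 2 ≤ a * (3 * N) ^ 2 := by gcongr; omega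
  have hc : h * (12 * C + 50) ≤ N ^ 2 * (12 * C + 50) := by gcongr; omega
  nlinarith

theorem exists_runs_writeNet (hk : 1 ≤ k) {C : ℕ} (hC : 1 ≤ C)
    (em : NetSym θ → CNFSym ⊕ (Cell k ⊕ Y)) {p : ℕ} (W₁ : Matrix (Fin p) (Fin 1) θr)
    (b₁ : Fin p → θr) (rest : Net θr p) :
    ∃ a : ℕ, ∀ α : CNF, (∀ c ∈ α, c.length ≤ k) → ∀ ω,
      ∃ s' : Store Ext (CNFSym ⊕ (Cell k ⊕ Y)),
        Runs (writeNet C em W₁ b₁ rest) ω (initStore Ext (encodeCNF α)) () s'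
          (a * ((encodeCNF α).length + α.length + α.quarterInputs C + 1) ^ 2) ∧
        s'.ext = (fun _ => []) ∧ s'.answer = [] ∧ s'.coins = 0 ∧
        s'.precision = List.replicate (α.quarterInputs C) (.inl .tick) ∧
        s'.net = ((encodeNet (CNF.net θ (2 * (2 * α.quarterInputs C)) α W₁ b₁ rest)).map
          em).reverse := by
  obtain ⟨a, h_parallel⟩ := exists_runs_parallelCode (Ext := Ext) em W₁ b₁ rest rest
  refine ⟨9 * a + 140 * p + 12 * C + 200, fun α hα ω => ?_⟩
  have h_measure := runs_measureFormula (Ext := Ext) (ω := ω) hC (cell 0 : CNFSym ⊕ (Cell k ⊕ Y)) α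
  have h_items := runs_emitItems (ω := ω) hk em W₁ b₁ (s := measuredStore Ext C (cell 0) α)
    (fun c hc => ⟨hα c hc, CNF.lt_quarterInputs hC α c hc⟩) rfl rfl rfl
  refine ⟨_, Runs.mono (h_measure.andThen <| h_items.bind <| (runs_emit [em .endLayer]).andThen <|
    h_parallel (CNF.items (2 * (2 * α.quarterInputs C)) α) ω _ (by rfl) (by rfl)
      (pairSigns_eq_items _ α)) ?_, rfl, rfl, rfl, rfl, ?_⟩
  · rw [CNF.length_items]
    exact writeNet_time_le ..
  · rw [CNF.net, Net.encodeNet_ofForms]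
    simp [Store.set, Store.get, measuredStore, initStore]

end Write

end Code

/-! ### Stacks grow by at most one symbol per step -/

theorem Instr.length_exec_le {K Γ Λ : Type} [DecidableEq K] {ω : ℕ → Bool} {i : Instr K Γ Λ}
    {m m' : Memory K Γ} {l : Λ} (h : i.exec ω m = some (l, m')) (k : K) :
    (m'.stk k).length ≤ (m.stk k).length + 1 := by
  cases i <;> simp only [exec, Option.some.injEq, Prod.mk.injEq, reduceCtorEq] at h
  all_goals
    obtain ⟨-, rfl⟩ := h
    simp only [Function.update_apply]
    try split_ifs with hk
    all_goals simp_all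
  omega

theorem Routine.Path.length_le {K Γ E : Type} [DecidableEq K] {p : Routine K Γ E} {ω : ℕ → Bool}
    {l m e m' t} (h : p.Path ω l m e m' t) (k : K) :
    (m'.stk k).length ≤ (m.stk k).length + t := by
  induction h with
  | exit h => exact Instr.length_exec_le h k
  | next h _ ih =>
    have := Instr.length_exec_le h k
    omega

theorem Code.Runs.length_net_le {Ext X E : Type} [DecidableEq Ext] {p : Code Ext X E}
    {ω : ℕ → Bool} {s s' : Store Ext (CNFSym ⊕ X)} {e : E} {T : ℕ} (h : Code.Runs p ω s e s' T) :
    s'.net.length ≤ s.net.length + T := by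
  obtain ⟨t, ht, h⟩ := h
  have : s'.net.length ≤ s.net.length + t := h.length_le (.inr .net)
  omega

/-! ### Calling a machine -/

namespace Code

section Call

variable {ι ο X : Type} (A : ProbMachine ι ο) (emb : A.Γ → CNFSym ⊕ X)
  (rd : CNFSym ⊕ X → Option A.Γ) {ω : ℕ → Bool}

/-- The instructions of `A`, on its own stacks. -/
def liftInstr {E : Type} : Instr A.K A.Γ A.Λ → Instr (A.K ⊕ Reg) (CNFSym ⊕ X) ((A.Λ ⊕ Unit) ⊕ E)
  | .push k a n => .push (.inl k) (emb a) (.inl (.inl n))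
  | .pop k g => .pop (.inl k) fun o => .inl (.inl (g (o.bind rd)))
  | .flip g => .flip fun b => .inl (.inl (g b))
  | .halt => .push default default (.inl (.inr ()))

/-- Run `A` on its own stacks. -/
def call : Code A.K X Unit where
  Λ := A.Λ ⊕ Unit
  start := .inl A.start
  prog
    | .inl l => liftInstr A emb rd (A.prog l)
    | .inr _ => .pop default fun _ => .inr ()

/-- The stacks and the coins of `A` within a store. -/
def withCfg (s : Store A.K (CNFSym ⊕ X)) (c : A.Cfg) : Store A.K (CNFSym ⊕ X) :=
  { s with
    ext := fun k => (c.stk k).map emb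
    coins := c.coins }

theorem withCfg_update (s : Store A.K (CNFSym ⊕ X)) (c : A.Cfg) (l : A.Λ) (k : A.K)
    (w : List A.Γ) :
    (withCfg A emb s ⟨l, Function.update c.stk k w, c.coins⟩).toMemory =
      ⟨Function.update (withCfg A emb s c).toMemory.stk (.inl k) (w.map emb),
        (withCfg A emb s c).toMemory.coins⟩ := by
  rw [← Store.toMemory_setExt]
  congr 1
  simp only [withCfg]
  congr 1
  funext k'
  by_cases h : k' = k
  · subst h
    simp
  · simp [h]

theorem exec_call (hrd : ∀ a, rd (emb a) = some a) (s : Store A.K (CNFSym ⊕ X)) {c : A.Cfg}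
    (hc : ¬ A.Halted c) :
    ((call A emb rd).prog (.inl c.state)).exec ω (withCfg A emb s c).toMemory =
      some (.inl (.inl (A.step ω c).state), (withCfg A emb s (A.step ω c)).toMemory) := by
  simp only [call]
  unfold ProbMachine.step
  cases hp : A.prog c.state with
  | push k a n =>
    dsimp only
    rw [withCfg_update]
    rfl
  | pop k g =>
    dsimp only
    rw [withCfg_update]
    have hk : (withCfg A emb s c).toMemory.stk (.inl k) = (c.stk k).map emb := rfl
    simp only [liftInstr, Instr.exec, Option.some.injEq, Prod.mk.injEq, Sum.inl.injEq, hk]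
    refine ⟨?_, by rw [List.map_tail]⟩
    cases c.stk k <;> simp [hrd]
  | flip g => rfl
  | halt => exact absurd hp hc

theorem path_call_of_halted (s : Store A.K (CNFSym ⊕ X)) {c : A.Cfg} (hc : A.Halted c) :
    (call A emb rd).Path ω (.inl c.state) (withCfg A emb s c).toMemory ()
      (withCfg A emb s c).toMemory 2 := by
  have hp : A.prog c.state = .halt := hc
  refine .next (l' := (Sum.inr () : A.Λ ⊕ Unit))
    (m' := ⟨Function.update (withCfg A emb s c).toMemory.stk default
      (default :: (withCfg A emb s c).toMemory.stk default), (withCfg A emb s c).toMemory.coins⟩)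
    ?_ (.exit ?_)
  · simp only [call, hp, liftInstr, Instr.exec]
  · simp [call, Instr.exec]

theorem path_call (hrd : ∀ a, rd (emb a) = some a) (s : Store A.K (CNFSym ⊕ X)) (t : ℕ)
    (c : A.Cfg) (h : A.Halted ((A.step ω)^[t] c)) :
    ∃ t' ≤ t + 2, (call A emb rd).Path ω (.inl c.state) (withCfg A emb s c).toMemory ()
      (withCfg A emb s ((A.step ω)^[t] c)).toMemory t' := by
  induction t generalizing c with
  | zero => exact ⟨2, le_rfl, path_call_of_halted A emb rd s h⟩
  | succ t ih =>
    by_cases hc : A.Halted c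
    · rw [Function.iterate_fixed (ProbMachine.step_of_halted hc)]
      exact ⟨2, by omega, path_call_of_halted A emb rd s hc⟩
    · rw [Function.iterate_succ_apply] at h ⊢
      obtain ⟨t', ht', h_path⟩ := ih _ h
      exact ⟨t' + 1, by omega, .next (exec_call A emb rd hrd s hc) h_path⟩

theorem runs_call (hrd : ∀ a, rd (emb a) = some a) (s : Store A.K (CNFSym ⊕ X)) {t : ℕ}
    {x : List ι} (h : A.Halted (A.run x ω t)) :
    Runs (call A emb rd) ω (withCfg A emb s (A.init x)) () (withCfg A emb s (A.run x ω t))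
      (t + 2) :=
  path_call A emb rd hrd s t (A.init x) h

/-- Move the contents of `net` to the input stack of `A`. -/
def load [Finite X] : Code A.K X Unit :=
  loop (S := Unit) (fun _ => (pop .net).bind fun o => match o with
    | some a => andThen (Routine.push (.inl A.inStack) a) (ret (.inl ()))
    | none => ret (.inr ())) ()

theorem runs_pushExt {Ext : Type} [DecidableEq Ext] (k : Ext) (a : CNFSym ⊕ X)
    (s : Store Ext (CNFSym ⊕ X)) :
    Runs (Routine.push (.inl k) a) ω s ()
      { s with ext := Function.update s.ext k (a :: s.ext k) } 1 := by
  refine ⟨1, le_rfl, ?_⟩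
  rw [Store.toMemory_setExt]
  exact Routine.path_push _ _ _

theorem runs_popExt {Ext : Type} [DecidableEq Ext] (k : Ext) (s : Store Ext (CNFSym ⊕ X)) :
    Runs (Routine.pop (.inl k)) ω s (s.ext k).head?
      { s with ext := Function.update s.ext k (s.ext k).tail } 1 := by
  refine ⟨1, le_rfl, ?_⟩
  rw [Store.toMemory_setExt]
  exact Routine.path_pop _ _

theorem runs_load [Finite X] (s : Store A.K (CNFSym ⊕ X)) :
    Runs (load A) ω s ()
      { s with
        net := []
        ext := Function.update s.ext A.inStack (s.net.reverse ++ s.ext A.inStack) }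
      (4 * s.net.length + 3) := by
  induction hn : s.net generalizing s with
  | nil =>
    have h_get : s.get .net = [] := hn
    refine Runs.loop_exit (Runs.mono (T := 1 + 2) ((runs_pop _).bind ?_) (by simp))
    rw [h_get]
    refine (runs_ret _).congr rfl ?_ le_rfl
    simp [Store.set]
  | cons a w ih =>
    have h_get : s.get .net = a :: w := hn
    refine Runs.congr (Runs.loop_again (T := 1 + (1 + 2)) (y := ()) ((runs_pop _).bind ?_)
      (ih (s := { s with
        net := w
        ext := Function.update s.ext A.inStack (a :: s.ext A.inStack) }) rfl)) rfl ?_ ?_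
    · rw [h_get]
      exact (runs_pushExt _ _ _).andThen (runs_ret _)
    · simp
    · simp only [List.length_cons]
      omega

end Call

end Code

/-! ### Judging a number -/

namespace Code

/-- The number `0.b₁b₂…` has a digit `1` among the first `N` digits. -/
def fracVerdict : List NumSym → ℕ → Bool
  | .digit true :: _, _ + 1 => true
  | .digit false :: w, N + 1 => fracVerdict w N
  | _, _ => false

/-- The number is positive and has a digit `1` up to the `N`-th digit after the point. -/
def verdict : List NumSym → ℕ → Bool
  | .digit true :: _, _ => true
  | .digit false :: w, N => verdict w N
  | .point :: w, N => fracVerdict w N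
  | _, _ => false

theorem fracValue_nonneg (fp : List Bool) : 0 ≤ fracValue fp := by
  induction fp with
  | nil => simp [fracValue]
  | cons b l ih => rw [fracValue]; split_ifs <;> positivity

theorem fracValue_le_one (fp : List Bool) : fracValue fp ≤ 1 := by
  induction fp with
  | nil => simp [fracValue]
  | cons b l ih => rw [fracValue]; split_ifs <;> linarith

theorem fracVerdict_spec (fp : List Bool) (N : ℕ) :
    (fracVerdict (fp.map .digit) N = true → (1 / 2 : ℝ) ^ N ≤ fracValue fp) ∧
      (fracVerdict (fp.map .digit) N = false → fracValue fp ≤ (1 / 2 : ℝ) ^ N) := by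
  induction fp generalizing N with
  | nil =>
    refine ⟨by simp [fracVerdict], fun _ => ?_⟩
    simp [fracValue]
  | cons b l ih =>
    have h_nonneg := fracValue_nonneg l
    cases N with
    | zero =>
      refine ⟨by simp [fracVerdict], fun _ => ?_⟩
      simpa using fracValue_le_one (b :: l)
    | succ N =>
      have hN : (1 / 2 : ℝ) ^ N ≤ 1 := pow_le_one₀ (by norm_num) (by norm_num)
      cases b with
      | true =>
        refine ⟨fun _ => ?_, by simp [fracVerdict]⟩
        rw [fracValue, pow_succ, if_pos rfl]
        linarith
      | false =>
        simp only [List.map_cons, fracVerdict, fracValue, pow_succ, Bool.false_eq_true, if_false]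
        exact ⟨fun h => by linarith [(ih N).1 h], fun h => by linarith [(ih N).2 h]⟩

theorem foldl_digits_le (ip : List Bool) (v : ℝ) (hv : 0 ≤ v) :
    v ≤ ip.foldl (fun v b => 2 * v + (if b then 1 else 0)) v := by
  induction ip generalizing v with
  | nil => rfl
  | cons b l ih =>
    rw [List.foldl_cons]
    have h_step : v ≤ 2 * v + (if b then 1 else 0 : ℝ) := by split_ifs <;> linarith
    exact h_step.trans (ih _ (hv.trans h_step))

theorem verdict_spec (neg : Bool) (ip fp : List Bool) (N : ℕ) :
    (verdict (numeral neg ip fp) N = true → (1 / 2 : ℝ) ^ N ≤ numeralValue neg ip fp) ∧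
      (verdict (numeral neg ip fp) N = false → numeralValue neg ip fp ≤ (1 / 2 : ℝ) ^ N) := by
  have h_nonneg := fracValue_nonneg fp
  have hN : (1 / 2 : ℝ) ^ N ≤ 1 := pow_le_one₀ (by norm_num) (by norm_num)
  cases neg with
  | true =>
    refine ⟨by simp [numeral, verdict], fun _ => ?_⟩
    have h_int := foldl_digits_le ip 0 le_rfl
    have h_pow : (0 : ℝ) ≤ (1 / 2) ^ N := by positivity
    simp only [numeralValue, if_true]
    linarith
  | false =>
    simp only [numeral, numeralValue, Bool.false_eq_true, if_false, List.nil_append, one_mul]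
    induction ip with
    | nil => simpa [verdict] using fracVerdict_spec fp N
    | cons b l ih =>
      cases b with
      | true =>
        refine ⟨fun _ => ?_, by simp [verdict]⟩
        have h_int := foldl_digits_le l 1 (by norm_num)
        simp only [List.foldl_cons, if_true, mul_zero, zero_add]
        linarith
      | false => simpa [verdict] using ih

section Judge

variable {ι X : Type} [Finite X] (A : ProbMachine ι NumSym) (emb : A.Γ → CNFSym ⊕ X)
  (rd : CNFSym ⊕ X → Option A.Γ) {ω : ℕ → Bool}

/-- Read a symbol of the output of `A`. -/
def judgeSym {F : Type} (f : Option NumSym → Code A.K X F) : Code A.K X F :=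
  bind (Routine.pop (.inl A.outStack)) fun o => f ((o.bind rd).map A.outSym)

/-- What a symbol before the point means: read on before (`inl false`) or after (`inl true`) the
point, or stop with a verdict. -/
def intStep : Option NumSym → Bool ⊕ Bool
  | some (.digit true) => .inr true
  | some (.digit false) => .inl false
  | some .point => .inl true
  | _ => .inr false

/-- What a symbol after the point means: read on, or stop with a verdict. -/
def fracStep : Option NumSym → Bool ⊕ Bool
  | some (.digit true) => .inr true
  | some (.digit false) => .inl true
  | _ => .inr false

/-- Judge one digit after the point if `precision` is not exhausted. -/
def judgeFracSym : Code A.K X (Bool ⊕ Bool) :=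
  (pop .precision).bind fun
    | none => ret (.inr false)
    | some _ => judgeSym A rd fun o => ret (fracStep o)

/-- Judge the output of `A`, up to as many digits after the point as there are symbols in
`precision`; the state tells whether the point has been read. -/
def judge : Bool → Code A.K X Bool :=
  loop (S := Bool) fun
    | false => judgeSym A rd fun o => ret (intStep o)
    | true => judgeFracSym A rd

theorem runs_judgeSym (hrd : ∀ a, rd (emb a) = some a) {F : Type}
    {f : Option NumSym → Code A.K X F} {s s' : Store A.K (CNFSym ⊕ X)} {w : List A.Γ}
    (hw : s.ext A.outStack = w.map emb) {e : F} {T : ℕ}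
    (h : Runs (f (w.map A.outSym).head?) ω
      { s with ext := Function.update s.ext A.outStack (w.tail.map emb) } e s' T) :
    Runs (judgeSym A rd f) ω s e s' (1 + T) := by
  refine (runs_popExt _ _).bind ?_
  rw [hw]
  convert h using 2
  · cases w <;> simp [hrd]
  · simp

theorem runs_judgeIntSym (hrd : ∀ a, rd (emb a) = some a) {s : Store A.K (CNFSym ⊕ X)}
    {w : List A.Γ} (hw : s.ext A.outStack = w.map emb) :
    Runs (judgeSym A rd fun o => ret (intStep o)) ω s (intStep (w.map A.outSym).head?)
      { s with ext := Function.update s.ext A.outStack (w.tail.map emb) } 3 :=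
  runs_judgeSym A emb rd hrd (f := fun o => ret (intStep o)) hw (runs_ret _)

theorem runs_judgeFracSym_nil {s : Store A.K (CNFSym ⊕ X)} (hs : s.precision = []) :
    Runs (judgeFracSym A rd) ω s (.inr false) { s with precision := [] } 3 := by
  have h_get : s.get .precision = [] := hs
  refine (runs_pop (Ext := A.K) .precision).bind (T' := 2) ?_
  rw [h_get]
  exact runs_ret _

theorem runs_judgeFracSym_cons (hrd : ∀ a, rd (emb a) = some a) {s : Store A.K (CNFSym ⊕ X)}
    {a : CNFSym ⊕ X} {l : List (CNFSym ⊕ X)} (hs : s.precision = a :: l) {w : List A.Γ}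
    (hw : s.ext A.outStack = w.map emb) :
    Runs (judgeFracSym A rd) ω s (fracStep (w.map A.outSym).head?)
      { s with
        precision := l
        ext := Function.update s.ext A.outStack (w.tail.map emb) } 4 := by
  have h_get : s.get .precision = a :: l := hs
  refine (runs_pop _).bind (T' := 3) ?_
  rw [h_get]
  exact runs_judgeSym A emb rd hrd (f := fun o => ret (fracStep o))
    (s := { s with precision := l }) hw (runs_ret _)

theorem runs_judge_frac (hrd : ∀ a, rd (emb a) = some a) {s : Store A.K (CNFSym ⊕ X)}
    {w : List A.Γ} (hw : s.ext A.outStack = w.map emb) :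
    ∃ s', Runs (judge A rd true) ω s (fracVerdict (w.map A.outSym) s.precision.length) s'
      (4 * w.length + 4) ∧ s'.answer = s.answer := by
  induction w generalizing s with
  | nil =>
    cases h_precision : s.precision with
    | nil =>
      exact ⟨_, Runs.loop_exit ((runs_judgeFracSym_nil A rd h_precision).mono (by simp)), rfl⟩
    | cons a l =>
      exact ⟨_, Runs.loop_exit (runs_judgeFracSym_cons A emb rd hrd h_precision hw), rfl⟩
  | cons b w ih =>
    cases h_precision : s.precision with
    | nil =>
      have h_verdict : fracVerdict ((b :: w).map A.outSym) 0 = false := by simp [fracVerdict]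
      rw [List.length_nil, h_verdict]
      exact ⟨_, Runs.loop_exit ((runs_judgeFracSym_nil A rd h_precision).mono (by simp)), rfl⟩
    | cons a l =>
      have h_sym := runs_judgeFracSym_cons (ω := ω) A emb rd hrd h_precision hw
      simp only [List.map_cons, List.length_cons]
      simp only [List.map_cons, List.head?_cons, List.tail_cons] at h_sym
      generalize A.outSym b = x at h_sym ⊢
      rcases x with _ | _ | (_ | _)
      · exact ⟨_, Runs.loop_exit (h_sym.mono (by omega)), rfl⟩
      · exact ⟨_, Runs.loop_exit (h_sym.mono (by omega)), rfl⟩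
      · obtain ⟨s', h_run, h_answer⟩ := ih (s := { s with
          precision := l
          ext := Function.update s.ext A.outStack (w.map emb) }) (by simp)
        exact ⟨s', (Runs.loop_again h_sym h_run).mono (by omega), h_answer⟩
      · exact ⟨_, Runs.loop_exit (h_sym.mono (by omega)), rfl⟩

theorem runs_judge (hrd : ∀ a, rd (emb a) = some a) {s : Store A.K (CNFSym ⊕ X)}
    {w : List A.Γ} (hw : s.ext A.outStack = w.map emb) :
    ∃ s', Runs (judge A rd false) ω s (verdict (w.map A.outSym) s.precision.length) s'
      (4 * w.length + 4) ∧ s'.answer = s.answer := by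
  induction w generalizing s with
  | nil => exact ⟨_, Runs.loop_exit ((runs_judgeIntSym A emb rd hrd hw).mono (by simp)), rfl⟩
  | cons b w ih =>
    have h_sym := runs_judgeIntSym (ω := ω) A emb rd hrd hw
    simp only [List.map_cons, List.head?_cons, List.tail_cons] at h_sym
    have h_rest : (Function.update s.ext A.outStack (w.map emb)) A.outStack = w.map emb := by simp
    simp only [List.map_cons, List.length_cons]
    generalize A.outSym b = x at h_sym ⊢
    rcases x with _ | _ | (_ | _)
    · exact ⟨_, Runs.loop_exit (h_sym.mono (by omega)), rfl⟩
    · obtain ⟨s', h_run, h_answer⟩ := runs_judge_frac (ω := ω) A emb rd hrd (s := { s with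
        ext := Function.update s.ext A.outStack (w.map emb) }) h_rest
      exact ⟨s', (Runs.loop_again h_sym h_run).mono (by omega), h_answer⟩
    · obtain ⟨s', h_run, h_answer⟩ := ih (s := { s with
        ext := Function.update s.ext A.outStack (w.map emb) }) h_rest
      exact ⟨s', (Runs.loop_again h_sym h_run).mono (by omega), h_answer⟩
    · exact ⟨_, Runs.loop_exit (h_sym.mono (by omega)), rfl⟩

end Judge

end Code

/-! ### Deciding satisfiability with an approximation algorithm -/

/-- The network of `α` on which the approximation algorithm is called. Its matrix has
`2 ^ (2 * quarterInputs C α)` essential rows; the even exponent makes the norms comparable with a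
power of `1 / 2`. -/
def CNF.query {θr : Finset ℝ} (θ : Finset ℝ) [Inhabited θ] (C : ℕ) (α : CNF) {p : ℕ}
    (W₁ : Matrix (Fin p) (Fin 1) θr) (b₁ : Fin p → θr) (rest : Net θr p) :
    Net θ (2 * (2 * α.quarterInputs C)) :=
  CNF.net θ (2 * (2 * α.quarterInputs C)) α W₁ b₁ rest

namespace Code

section Consult

variable {ι X : Type} (A : ProbMachine ι NumSym)

/-- A symbol of `A` as a symbol of the calling machine. -/
def outerSym (a : A.Γ) : CNFSym ⊕ (X ⊕ A.Γ) := .inr (.inr a)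

/-- The symbol of `A` that is written as a symbol of the calling machine. -/
def innerSym : CNFSym ⊕ (X ⊕ A.Γ) → Option A.Γ
  | .inr (.inr a) => some a
  | _ => none

variable [Finite X] {ω : ℕ → Bool}

/-- Pass the contents of `net` to `A` and raise the precision by one. -/
def prepare : Code A.K (X ⊕ A.Γ) Unit :=
  (load A).andThen (push .precision (.inl .tick))

/-- Run `A` on the contents of `net` and judge the result. -/
def consult : Code A.K (X ⊕ A.Γ) Bool :=
  (prepare A).andThen <| (call A (outerSym A) (innerSym A)).andThen (judge A (innerSym A) false)

variable {s : Store A.K (CNFSym ⊕ (X ⊕ A.Γ))} {x : List ι}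

theorem runs_prepare (h_net : s.net = (x.map fun a => outerSym A (A.inSym a)).reverse)
    (h_ext : s.ext = fun _ => []) (h_coins : s.coins = 0) :
    Runs (prepare A) ω s () (withCfg A (outerSym A)
      { s with
        net := []
        precision := .inl .tick :: s.precision } (A.init x)) (4 * x.length + 4) := by
  have h_stacks : Function.update s.ext A.inStack (s.net.reverse ++ s.ext A.inStack) =
      fun k => ((A.init x).stk k).map (outerSym A) := by
    funext k
    by_cases hk : k = A.inStack
    · subst hk
      simp [h_net, h_ext, ProbMachine.init]
    · simp [h_ext, ProbMachine.init, hk]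
  refine ((runs_load A s).andThen (runs_push .precision (.inl .tick))).congr rfl ?_ ?_
  · simp [withCfg, Store.set, Store.get, ProbMachine.init, h_stacks, h_coins]
  · simp [h_net]

theorem runs_consult (h_net : s.net = (x.map fun a => outerSym A (A.inSym a)).reverse)
    (h_ext : s.ext = fun _ => []) (h_coins : s.coins = 0) {t : ℕ}
    (h_halted : A.Halted (A.run x ω t)) :
    ∃ s', Runs (consult A) ω s (verdict (((A.run x ω t).stk A.outStack).map A.outSym)
      (s.precision.length + 1)) s' (8 * x.length + 5 * t + 10) ∧ s'.answer = s.answer := by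
  obtain ⟨s', h_judge, h_answer⟩ := runs_judge (ω := ω) A (outerSym A) (innerSym A)
    (fun _ => rfl) (s := withCfg A (outerSym A)
      { s with
        net := []
        precision := .inl .tick :: s.precision } (A.run x ω t))
    (w := (A.run x ω t).stk A.outStack) rfl
  have h_output : ((A.run x ω t).stk A.outStack).length ≤ x.length + t :=
    ProbMachine.length_outStack_le t
  refine ⟨s', ((runs_prepare A h_net h_ext h_coins).andThen
    ((runs_call A (outerSym A) (innerSym A) (fun _ => rfl) _ h_halted).andThen h_judge)).mono ?_,
    h_answer⟩
  omega

end Consult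

section Decide

variable {θr θ : Finset ℝ} [Inhabited θ] {k C : ℕ} (A : ProbMachine (NetSym θ) NumSym)
  {p : ℕ} (W₁ : Matrix (Fin p) (Fin 1) θr) (b₁ : Fin p → θr) (rest : Net θr p)

/-- Decide a formula by calling `A` on its network. -/
def decideByNet (k C : ℕ) : Code A.K (Cell k ⊕ A.Γ) Bool :=
  (writeNet C (fun x => outerSym A (A.inSym x)) W₁ b₁ rest).andThen (consult A)

theorem exists_runs_decideByNet (hk : 1 ≤ k) (hC : 1 ≤ C) :
    ∃ a : ℕ, ∀ α : CNF, (∀ c ∈ α, c.length ≤ k) → ∀ ω t,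
      A.Halted (A.run (encodeNet (α.query θ C W₁ b₁ rest)) ω t) →
        ∃ s', Runs (decideByNet A W₁ b₁ rest k C) ω (initStore A.K (encodeCNF α))
          (verdict (((A.run (encodeNet (α.query θ C W₁ b₁ rest)) ω t).stk A.outStack).map A.outSym)
            (α.quarterInputs C + 1)) s'
          (a * ((encodeCNF α).length + α.length + α.quarterInputs C + 1) ^ 2 + 5 * t) ∧
        s'.answer = [] := by
  obtain ⟨a, ha⟩ := exists_runs_writeNet (Ext := A.K) (Y := A.Γ) hk hC
    (fun x => outerSym A (A.inSym x)) W₁ b₁ rest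
  refine ⟨9 * a + 10, fun α hα ω t h_halted => ?_⟩
  obtain ⟨s, h_write, h_ext, h_answer, h_coins, h_precision, h_net⟩ := ha α hα ω
  obtain ⟨s', h_consult, h_answer'⟩ := runs_consult A h_net h_ext h_coins h_halted
  have h_length := h_write.length_net_le
  simp only [h_precision, List.length_replicate] at h_consult
  simp only [h_net, List.length_reverse, List.length_map, initStore, List.length_nil,
    Nat.zero_add] at h_length
  refine ⟨s', (h_write.andThen h_consult).mono ?_, h_answer'.trans h_answer⟩
  generalize (encodeCNF α).length + α.length + α.quarterInputs C = N at *
  nlinarith [Nat.one_le_pow 2 (N + 1) N.succ_pos]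

theorem verdict_eq_of_abs_sub_lt {neg : Bool} {ip fp : List Bool} {N : ℕ} {y : ℝ} {b : Bool}
    (h : |numeralValue neg ip fp - y| < (1 / 2 : ℝ) ^ N) (h_zero : b = false → y = 0)
    (h_le : b = true → 2 * (1 / 2 : ℝ) ^ N ≤ y) : verdict (numeral neg ip fp) N = b := by
  obtain ⟨h_true, h_false⟩ := verdict_spec neg ip fp N
  rw [abs_lt] at h
  cases b with
  | false =>
    rw [h_zero rfl] at h
    exact Bool.eq_false_of_not_eq_true fun h_verdict => by linarith [h_true h_verdict]
  | true =>
    have h_le := h_le rfl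
    by_contra h_verdict
    linarith [h_false (Bool.eq_false_of_not_eq_true h_verdict)]

theorem two_thirds_le_yields_decideByNet {σ : ℝ → ℝ} {W₁ : Matrix (Fin p) (Fin 1) θr}
    {b₁ : Fin p → θr} {rest : Net θr p} (hΨ : (Net.layer W₁ b₁ rest).IsStep σ) (hk : 1 ≤ k)
    (hC : 1 ≤ C) (hθ : cnfWeights k θr ⊆ (θ : Set ℝ)) {α : CNF} (hα : ∀ c ∈ α, c.length ≤ k)
    {d : ℕ} (hd : 2 * α.quarterInputs C ≤ d) {ε : ℝ}
    (hε : ε ≤ (1 / 2 : ℝ) ^ (α.quarterInputs C + 1))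
    (hA : Approximates A (encodeNet (α.query θ C W₁ b₁ rest))
      (mvmRatio (netMatrix σ d (α.query θ C W₁ b₁ rest))) ε)
    {b : Bool} (hb : b = true ↔ α.Satisfiable) :
    2 / 3 ≤ coinMeasure {ω | Yields (decideByNet A W₁ b₁ rest k C) ω α b} := by
  obtain ⟨a, ha⟩ := exists_runs_decideByNet A W₁ b₁ rest hk hC
  refine hA.trans (measure_mono ?_)
  rintro ω ⟨neg, ip, fp, ⟨t, h_halted, h_output⟩, h_approx⟩
  obtain ⟨s', h_run, h_answer⟩ := ha α hα ω t h_halted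
  have h_vars := CNF.lt_quarterInputs hC α
  have h_sqrt : √((2 : ℝ) ^ (2 * α.quarterInputs C))⁻¹ =
      2 * (1 / 2 : ℝ) ^ (α.quarterInputs C + 1) := by
    rw [pow_mul', Real.sqrt_inv, Real.sqrt_sq (by positivity), pow_succ, one_div, inv_pow]
    ring
  have h_verdict : verdict (numeral neg ip fp) (α.quarterInputs C + 1) = b := by
    refine verdict_eq_of_abs_sub_lt (h_approx.trans_le hε) (fun h_false => ?_) fun h_true => ?_
    · exact CNF.mvmRatio_net_eq_zero hΨ hk hθ hα h_vars (by simp [← hb, h_false]) d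
    · exact h_sqrt.ge.trans (CNF.le_mvmRatio_net hΨ hk hθ hα h_vars (hb.1 h_true) hd)
  rw [h_output, h_verdict] at h_run
  exact ⟨s', _, h_run, h_answer⟩

end Decide

end Code

theorem CNF.query_mem_mvmClass {k C wr Lr : ℕ} {σ : ℝ → ℝ} {θr θ : Finset ℝ} [Inhabited θ] {p : ℕ}
    {W₁ : Matrix (Fin p) (Fin 1) θr} {b₁ : Fin p → θr} {rest : Net θr p}
    (hΨ : (Net.layer W₁ b₁ rest).IsStep σ) (hmem : Net.layer W₁ b₁ rest ∈ netClass 1 wr Lr θr)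
    (hk : 2 ≤ k) (hC : 1 ≤ C) (hθ : cnfWeights k θr ⊆ (θ : Set ℝ)) {α : CNF}
    (hα : ∀ c ∈ α, c.length ≤ k) {n : ℕ} (hn : 2 * α.quarterInputs C ≤ n) :
    (⟨2 * α.quarterInputs C, α.query θ C W₁ b₁ rest⟩ : Σ ℓ : ℕ, Net θ (2 * ℓ)) ∈
      mvmClass σ k C wr Lr θ n :=
  CNF.net_mem_mvmClass hΨ hmem hk hθ hα (by unfold CNF.quarterInputs; omega) hn
    (CNF.length_lt_quarterInputs hC α)

theorem CNF.query_size_le {k C n : ℕ} (hC : 1 ≤ C) {α : CNF} (hα : α ∈ sparseKCNF k C n) :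
    (encodeCNF α).length + α.length + α.quarterInputs C + 1 ≤
      (C * (k + 2) + 8) * (n + 1) ^ 2 := by
  have h_code := length_encodeCNF_le_of_sparse hα
  have h_clauses : α.length ≤ C * (n + 1) ^ 2 :=
    hα.2.trans (Nat.mul_le_mul_left _ (by nlinarith))
  have h_inputs := CNF.quarterInputs_le hC (fun c hc => (hα.1 c hc).2) hα.2
  nlinarith

theorem rpow_tolerance_le {s δ : ℝ} (hs : s ≤ 1 + δ) (h : ℕ) :
    (2 : ℝ) ^ (-(1 / 2 + 1 - s + δ) * ((2 * h : ℕ) : ℝ)) / 2 ≤ (1 / 2 : ℝ) ^ (h + 1) := by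
  have h_pow : (1 / 2 : ℝ) ^ h = (2 : ℝ) ^ (-(h : ℝ)) := by
    rw [Real.rpow_neg zero_le_two, Real.rpow_natCast, one_div, inv_pow]
  rw [pow_succ, h_pow, mul_one_div]
  gcongr
  · exact one_le_two
  · push_cast
    nlinarith [h.cast_nonneg (α := ℝ)]

theorem floor_mul_rpow_le {c t : ℝ} (hc : 0 ≤ c) (n : ℕ) :
    (⌊c * (2 : ℝ) ^ (t / 2 * ((n : ℝ) + 7))⌋₊ : ℝ) ≤
      c * (2 : ℝ) ^ (t / 2 * 7) * (2 : ℝ) ^ (t / 2 * (n : ℝ)) := by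
  refine (Nat.floor_le (by positivity)).trans_eq ?_
  rw [mul_assoc, ← Real.rpow_add two_pos]
  ring_nf

section Main

variable {k C wr Lr : ℕ} {σ : ℝ → ℝ} {θr θ : Finset ℝ} [Inhabited θ] {p : ℕ}
  {W₁ : Matrix (Fin p) (Fin 1) θr} {b₁ : Fin p → θr} {rest : Net θr p}
  {A : ProbMachine (NetSym θ) NumSym} {t : ℝ}

theorem exists_runs_decideByNet_of_runsInExpTime (hΨ : (Net.layer W₁ b₁ rest).IsStep σ)
    (hmem : Net.layer W₁ b₁ rest ∈ netClass 1 wr Lr θr) (hk : 2 ≤ k) (hC : 1 ≤ C)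
    (hθ : cnfWeights k θr ⊆ (θ : Set ℝ)) (ht : 0 ≤ t)
    (hT : A.RunsInExpTime
      (fun n => (fun Φ : (Σ ℓ : ℕ, Net θ (2 * ℓ)) => encodeNet Φ.2) '' mvmClass σ k C wr Lr θ n)
      t) :
    ∃ (a : ℕ) (c : ℝ), 0 ≤ c ∧ ∀ α : CNF, (∀ c ∈ α, c.length ≤ k) → ∀ ω, ∃ (b : Bool) (s' : _)
      (τ : ℕ), (Code.decideByNet A W₁ b₁ rest k C).Runs ω (Code.initStore A.K (encodeCNF α)) b s'
        (a * ((encodeCNF α).length + α.length + α.quarterInputs C + 1) ^ 2 + 5 * τ) ∧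
      s'.answer = [] ∧ (τ : ℝ) ≤ c * (2 : ℝ) ^ (t * ((2 * α.quarterInputs C : ℕ) : ℝ)) := by
  obtain ⟨a, ha⟩ := Code.exists_runs_decideByNet A W₁ b₁ rest (by omega : 1 ≤ k) hC
  obtain ⟨c, hc, h_halts⟩ := hT.exists_halted ht
  refine ⟨a, c, hc, fun α hα ω => ?_⟩
  obtain ⟨τ, h_halted, hτ⟩ := h_halts _ (encodeNet (α.query θ C W₁ b₁ rest)) (fun m hm =>
    Set.mem_image_of_mem _ (CNF.query_mem_mvmClass hΨ hmem hk hC hθ hα hm)) ω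
  obtain ⟨s', h_run, h_answer⟩ := ha α hα ω τ h_halted
  exact ⟨_, s', τ, h_run, h_answer, hτ⟩

theorem runsInExpTime_decideByNet (hΨ : (Net.layer W₁ b₁ rest).IsStep σ)
    (hmem : Net.layer W₁ b₁ rest ∈ netClass 1 wr Lr θr) (hk : 2 ≤ k) (hC : 1 ≤ C)
    (hθ : cnfWeights k θr ⊆ (θ : Set ℝ)) (ht : 0 < t)
    (hT : A.RunsInExpTime
      (fun n => (fun Φ : (Σ ℓ : ℕ, Net θ (2 * ℓ)) => encodeNet Φ.2) '' mvmClass σ k C wr Lr θ n)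
      t) :
    (Code.decider k (Code.decideByNet A W₁ b₁ rest k C)).RunsInExpTime
      (fun n => encodeCNF '' sparseKCNF k C n) (t / 2) := by
  obtain ⟨a, c, hc, h_run⟩ :=
    exists_runs_decideByNet_of_runsInExpTime hΨ hmem hk hC hθ ht.le hT
  set D := 10 * (C * (k + 1)) + 7 + a * (C * (k + 2) + 8) ^ 2 with hD
  refine Code.runsInExpTime_decider
    (B := fun n => D * (n + 1) ^ 4 + 5 * ⌊c * (2 : ℝ) ^ (t / 2 * ((n : ℝ) + 7))⌋₊)
    (c := 1 + 5 * (c * (2 : ℝ) ^ (t / 2 * 7))) (fun n α hα ω => ?_) ?_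
  · obtain ⟨b, s', τ, h_run, h_answer, hτ⟩ := h_run α (fun c hc => (hα.1 c hc).1) ω
    refine ⟨b, s', _, h_run, h_answer, ?_⟩
    have h_inputs : (2 : ℝ) * (2 * α.quarterInputs C : ℕ) ≤ n + 7 := by
      exact_mod_cast CNF.quarterInputs_le hC (fun c hc => (hα.1 c hc).2) hα.2
    have h_floor : τ ≤ ⌊c * (2 : ℝ) ^ (t / 2 * ((n : ℝ) + 7))⌋₊ := by
      have h_exponent : t * (2 * α.quarterInputs C : ℕ) ≤ t / 2 * (n + 7) := by nlinarith
      refine Nat.le_floor (hτ.trans (mul_le_mul_of_nonneg_left ?_ hc))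
      exact Real.rpow_le_rpow_of_exponent_le one_le_two h_exponent
    have h_size := Nat.mul_le_mul_left a (Nat.pow_le_pow_left (CNF.query_size_le hC hα) 2)
    have h_length := length_encodeCNF_le_of_sparse hα
    have h_pow : (n + 1) ^ 2 ≤ (n + 1) ^ 4 := Nat.pow_le_pow_right n.succ_pos (by norm_num)
    calc _ ≤ 10 * (C * (k + 1) * (n + 1) ^ 4) + 7 * (n + 1) ^ 4 +
          (a * ((C * (k + 2) + 8) * (n + 1) ^ 2) ^ 2 +
            5 * ⌊c * (2 : ℝ) ^ (t / 2 * ((n : ℝ) + 7))⌋₊) := by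
          gcongr
          · exact h_length.trans (Nat.mul_le_mul_left _ h_pow)
          · exact Nat.le_mul_of_pos_right _ (by positivity)
      _ = _ := by rw [hD]; ring
  · filter_upwards [eventually_mul_pow_le D 4 (half_pos ht)] with n hn
    have h_floor := floor_mul_rpow_le (t := t) hc n
    push_cast
    linarith

theorem two_mul_sTilde_le (hΨ : (Net.layer W₁ b₁ rest).IsStep σ)
    (hmem : Net.layer W₁ b₁ rest ∈ netClass 1 wr Lr θr) (hk : 2 ≤ k) (hC : 1 ≤ C)
    (hθ : cnfWeights k θr ⊆ (θ : Set ℝ)) {δ : ℝ} (hδ : 0 ≤ δ) {d : ℕ → ℕ} (hd : ∀ n, n ≤ d n)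
    (hA : ∀ n : ℕ, 1 ≤ n →
      ∀ Φ ∈ mvmClass σ k C wr Lr θ n \ mvmClass σ k C wr Lr θ (n - 1),
        Approximates A (encodeNet Φ.2) (mvmRatio (netMatrix σ (d n) Φ.2))
          ((2 : ℝ) ^ (-(1 / 2 + 1 - sTilde k C + δ) * (n : ℝ)) / 2))
    (ht : 0 < t)
    (hT : A.RunsInExpTime
      (fun n => (fun Φ : (Σ ℓ : ℕ, Net θ (2 * ℓ)) => encodeNet Φ.2) '' mvmClass σ k C wr Lr θ n)
      t) :
    2 * sTilde k C ≤ t := by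
  have h_correct : ∀ (α : CNF), (∀ c ∈ α, c.length ≤ k) → ∀ b, (b = true ↔ α.Satisfiable) →
      2 / 3 ≤ coinMeasure {ω | Code.Yields (Code.decideByNet A W₁ b₁ rest k C) ω α b} := by
    intro α hα b hb
    have h_pos : 1 ≤ α.quarterInputs C := Nat.succ_le_succ (Nat.zero_le _)
    refine Code.two_thirds_le_yields_decideByNet A hΨ (by omega) hC hθ hα (hd _)
      (rpow_tolerance_le ((sTilde_le_one k C).trans (by linarith)) _) (hA _ (by omega)
        ⟨_, α.query θ C W₁ b₁ rest⟩ ⟨CNF.query_mem_mvmClass hΨ hmem hk hC hθ hα le_rfl, ?_⟩) hb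
    intro h
    have h_le : 2 * α.quarterInputs C ≤ 2 * α.quarterInputs C - 1 := h.2.1
    omega
  obtain ⟨a, c, -, h_run⟩ := exists_runs_decideByNet_of_runsInExpTime hΨ hmem hk hC hθ ht.le hT
  have h_le : sTilde k C ≤ t / 2 := sTilde_le (half_pos ht)
    (Code.decidesKSAT_decider
      (fun α hα ω => by
        obtain ⟨b, s', τ, h_run, h_answer, -⟩ := h_run α hα ω
        exact ⟨b, s', _, h_run, h_answer⟩)
      (fun α hα hsat => h_correct α hα true (by simpa))
      fun α hα hsat => h_correct α hα false (by simpa))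
    (runsInExpTime_decideByNet hΨ hmem hk hC hθ ht hT)
  linarith

end Main

end

theorem theorem5p2_general {k C : ℕ} (hk : 1 ≤ k) (hC : 1 ≤ C) {σ : ℝ → ℝ} {wr Lr : ℕ}
    {θr : Finset ℝ} {Ψ : Net θr 1} (hΨ : Ψ ∈ netClass 1 wr Lr θr) (h_step : Ψ.IsStep σ)
    {θ : Finset ℝ} (hθ : cnfWeights k θr ⊆ (θ : Set ℝ)) {δ : ℝ} (hδ : 0 ≤ δ) {d : ℕ → ℕ}
    (hd : ∀ n, n ≤ d n) {A : ProbMachine (NetSym θ) NumSym}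
    (hA : ∀ n : ℕ, 1 ≤ n →
      ∀ Φ ∈ mvmClass σ k C wr Lr θ n \ mvmClass σ k C wr Lr θ (n - 1),
        Approximates A (encodeNet Φ.2) (mvmRatio (netMatrix σ (d n) Φ.2))
          ((2 : ℝ) ^ (-(1 / 2 + 1 - sTilde k C + δ) * (n : ℝ)) / 2))
    {t : ℝ} (ht : 0 < t)
    (hT : A.RunsInExpTime
      (fun n => (fun Φ : (Σ ℓ : ℕ, Net θ (2 * ℓ)) => encodeNet Φ.2) '' mvmClass σ k C wr Lr θ n)
      t) :
    2 * sTilde k C ≤ t := by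
  rcases hk.eq_or_lt with rfl | hk
  · linarith [sTilde_one_le C (half_pos ht)]
  · have : Inhabited θ := ⟨⟨0, cnfWeights.zero_mem hθ⟩⟩
    cases Ψ with
    | last W b => exact (h_step.ne_last W b rfl).elim
    | layer W₁ b₁ rest => exact two_mul_sTilde_le h_step hΨ hk hC hθ hδ hd hA ht hT

theorem theorem5p2 (k C : ℕ) (hk : 1 ≤ k) (hC : 1 ≤ C)
    (σ : ℝ → ℝ) (wr Lr : ℕ) (θr : Finset ℝ) (Ψ : Net θr 1) (hΨ : Ψ ∈ netClass 1 wr Lr θr)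
    (r : ℝ → ℝ) (hr_cont : Continuous r) (hr_mem : ∀ x, r x ∈ Set.Icc (0 : ℝ) 1)
    (η : ℝ) (hη : 0 < η) (hη' : η < 1 / 2)
    (hr_zero : ∀ x, x ≤ 1 / 2 → r x = 0) (hr_one : ∀ x, 1 - η ≤ x → r x = 1)
    (hr_net : ∀ x : ℝ, Ψ.realize σ (fun _ => x) = r x)
    (θ : Finset ℝ) (hθ : cnfWeights k θr ⊆ (θ : Set ℝ))
    (δ : ℝ) (hδ : 0 < δ) (d : ℕ → ℕ) (hd : ∀ n, n ≤ d n)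
    (A : ProbMachine (NetSym θ) NumSym)
    (hA : ∀ n : ℕ, 1 ≤ n →
      ∀ Φ ∈ mvmClass σ k C wr Lr θ n \ mvmClass σ k C wr Lr θ (n - 1),
        Approximates A (encodeNet Φ.2) (mvmRatio (netMatrix σ (d n) Φ.2))
          ((2 : ℝ) ^ (-(1 / 2 + 1 - sTilde k C + δ) * (n : ℝ)) / 2))
    (t : ℝ) (ht : 0 < t)
    (hT : A.RunsInExpTime
      (fun n => (fun Φ : (Σ ℓ : ℕ, Net θ (2 * ℓ)) => encodeNet Φ.2) '' mvmClass σ k C wr Lr θ n) t) :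
    2 * sTilde k C ≤ t :=
  theorem5p2_general hk hC hΨ
    ⟨fun x => hr_net x ▸ hr_mem x, fun x hx => (hr_net x).trans (hr_zero x (by linarith)),
      fun x hx => (hr_net x).trans (hr_one x (by linarith))⟩
    hθ hδ.le hd hA ht hT
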